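/- Let $R$ be a finite commutative chain ring (a finite commutative local ring with principal maximal ideal) with maximal ideal $\gamma R$ of nilpotency index $e\ge 2$ (so $\gamma^e=0\neq\gamma^{e-1}$) and residue field $\overline R=R/\gamma R$ of order $q$. Let $1\le s<e$, let $\check R=R/\gamma^sR$, and let $a,b$ be positive integers. An $R\check R$-linear code of block-length $(a,b)$ is an $R$-submodule $C$ of $M=R^a\oplus\check R^b$. Equip $M$ with the Euclidean inner product $$\langle (c\,|\,d),(c'\,|\,d')\rangle=\sum_{i=1}^a c_ic'_i+\gamma^{e-s}\sum_{j=1}^b d_jd'_j\in R,$$ where $\gamma^{e-s}(x+\gamma^sR)$ denotes the well-defined element $\gamma^{e-s}x\in R$. The code $C$ is called Euclidean LCD if $C\cap C^{\perp}=\{0\}$, where $C^\perp=\{m\in M:\langle m,m'\rangle=0\text{ for all }m'\in C\}$. Then the number $\mathscr L$ of Euclidean $R\check R$-LCD codes of block-length $(a,b)$ is $$\mathscr L=\sum_{k_0=0}^{a}\sum_{\ell_0=0}^{b}L_q(a,k_0)\,L_q(b,\ell_0)\,q^{(a-k_0)(s\ell_0+(e-1)k_0)+(b-\ell_0)(sk_0+(s-1)\ell_0)}.$$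 Here, for $n\ge1$ and $0\le r\le n$, $L_q(n,r)$ is the number of $r$-dimensional subspaces $E\subseteq\overline R^{\,n}$ with $E\cap E^{\perp}=\{0\}$ for the standard dot product (Euclidean LCD codes of length $n$ and dimension $r$ over $\overline R\cong\mathbb F_q$), and it is given explicitly as follows. Write ${n\brack 0}_Q=1$ and ${n\brack r}_Q=\prod_{i=0}^{r-1}\frac{Q^n-Q^i}{Q^r-Q^i}$. Then $L_q(n,0)=L_q(n,n)=1$, and for $1\le r\le n-1$: (a) if $q$ is even, $$L_q(n,r)=\begin{cases} q^{\frac{(n-r)(r+1)}2}{(n-1)/2\brack (r-1)/2}_{q^2} & n,r\text{ odd},\\[2pt] q^{\frac{nr-r^2+n-1}2}{(n-2)/2\brack (r-1)/2}_{q^2} & n\text{ even},\ r\text{ odd},\\[2pt] q^{\frac{r(n-r+1)}2}{(n-1)/2\brack r/2}_{q^2} & n\text{ odd},\ r\text{ even},\\[2pt] q^{\frac{nr-r^2-2}2}\Bigl((q^r+q-1){(n-2)/2\brack r/2}_{q^2}+(q^{n-r+1}-q^{n-r}+1){(n-2)/2\brack (r-2)/2}_{q^2}\Bigr) & n,r\text{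 even}; \end{cases}$$ (b) if $q$ is odd, $$L_q(n,r)=\begin{cases} q^{\frac{(n-r)(r+1)}2}{(n-1)/2\brack (r-1)/2}_{q^2} & n,r\text{ odd},\\[2pt] q^{\frac{nr-r^2-1}2}(q^{n/2}-1){(n-2)/2\brack (r-1)/2}_{q^2} & n\text{ even},\ r\text{ odd, and either } q\equiv1\ (\mathrm{mod}\ 4)\text{, or both } n\equiv0\ (\mathrm{mod}\ 4)\text{ and }q\equiv3\ (\mathrm{mod}\ 4),\\[2pt] q^{\frac{nr-r^2-1}2}(q^{n/2}+1){(n-2)/2\brack (r-1)/2}_{q^2} & n\equiv2\ (\mathrm{mod}\ 4),\ r\text{ odd},\ q\equiv3\ (\mathrm{mod}\ 4),\\[2pt] q^{\frac{r(n-r+1)}2}{(n-1)/2\brack r/2}_{q^2} & n\text{ odd},\ r\text{ even},\\[2pt] q^{\frac{r(n-r)}2}{n/2\brack r/2}_{q^2} & n,r\text{ even}. \end{cases}$$ -/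

import Mathlib

/-- The ring `Ř = R / γ^s R`. -/
abbrev RCheck {R : Type*} [CommRing R] (γ : R) (s : ℕ) : Type _ :=
  R ⧸ Ideal.span {γ ^ s}

/-- The ambient `R`-module `M = R^a ⊕ Ř^b`. Its `R`-submodules are the `RŘ`-linear codes of
block-length `(a, b)`. -/
abbrev MixedSpace {R : Type*} [CommRing R] (γ : R) (s a b : ℕ) : Type _ :=
  (Fin a → R) × (Fin b → RCheck γ s)

/-- The `R`-linear map `Ř → R`, `x + γ^s R ↦ γ^(e-s) x`, which is well defined since `γ^e = 0`.
It gives the meaning of `γ^(e-s) d` in `R` for `d` in `Ř`. -/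
def scaleMap {R : Type*} [CommRing R] (γ : R) {s e : ℕ} (hs : s ≤ e) (he : γ ^ e = 0) :
    RCheck γ s →ₗ[R] R :=
  Submodule.liftQ (Ideal.span {γ ^ s}) (LinearMap.mulLeft R (γ ^ (e - s))) (by
    rw [Ideal.span, Submodule.span_le, Set.singleton_subset_iff]
    change γ ^ (e - s) * γ ^ s = 0
    rw [← pow_add, Nat.sub_add_cancel hs, he])

theorem scaleMap_mk {R : Type*} [CommRing R] (γ : R) {s e : ℕ} (hs : s ≤ e) (he : γ ^ e = 0)
    (x : R) : scaleMap γ hs he (Ideal.Quotient.mk _ x) = γ ^ (e - s) * x := rfl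

/-- The Euclidean inner product `∑ cᵢ c'ᵢ + γ^(e-s) ∑ dⱼ d'ⱼ` on `M = R^a ⊕ Ř^b`,
with values in `R`. -/
def mixedInner {R : Type*} [CommRing R] (γ : R) {s e : ℕ} (hs : s ≤ e) (he : γ ^ e = 0)
    {a b : ℕ} (x y : MixedSpace γ s a b) : R :=
  ∑ i, x.1 i * y.1 i + scaleMap γ hs he (∑ j, x.2 j * y.2 j)

/-- The Euclidean dual code of an `RŘ`-linear code. -/
def mixedDual {R : Type*} [CommRing R] (γ : R) {s e : ℕ} (hs : s ≤ e) (he : γ ^ e = 0)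
    {a b : ℕ} (C : Submodule R (MixedSpace γ s a b)) : Submodule R (MixedSpace γ s a b) where
  carrier := {x | ∀ y ∈ C, mixedInner γ hs he x y = 0}
  zero_mem' := by
    intro y _
    simp [mixedInner]
  add_mem' := by
    intro x x' hx hx' y hy
    have h1 := hx y hy
    have h2 := hx' y hy
    simp only [mixedInner] at h1 h2 ⊢
    simp only [Prod.fst_add, Prod.snd_add, Pi.add_apply, add_mul, Finset.sum_add_distrib, map_add]
    linear_combination h1 + h2
  smul_mem' := by
    intro r x hx y hy
    have h1 := hx y hy
    simp only [mixedInner] at h1 ⊢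
    simp only [Prod.smul_fst, Prod.smul_snd, Pi.smul_apply, smul_mul_assoc, ← Finset.smul_sum,
      map_smul, ← smul_add, h1, smul_zero]

/-- An `RŘ`-linear code is Euclidean LCD if it meets its Euclidean dual code trivially. -/
def IsMixedLCD {R : Type*} [CommRing R] (γ : R) {s e : ℕ} (hs : s ≤ e) (he : γ ^ e = 0)
    {a b : ℕ} (C : Submodule R (MixedSpace γ s a b)) : Prop :=
  C ⊓ mixedDual γ hs he C = ⊥

/-- A linear code `C ⊆ K^n` over a field is Euclidean LCD if the only codeword orthogonal to all
of `C`, for the standard dot product, is the zero word, i.e. `C ∩ C^⊥ = {0}`. -/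
def IsFieldLCD {K : Type*} [Field K] {n : ℕ} (C : Submodule K (Fin n → K)) : Prop :=
  ∀ x ∈ C, (∀ y ∈ C, x ⬝ᵥ y = 0) → x = 0

/-- The number of Euclidean LCD codes of length `n` and dimension `r` over the field `K`. -/
noncomputable def fieldLCDCount (K : Type*) [Field K] (n r : ℕ) : ℕ :=
  Nat.card {C : Submodule K (Fin n → K) // Module.finrank K C = r ∧ IsFieldLCD C}

/-- The Gaussian binomial coefficient `[n, r]_Q`, for `Q > 1`. -/
def qBinom (Q : ℚ) (n r : ℕ) : ℚ :=
  (∏ i ∈ Finset.range r, (Q ^ n - Q ^ i)) / ∏ i ∈ Finset.range r, (Q ^ r - Q ^ i)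

/-- The explicit number `L_q(n, r)`, for a prime power `q` and `0 ≤ r ≤ n`. In each case the
truncated subtractions and the halvings in exponents and arguments are exact. -/
def lcdFormula (q n r : ℕ) : ℚ :=
  if r = 0 ∨ r = n then 1
  else if Even q then
    if Odd n ∧ Odd r then
      (q : ℚ) ^ ((n - r) * (r + 1) / 2) * qBinom ((q : ℚ) ^ 2) ((n - 1) / 2) ((r - 1) / 2)
    else if Even n ∧ Odd r then
      (q : ℚ) ^ ((n * r - r ^ 2 + n - 1) / 2) *
        qBinom ((q : ℚ) ^ 2) ((n - 2) / 2) ((r - 1) / 2)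
    else if Odd n ∧ Even r then
      (q : ℚ) ^ (r * (n - r + 1) / 2) * qBinom ((q : ℚ) ^ 2) ((n - 1) / 2) (r / 2)
    else
      (q : ℚ) ^ ((n * r - r ^ 2 - 2) / 2) *
        (((q : ℚ) ^ r + q - 1) * qBinom ((q : ℚ) ^ 2) ((n - 2) / 2) (r / 2) +
          ((q : ℚ) ^ (n - r + 1) - (q : ℚ) ^ (n - r) + 1) *
            qBinom ((q : ℚ) ^ 2) ((n - 2) / 2) ((r - 2) / 2))
  else
    if Odd n ∧ Odd r then
      (q : ℚ) ^ ((n - r) * (r + 1) / 2) * qBinom ((q : ℚ) ^ 2) ((n - 1) / 2) ((r - 1) / 2)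
    else if Even n ∧ Odd r then
      if q % 4 = 1 ∨ (n % 4 = 0 ∧ q % 4 = 3) then
        (q : ℚ) ^ ((n * r - r ^ 2 - 1) / 2) * ((q : ℚ) ^ (n / 2) - 1) *
          qBinom ((q : ℚ) ^ 2) ((n - 2) / 2) ((r - 1) / 2)
      else
        (q : ℚ) ^ ((n * r - r ^ 2 - 1) / 2) * ((q : ℚ) ^ (n / 2) + 1) *
          qBinom ((q : ℚ) ^ 2) ((n - 2) / 2) ((r - 1) / 2)
    else if Odd n ∧ Even r then
      (q : ℚ) ^ (r * (n - r + 1) / 2) * qBinom ((q : ℚ) ^ 2) ((n - 1) / 2) (r / 2)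
    else
      (q : ℚ) ^ (r * (n - r) / 2) * qBinom ((q : ℚ) ^ 2) (n / 2) (r / 2)

open Module

/-! The count has two layers: codes over the chain ring are fibred over pairs of LCD codes over the
residue field, and the latter are counted as nondegenerate subspaces.

Chain ring. A code `C` has two residue codes: the reduction `X` of its first block, and the
reduction `W` of the second block of the codewords killed by `γ ^ s`. Characters of the finite group
`C` show that an LCD code satisfies `M = C ⊕ C^⊥` (`isCompl_mixedDual`). The residue codes of `C`
and `C^⊥` are then orthogonal and together span, so `X` and `W` are nondegenerate. Conversely, a
direct summand with nondegenerate residue codes is LCD (`isMixedLCD_of_isCompl`): a nonzero vector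
of `C ∩ C^⊥` has a nonzero multiple killed by `γ`, and orthogonality to `C` makes its leading
coefficients fall into the radicals of `W` and `X`. Fix nondegenerate `X`, `W` of dimensions `k`,
`l`, and lift `X^⊥`, `W^⊥` to a summand `D`. The LCD codes over `(X, W)` are exactly the complements
of `D` with residue codes inside `X` and `W` (`isMixedLCD_and_res_eq_iff`), that is, graphs of
linear maps with vanishing residues (`ncard_isCompl_res_le`). Such maps are given by free values of
the generators in two explicit finite groups, which yields the power of `q` (`ncard_smallHoms`).

Field, `q` odd. Nondegenerate subspaces are sorted by the quadratic character of the discriminant,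
read off from Gauss sums. Double counting pairs (subspace, vector of a fixed norm in it) and
splitting off the vector gives, by induction, a quotient `|O_n| / (|O_r| |O_{n-r}|)` for each sign
(`ncard_nondegSub_hasDisc`); the two signs are added.

Field, `q` even. The map `x ↦ B(x, x)` is additive, and a nondegenerate subspace is either
alternating or contains vectors of norm 1. Alternating spaces are counted by hyperbolic pairs
(`ncard_nondegSub_of_altOn`). In the other case unit vectors are split off; the complement is
alternating for exactly one unit vector in odd dimension and for none in even dimension
(`altCenter`). This gives an induction alternating between even and odd subspace dimension
(`evenCount_oddCount`). -/

theorem apply_eq_zero_of_mem_sup {R M : Type*} [CommRing R] [AddCommGroup M] [Module R M]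
    {B : LinearMap.BilinForm R M} {E F : Submodule R M} {x : M} (hE : ∀ y ∈ E, B x y = 0)
    (hF : ∀ y ∈ F, B x y = 0) : ∀ y ∈ E ⊔ F, B x y = 0 := by
  intro y hy
  obtain ⟨u, hu, v, hv, rfl⟩ := Submodule.mem_sup.1 hy
  rw [map_add, hE u hu, hF v hv, add_zero]

/-! ### Nondegenerate subspaces and orthogonal splitting. -/

section NondegenerateSubspaces

variable {K V : Type*} [Field K] [AddCommGroup V] [Module K V]

/-- The restriction of the bilinear form `B` to the subspace `E` is nondegenerate. -/
def NondegOn (B : LinearMap.BilinForm K V) (E : Submodule K V) : Prop :=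
  ∀ x ∈ E, (∀ y ∈ E, B x y = 0) → x = 0

/-- The nondegenerate `r`-dimensional subspaces of `F`. -/
def nondegSub (B : LinearMap.BilinForm K V) (F : Submodule K V) (r : ℕ) : Set (Submodule K V) :=
  {E | E ≤ F ∧ NondegOn B E ∧ finrank K E = r}

variable {B : LinearMap.BilinForm K V}

theorem NondegOn.disjoint (hB : B.IsSymm) {E : Submodule K V} (hE : NondegOn B E) :
    Disjoint E (B.orthogonal E) := by
  rw [Submodule.disjoint_def]
  intro x hx hx'
  exact hE x hx fun y hy => by rw [hB.eq]; exact hx' y hy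

variable [FiniteDimensional K V]

theorem NondegOn.isCompl (hB : B.IsSymm) {E : Submodule K V} (hE : NondegOn B E) :
    IsCompl E (B.orthogonal E) :=
  (LinearMap.BilinForm.isCompl_orthogonal_iff_disjoint
    (fun x y h => by rw [hB.eq, h])).2 (hE.disjoint hB)

theorem NondegOn.sup_inf_orthogonal (hB : B.IsSymm) {P F : Submodule K V} (hP : NondegOn B P)
    (hPF : P ≤ F) : P ⊔ F ⊓ B.orthogonal P = F := by
  rw [inf_comm, ← sup_inf_assoc_of_le _ hPF, (hP.isCompl hB).sup_eq_top, top_inf_eq]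

theorem NondegOn.finrank_inf_orthogonal (hB : B.IsSymm) {P F : Submodule K V} (hP : NondegOn B P)
    (hPF : P ≤ F) : finrank K P + finrank K (F ⊓ B.orthogonal P : Submodule K V) = finrank K F := by
  have h := Submodule.finrank_sup_add_finrank_inf_eq P (F ⊓ B.orthogonal P)
  rw [hP.sup_inf_orthogonal hB hPF, ((hP.disjoint hB).mono_right inf_le_right).eq_bot,
    finrank_bot, add_zero] at h
  exact h.symm

theorem NondegOn.inf_orthogonal (hB : B.IsSymm) {P F : Submodule K V} (hP : NondegOn B P)
    (hF : NondegOn B F) (hPF : P ≤ F) : NondegOn B (F ⊓ B.orthogonal P) := by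
  intro x hx h
  refine hF x hx.1 ?_
  rw [← hP.sup_inf_orthogonal hB hPF]
  exact apply_eq_zero_of_mem_sup (fun y hy => by rw [hB.eq]; exact hx.2 y hy) h

omit [FiniteDimensional K V] in
theorem NondegOn.sup (hB : B.IsSymm) {P E : Submodule K V} (hP : NondegOn B P)
    (hE : NondegOn B E) (h : E ≤ B.orthogonal P) : NondegOn B (P ⊔ E) := by
  intro x hx hxy
  obtain ⟨u, hu, v, hv, rfl⟩ := Submodule.mem_sup.1 hx
  have h1 : u = 0 := hP u hu fun y hy => by
    have := hxy y (Submodule.mem_sup_left hy)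
    rwa [map_add, LinearMap.add_apply, hB.eq v, h hv y hy, add_zero] at this
  have h2 : v = 0 := hE v hv fun y hy => by
    have := hxy y (Submodule.mem_sup_right hy)
    rwa [map_add, LinearMap.add_apply, h hy u hu, zero_add] at this
  rw [h1, h2, add_zero]

omit [FiniteDimensional K V] in
theorem NondegOn.sup_inf_cancel (hB : B.IsSymm) {P E : Submodule K V} (hP : NondegOn B P)
    (h : E ≤ B.orthogonal P) : (P ⊔ E) ⊓ B.orthogonal P = E := by
  rw [sup_comm, sup_inf_assoc_of_le _ h, (hP.disjoint hB).eq_bot, sup_bot_eq]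

/-- Nondegenerate subspaces of `F` through a nondegenerate `P` correspond to nondegenerate
subspaces of the orthogonal complement of `P` in `F`. -/
theorem ncard_nondegSub_through (hB : B.IsSymm) {P F : Submodule K V} (hP : NondegOn B P)
    (hPF : P ≤ F) (r : ℕ) (p : Submodule K V → Prop) :
    {E | E ∈ nondegSub B F (finrank K P + r) ∧ p E ∧ P ≤ E}.ncard =
      {E | E ∈ nondegSub B (F ⊓ B.orthogonal P) r ∧ p (P ⊔ E)}.ncard := by
  have : {E | E ∈ nondegSub B F (finrank K P + r) ∧ p E ∧ P ≤ E} =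
      (P ⊔ ·) '' {E | E ∈ nondegSub B (F ⊓ B.orthogonal P) r ∧ p (P ⊔ E)} := by
    ext E
    constructor
    · rintro ⟨⟨hEF, hE, hr⟩, hpE, hPE⟩
      have hs := hP.sup_inf_orthogonal hB hPE
      refine ⟨E ⊓ B.orthogonal P, ⟨⟨inf_le_inf_right _ hEF, hP.inf_orthogonal hB hE hPE, ?_⟩, ?_⟩,
        hs⟩
      · have := hP.finrank_inf_orthogonal hB hPE
        omega
      · rwa [hs]
    · rintro ⟨E', ⟨⟨hEF, hE, hr⟩, hpE⟩, rfl⟩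
      have hle := hEF.trans inf_le_right
      refine ⟨⟨sup_le hPF (hEF.trans inf_le_left), hP.sup hB hE hle, ?_⟩, hpE, le_sup_left⟩
      have := hP.finrank_inf_orthogonal hB (le_sup_left : P ≤ P ⊔ E')
      rw [hP.sup_inf_cancel hB hle] at this
      dsimp only
      omega
  rw [this, Set.InjOn.ncard_image]
  intro E₁ h₁ E₂ h₂ h
  rw [← hP.sup_inf_cancel hB (h₁.1.1.trans inf_le_right), ← hP.sup_inf_cancel hB
    (h₂.1.1.trans inf_le_right)]
  exact congrArg (· ⊓ B.orthogonal P) h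

omit [FiniteDimensional K V] in
theorem nondegOn_span_singleton {v : V} (hv : B v v ≠ 0) : NondegOn B (K ∙ v) := by
  intro x hx h
  obtain ⟨c, rfl⟩ := Submodule.mem_span_singleton.1 hx
  have := h v (Submodule.mem_span_singleton_self v)
  rw [map_smul, LinearMap.smul_apply, smul_eq_mul] at this
  rw [(mul_eq_zero.1 this).resolve_right hv, zero_smul]

omit [FiniteDimensional K V] in
theorem mem_orthogonal_span_singleton {v x : V} :
    x ∈ B.orthogonal (K ∙ v) ↔ B v x = 0 := by
  rw [LinearMap.BilinForm.mem_orthogonal_iff]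
  constructor
  · exact fun h => h v (Submodule.mem_span_singleton_self v)
  · rintro h y hy
    obtain ⟨c, rfl⟩ := Submodule.mem_span_singleton.1 hy
    rw [map_smul, LinearMap.smul_apply, h, smul_zero]

theorem nondegSub_zero (F : Submodule K V) :
    nondegSub B F 0 = {⊥} := by
  ext E
  rw [Set.mem_singleton_iff]
  constructor
  · rintro ⟨-, -, h⟩
    exact Submodule.finrank_eq_zero.1 h
  · rintro rfl
    exact ⟨bot_le, fun x hx _ => (Submodule.mem_bot K).1 hx, finrank_bot K V⟩

omit [FiniteDimensional K V] in
theorem nondegOn_bot : NondegOn B ⊥ := fun _ hx _ => (Submodule.mem_bot K).1 hx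

end NondegenerateSubspaces

/-! ### Double counting. -/

/-- Double counting of a relation whose fibres over the two parts of `T` and over `S` have constant
sizes. -/
theorem ncard_mul_eq_add_of_fibers {α β : Type*} [Finite α] [Finite β] {S : Set α} {T₁ T₂ : Set β}
    (hT : Disjoint T₁ T₂) (rel : α → β → Prop) {m n₁ n₂ : ℚ}
    (hS : ∀ a ∈ S, ({b | b ∈ T₁ ∪ T₂ ∧ rel a b}.ncard : ℚ) = m)
    (h₁ : ∀ b ∈ T₁, ({a | a ∈ S ∧ rel a b}.ncard : ℚ) = n₁)
    (h₂ : ∀ b ∈ T₂, ({a | a ∈ S ∧ rel a b}.ncard : ℚ) = n₂) :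
    (S.ncard : ℚ) * m = T₁.ncard * n₁ + T₂.ncard * n₂ := by
  classical
  cases nonempty_fintype α
  cases nonempty_fintype β
  have key := congrArg (Nat.cast : ℕ → ℚ)
    (Finset.sum_card_bipartiteAbove_eq_sum_card_bipartiteBelow rel
      (s := S.toFinset) (t := T₁.toFinset ∪ T₂.toFinset))
  rw [Finset.sum_union (by simpa using hT)] at key
  push_cast at key
  have hA : ∀ a ∈ S.toFinset,
      ((Finset.bipartiteAbove rel (T₁.toFinset ∪ T₂.toFinset) a).card : ℚ) = m := by
    intro a ha
    rw [← hS a (by simpa using ha), ← Set.ncard_coe_finset]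
    congr 2
    ext b
    simp [Finset.bipartiteAbove]
  have hB : ∀ (T : Set β) (n : ℚ), (∀ b ∈ T, ({a | a ∈ S ∧ rel a b}.ncard : ℚ) = n) →
      ∀ b ∈ T.toFinset, ((Finset.bipartiteBelow rel S.toFinset b).card : ℚ) = n := by
    intro T n h b hb
    rw [← h b (by simpa using hb), ← Set.ncard_coe_finset]
    congr 2
    ext a
    simp [Finset.bipartiteBelow]
  rw [Finset.sum_congr rfl hA, Finset.sum_congr rfl (hB T₁ n₁ h₁),
    Finset.sum_congr rfl (hB T₂ n₂ h₂)] at key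
  simpa only [Set.ncard_eq_toFinset_card', Finset.sum_const, nsmul_eq_mul] using key

/-- Double counting of a relation with fibres of constant sizes. -/
theorem ncard_mul_eq_of_fibers {α β : Type*} [Finite α] [Finite β] {S : Set α} {T : Set β}
    (rel : α → β → Prop) {m n : ℚ}
    (hS : ∀ a ∈ S, ({b | b ∈ T ∧ rel a b}.ncard : ℚ) = m)
    (hT : ∀ b ∈ T, ({a | a ∈ S ∧ rel a b}.ncard : ℚ) = n) :
    (S.ncard : ℚ) * m = T.ncard * n := by
  have := ncard_mul_eq_add_of_fibers (T₁ := T) (T₂ := ∅) (n₂ := 0) (S := S) (m := m) (by simp) rel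
    (by simpa using hS) hT (by simp)
  simpa using this

/-! ### Odd characteristic: discriminants and representation numbers through Gauss sums. -/

section OddCharacteristic

variable {K V : Type*} [Field K] [AddCommGroup V] [Module K V] [Fintype K] [DecidableEq K]
  [Fintype V] {B : LinearMap.BilinForm K V}

open Classical in
/-- The exponential sum `∑ x ∈ E, ψ (t B(x, x))`. -/
noncomputable def quadSum (ψ : AddChar K ℂ) (B : LinearMap.BilinForm K V) (E : Submodule K V)
    (t : K) : ℂ :=
  ∑ x : E, ψ (t * B x x)

/-- The quadratic character with complex values. -/
noncomputable def quadCharC (K : Type*) [Field K] [Fintype K] [DecidableEq K] : MulChar K ℂ :=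
  (quadraticChar K).ringHomComp (Int.castRingHom ℂ)

theorem quadCharC_apply (a : K) : quadCharC K a = (quadraticChar K a : ℂ) := rfl

/-- The subspace `E` has discriminant of quadratic character `ε`, expressed through its
exponential sums. -/
def HasDisc (ψ : AddChar K ℂ) (B : LinearMap.BilinForm K V) (E : Submodule K V) (ε : ℤ) : Prop :=
  ∀ t : K, t ≠ 0 →
    quadSum ψ B E t = quadCharC K t ^ finrank K E * ε * gaussSum (quadCharC K) ψ ^ finrank K E

-- The cross terms of `B` vanish on an orthogonal sum, so the character of the norm factors over the
-- two summands.
omit [DecidableEq K] [Fintype K] in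
theorem quadSum_sup (hB : B.IsSymm) (ψ : AddChar K ℂ) {P E : Submodule K V} (hP : NondegOn B P)
    (h : E ≤ B.orthogonal P) (t : K) :
    quadSum ψ B (P ⊔ E) t = quadSum ψ B P t * quadSum ψ B E t := by
  classical
  have hd : Disjoint P E := (hP.disjoint hB).mono_right h
  let f : P × E → (P ⊔ E : Submodule K V) := fun x =>
    ⟨x.1 + x.2, Submodule.add_mem_sup x.1.2 x.2.2⟩
  have hf : Function.Bijective f := by
    constructor
    · rintro ⟨x, y⟩ ⟨x', y'⟩ hxy
      have hxy : (x : V) + y = x' + y' := congrArg Subtype.val hxy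
      have := Submodule.disjoint_def.1 hd (x - x') (P.sub_mem x.2 x'.2) (by
        have : (x : V) - x' = y' - y := by
          rw [sub_eq_sub_iff_add_eq_add, hxy, add_comm]
        rw [this]; exact E.sub_mem y'.2 y.2)
      have hx : (x : V) = x' := sub_eq_zero.1 this
      rw [hx] at hxy
      exact Prod.ext (Subtype.ext hx) (Subtype.ext (add_left_cancel hxy))
    · rintro ⟨z, hz⟩
      obtain ⟨u, hu, v, hv, rfl⟩ := Submodule.mem_sup.1 hz
      exact ⟨(⟨u, hu⟩, ⟨v, hv⟩), rfl⟩
  unfold quadSum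
  rw [Finset.sum_mul_sum, ← Finset.sum_product', Finset.univ_product_univ,
    ← (Equiv.ofBijective f hf).sum_comp]
  refine Finset.sum_congr rfl fun x _ => ?_
  have h1 : B (x.1 : V) x.2 = 0 := h x.2.2 x.1 x.1.2
  have h2 : B (x.2 : V) x.1 = 0 := by rw [hB.eq, h1]
  change ψ (t * B ((x.1 : V) + x.2) (x.1 + x.2)) = _
  rw [← AddChar.map_add_eq_mul]
  simp only [map_add, LinearMap.add_apply, h1, h2]
  ring_nf

/-- The element `a` has `1 + χ(a)` square roots. The constant part sums to zero because the shifted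
character is nontrivial, and the rest is a shifted Gauss sum. -/
theorem sum_addChar_mul_sq (hK : ringChar K ≠ 2) {ψ : AddChar K ℂ} (hψ : ψ ≠ 1) {c : K}
    (hc : c ≠ 0) :
    ∑ x : K, ψ (c * x ^ 2) = quadCharC K c * gaussSum (quadCharC K) ψ := by
  have h1 : ∑ x : K, ψ (c * x ^ 2) = ∑ a : K, ((quadraticChar K a : ℂ) + 1) * ψ (c * a) := by
    rw [← Finset.sum_fiberwise Finset.univ (fun x : K => x ^ 2) (fun x => ψ (c * x ^ 2))]
    refine Finset.sum_congr rfl fun a _ => ?_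
    have hs := quadraticChar_card_sqrts hK a
    rw [Finset.sum_congr rfl (g := fun _ => ψ (c * a)), Finset.sum_const, nsmul_eq_mul]
    · congr 1
      have : ({x | x ^ 2 = a} : Finset K) = {x : K | x ^ 2 = a}.toFinset := by ext; simp
      rw [this]
      exact_mod_cast congrArg (Int.cast : ℤ → ℂ) hs
    · intro x hx
      rw [(Finset.mem_filter.1 hx).2]
  have h2 : ∑ a : K, ψ (c * a) = 0 :=
    AddChar.sum_eq_zero_of_ne_one (ψ := ψ.mulShift c) (AddChar.IsPrimitive.of_ne_one hψ hc)
  have h3 := gaussSum_mulShift (quadCharC K) ψ (Units.mk0 c hc)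
  have h4 : quadCharC K c * quadCharC K c = 1 := by
    rw [quadCharC_apply]
    exact_mod_cast (pow_two (quadraticChar K c)).symm.trans (quadraticChar_sq_one hc)
  simp only [add_mul, one_mul, Finset.sum_add_distrib, h2, add_zero] at h1
  rw [h1, ← h3, Units.val_mk0, ← mul_assoc, h4, one_mul]
  rfl

theorem quadSum_span_singleton (hK : ringChar K ≠ 2) {ψ : AddChar K ℂ} (hψ : ψ ≠ 1) {v : V}
    (hv : B v v ≠ 0) {t : K} (ht : t ≠ 0) :
    quadSum ψ B (K ∙ v) t = quadCharC K (t * B v v) * gaussSum (quadCharC K) ψ := by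
  classical
  have hv0 : v ≠ 0 := by rintro rfl; simp at hv
  rw [← sum_addChar_mul_sq hK hψ (mul_ne_zero ht hv), quadSum,
    ← (LinearEquiv.toSpanNonzeroSingleton K V v hv0).toEquiv.sum_comp]
  refine Finset.sum_congr rfl fun a _ => ?_
  simp only [LinearEquiv.coe_toEquiv, LinearEquiv.toSpanNonzeroSingleton_apply, map_smul,
    LinearMap.smul_apply, smul_eq_mul]
  ring_nf

theorem quadCharC_ne_one (hK : ringChar K ≠ 2) : quadCharC K ≠ 1 :=
  (MulChar.ringHomComp_ne_one_iff (RingHom.injective_int _)).2 (quadraticChar_ne_one hK)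

theorem gaussSum_quadCharC_ne_zero (hK : ringChar K ≠ 2) {ψ : AddChar K ℂ} (hψ : ψ ≠ 1) :
    gaussSum (quadCharC K) ψ ≠ 0 :=
  gaussSum_ne_zero_of_nontrivial (by simp) (quadCharC_ne_one hK) (AddChar.IsPrimitive.of_ne_one hψ)

theorem gaussSum_quadCharC_sq (hK : ringChar K ≠ 2) {ψ : AddChar K ℂ} (hψ : ψ ≠ 1) :
    gaussSum (quadCharC K) ψ ^ 2 = quadraticChar K (-1) * Fintype.card K :=
  gaussSum_sq (quadCharC_ne_one hK) ((quadraticChar_isQuadratic K).comp _)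
    (AddChar.IsPrimitive.of_ne_one hψ)

/-- Comparing the exponential sums at `t = 1` suffices, since the Gauss sum is nonzero. -/
theorem HasDisc.unique (hK : ringChar K ≠ 2) {ψ : AddChar K ℂ} (hψ : ψ ≠ 1) {E : Submodule K V}
    {ε ε' : ℤ} (h : HasDisc ψ B E ε) (h' : HasDisc ψ B E ε') : ε = ε' := by
  have := (h 1 one_ne_zero).symm.trans (h' 1 one_ne_zero)
  rw [map_one, one_pow, one_mul, one_mul] at this
  exact_mod_cast mul_right_cancel₀ (pow_ne_zero _ (gaussSum_quadCharC_ne_zero hK hψ)) this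

/-- Multiplicativity of the discriminant when splitting off a line. -/
theorem HasDisc.of_inf_orthogonal (hB : B.IsSymm) (hK : ringChar K ≠ 2) {ψ : AddChar K ℂ}
    (hψ : ψ ≠ 1) {F : Submodule K V} {v : V} (hvF : v ∈ F) (hv : B v v ≠ 0) {ε : ℤ}
    (h : HasDisc ψ B (F ⊓ B.orthogonal (K ∙ v)) ε) :
    HasDisc ψ B F (quadraticChar K (B v v) * ε) := by
  intro t ht
  have hP := nondegOn_span_singleton hv
  have hv0 : v ≠ 0 := by rintro rfl; simp at hv
  have hPF : K ∙ v ≤ F := (Submodule.span_singleton_le_iff_mem v F).2 hvF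
  have hfin := hP.finrank_inf_orthogonal hB hPF
  rw [finrank_span_singleton hv0] at hfin
  conv_lhs => rw [← hP.sup_inf_orthogonal hB hPF]
  rw [quadSum_sup hB ψ hP inf_le_right, quadSum_span_singleton hK hψ hv ht, h t ht, ← hfin,
    map_mul, quadCharC_apply (B v v)]
  push_cast
  ring

-- By polarization, a form whose norms all vanish on `F` satisfies `2 B(x, y) = 0` there.
omit [Fintype K] [DecidableEq K] [Fintype V] in
theorem NondegOn.exists_apply_self_ne_zero (hB : B.IsSymm) (hK : ringChar K ≠ 2)
    {F : Submodule K V} (hF : NondegOn B F) (h0 : F ≠ ⊥) : ∃ v ∈ F, B v v ≠ 0 := by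
  by_contra! h
  obtain ⟨x, hx, hx0⟩ := (Submodule.ne_bot_iff F).1 h0
  refine hx0 (hF x hx fun y hy => ?_)
  have := h (x + y) (F.add_mem hx hy)
  simp only [map_add, LinearMap.add_apply, h x hx, h y hy, hB.eq y x, zero_add, add_zero] at this
  rw [← two_mul] at this
  exact (mul_eq_zero.1 this).resolve_left (Ring.two_ne_zero hK)

/-- Diagonalization: lines spanned by vectors of nonzero norm are split off one at a time, each
contributing the quadratic character of its norm. -/
theorem NondegOn.exists_hasDisc (hB : B.IsSymm) (hK : ringChar K ≠ 2) {ψ : AddChar K ℂ}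
    (hψ : ψ ≠ 1) {F : Submodule K V} (hF : NondegOn B F) :
    ∃ ε : ℤ, (ε = 1 ∨ ε = -1) ∧ HasDisc ψ B F ε := by
  classical
  induction hn : finrank K F generalizing F with
  | zero =>
    refine ⟨1, Or.inl rfl, fun t _ => ?_⟩
    obtain rfl : F = ⊥ := Submodule.finrank_eq_zero.1 hn
    have h : ∀ x : (⊥ : Submodule K V), ψ (t * B (x : V) x) = 1 := fun x => by
      rw [(Submodule.mem_bot K).1 x.2]; simp
    simp [quadSum, h]
  | succ n ih =>
    have h0 : F ≠ ⊥ := by rintro rfl; simp at hn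
    obtain ⟨v, hvF, hv⟩ := hF.exists_apply_self_ne_zero hB hK h0
    have hP := nondegOn_span_singleton hv
    have hv0 : v ≠ 0 := by rintro rfl; simp at hv
    have hPF : K ∙ v ≤ F := (Submodule.span_singleton_le_iff_mem v F).2 hvF
    have hfin := hP.finrank_inf_orthogonal hB hPF
    rw [finrank_span_singleton hv0] at hfin
    obtain ⟨ε, hε, h⟩ := ih (hP.inf_orthogonal hB hF hPF) (by omega)
    refine ⟨_, ?_, h.of_inf_orthogonal hB hK hψ hvF hv⟩
    rcases quadraticChar_dichotomy hv with hχ | hχ <;> rcases hε with rfl | rfl <;> rw [hχ] <;>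
      decide

/-- The complement has some sign by existence; `HasDisc.of_inf_orthogonal` and uniqueness determine
it, because `χ(B(v, v))` is its own inverse. -/
theorem HasDisc.inf_orthogonal (hB : B.IsSymm) (hK : ringChar K ≠ 2) {ψ : AddChar K ℂ}
    (hψ : ψ ≠ 1) {F : Submodule K V} (hF : NondegOn B F) {v : V} (hvF : v ∈ F) (hv : B v v ≠ 0)
    {ε : ℤ} (h : HasDisc ψ B F ε) :
    HasDisc ψ B (F ⊓ B.orthogonal (K ∙ v)) (quadraticChar K (B v v) * ε) := by
  have hPF : K ∙ v ≤ F := (Submodule.span_singleton_le_iff_mem v F).2 hvF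
  obtain ⟨ε', -, h'⟩ := ((nondegOn_span_singleton hv).inf_orthogonal hB hF hPF).exists_hasDisc
    hB hK hψ
  have := h.unique hK hψ (h'.of_inf_orthogonal hB hK hψ hvF hv)
  rwa [this, ← mul_assoc, ← pow_two, quadraticChar_sq_one hv, one_mul]

/-- The number of representations of `c` by the quadratic form, as an exponential sum. -/
theorem card_mul_ncard_eq {ψ : AddChar K ℂ} (hψ : ψ ≠ 1) (E : Submodule K V) (c : K) :
    (Fintype.card K : ℂ) * ({x | x ∈ E ∧ B x x = c}.ncard : ℂ) =
      ∑ t : K, ψ (-(t * c)) * quadSum ψ B E t := by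
  classical
  simp only [quadSum, Finset.mul_sum]
  rw [Finset.sum_comm]
  have h1 : ∀ x : E, ∑ t : K, ψ (-(t * c)) * ψ (t * B x x) =
      if B (x : V) x = c then (Fintype.card K : ℂ) else 0 := by
    intro x
    have := AddChar.sum_mulShift (B (x : V) x - c) (AddChar.IsPrimitive.of_ne_one hψ)
    simp only [sub_eq_zero, Nat.cast_ite, Nat.cast_zero] at this
    rw [← this]
    refine Finset.sum_congr rfl fun t _ => ?_
    rw [← AddChar.map_add_eq_mul]
    ring_nf
  rw [Finset.sum_congr rfl fun x _ => h1 x, ← Finset.sum_filter, Finset.sum_const, nsmul_eq_mul,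
    mul_comm]
  congr 2
  have : {x : V | x ∈ E ∧ B x x = c} =
      Subtype.val '' (({x : E | B (x : V) x = c} : Finset E) : Set E) := by
    ext x
    simp [and_comm]
  rw [this, Set.InjOn.ncard_image Subtype.val_injective.injOn, Set.ncard_coe_finset]

omit [DecidableEq K] in
theorem card_eq_pow (E : Submodule K V) :
    Nat.card E = Fintype.card K ^ finrank K E := by
  rw [← Nat.card_eq_fintype_card, Module.natCard_eq_pow_finrank (K := K)]

/-- The term `t = 0` of the exponential sum contributes the size of `E`; the others are evaluated by
the discriminant sign. -/
theorem card_mul_ncard_of_hasDisc {ψ : AddChar K ℂ} (hψ : ψ ≠ 1)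
    {E : Submodule K V} {ε : ℤ} (h : HasDisc ψ B E ε) (c : K) :
    (Fintype.card K : ℂ) * ({x | x ∈ E ∧ B x x = c}.ncard : ℂ) =
      (Fintype.card K : ℂ) ^ finrank K E + ε * gaussSum (quadCharC K) ψ ^ finrank K E *
        ∑ t ∈ Finset.univ.erase (0 : K), quadCharC K t ^ finrank K E * ψ (-(t * c)) := by
  classical
  rw [card_mul_ncard_eq hψ, ← Finset.add_sum_erase _ _ (Finset.mem_univ (0 : K))]
  congr 1
  · simp only [quadSum, zero_mul, neg_zero, AddChar.map_zero_eq_one, one_mul, Finset.sum_const,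
      nsmul_eq_mul, mul_one, Finset.card_univ]
    rw [← Nat.card_eq_fintype_card (α := E), card_eq_pow, Nat.cast_pow]
  · rw [Finset.mul_sum]
    refine Finset.sum_congr rfl fun t ht => ?_
    rw [h t (Finset.ne_of_mem_erase ht)]
    ring

theorem quadCharC_sq {a : K} (ha : a ≠ 0) : quadCharC K a ^ 2 = 1 := by
  rw [quadCharC_apply]
  exact_mod_cast quadraticChar_sq_one ha

/-- For even dimension `χ(t)^n = 1` when `t ≠ 0`, so the remaining sum is a full character sum
without its term at 0, namely `-1`. -/
theorem ncard_of_hasDisc_even (hK : ringChar K ≠ 2) {ψ : AddChar K ℂ} (hψ : ψ ≠ 1)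
    {E : Submodule K V} {ε : ℤ} (h : HasDisc ψ B E ε) {c : K} (hc : c ≠ 0) {m : ℕ}
    (hm : finrank K E = 2 * m) :
    (Fintype.card K : ℚ) * ({x | x ∈ E ∧ B x x = c}.ncard : ℚ) =
      (Fintype.card K : ℚ) ^ (2 * m) - quadraticChar K (-1) ^ m * ε * (Fintype.card K : ℚ) ^ m := by
  have key := card_mul_ncard_of_hasDisc hψ h c
  have hs : ∑ t ∈ Finset.univ.erase (0 : K), quadCharC K t ^ finrank K E * ψ (-(t * c)) = -1 := by
    have h0 : ∑ t : K, ψ (-(t * c)) = 0 := by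
      rw [← AddChar.sum_eq_zero_of_ne_one (ψ := ψ.mulShift (-c))
        (AddChar.IsPrimitive.of_ne_one hψ (neg_ne_zero.2 hc))]
      refine Finset.sum_congr rfl fun t _ => ?_
      rw [AddChar.mulShift_apply]; ring_nf
    rw [← Finset.add_sum_erase _ _ (Finset.mem_univ (0 : K)), zero_mul, neg_zero,
      AddChar.map_zero_eq_one] at h0
    rw [add_eq_zero_iff_neg_eq.1 h0]
    refine Finset.sum_congr rfl fun t ht => ?_
    rw [hm, pow_mul, quadCharC_sq (Finset.ne_of_mem_erase ht), one_pow, one_mul]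
  rw [hs, hm, pow_mul (gaussSum _ _), gaussSum_quadCharC_sq hK hψ] at key
  have : (Fintype.card K : ℂ) * ({x | x ∈ E ∧ B x x = c}.ncard : ℂ) =
      (Fintype.card K : ℂ) ^ (2 * m) - quadraticChar K (-1) ^ m * ε * (Fintype.card K : ℂ) ^ m := by
    rw [key]; ring
  exact_mod_cast this

/-- For odd dimension `χ(t)^n = χ(t)`, so one more Gauss sum appears; the total power of the Gauss
sum is then even and is evaluated by `gaussSum_quadCharC_sq`. -/
theorem ncard_of_hasDisc_odd (hK : ringChar K ≠ 2) {ψ : AddChar K ℂ} (hψ : ψ ≠ 1)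
    {E : Submodule K V} {ε : ℤ} (h : HasDisc ψ B E ε) {c : K} (hc : c ≠ 0) {m : ℕ}
    (hm : finrank K E = 2 * m + 1) :
    ({x | x ∈ E ∧ B x x = c}.ncard : ℚ) =
      (Fintype.card K : ℚ) ^ (2 * m) +
        quadraticChar K (-1) ^ m * ε * quadraticChar K c * (Fintype.card K : ℚ) ^ m := by
  have key := card_mul_ncard_of_hasDisc hψ h c
  have hs : ∑ t ∈ Finset.univ.erase (0 : K), quadCharC K t ^ finrank K E * ψ (-(t * c)) =
      quadCharC K (-c) * gaussSum (quadCharC K) ψ := by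
    have h3 := gaussSum_mulShift (quadCharC K) ψ (Units.mk0 (-c) (neg_ne_zero.2 hc))
    rw [← h3, Units.val_mk0, ← mul_assoc, ← pow_two, quadCharC_sq (neg_ne_zero.2 hc), one_mul,
      gaussSum, ← Finset.add_sum_erase _ _ (Finset.mem_univ (0 : K)), MulChar.map_zero, zero_mul,
      zero_add]
    refine Finset.sum_congr rfl fun t ht => ?_
    rw [hm, pow_succ, pow_mul, quadCharC_sq (Finset.ne_of_mem_erase ht), one_pow, one_mul,
      AddChar.mulShift_apply]
    ring_nf
  have hχ : quadCharC K (-c) = quadraticChar K (-1) * quadraticChar K c := by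
    rw [← quadCharC_apply, ← quadCharC_apply, ← map_mul, neg_one_mul]
  have hχ2 : (quadraticChar K (-1) : ℂ) ^ 2 = 1 := quadCharC_sq (neg_ne_zero.2 one_ne_zero)
  have hq : (Fintype.card K : ℂ) ≠ 0 := by simp
  rw [hs, hm, hχ] at key
  have : (Fintype.card K : ℂ) * ({x | x ∈ E ∧ B x x = c}.ncard : ℂ) = (Fintype.card K : ℂ) *
      ((Fintype.card K : ℂ) ^ (2 * m) +
        quadraticChar K (-1) ^ m * ε * quadraticChar K c * (Fintype.card K : ℂ) ^ m) := by
    rw [key]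
    have hg := gaussSum_quadCharC_sq hK hψ
    rw [show ∀ g : ℂ, (Fintype.card K : ℂ) ^ (2 * m + 1) + ε * g ^ (2 * m + 1) *
      (quadraticChar K (-1) * quadraticChar K c * g) = (Fintype.card K : ℂ) ^ (2 * m + 1) +
      ε * ((g ^ 2) ^ m * g ^ 2) * (quadraticChar K (-1) * quadraticChar K c) by intro g; ring, hg,
      mul_pow]
    linear_combination (Fintype.card K : ℂ) * ε * quadraticChar K c *
      quadraticChar K (-1) ^ m * (Fintype.card K : ℂ) ^ m * hχ2
  exact_mod_cast mul_left_cancel₀ hq this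

end OddCharacteristic

/-! ### Gaussian binomials and orders of orthogonal groups. -/

/-- `∏ i ∈ [1, m], (q ^ (2 i) - 1)`. -/
def evenProd (q : ℚ) (m : ℕ) : ℚ := ∏ i ∈ Finset.range m, (q ^ (2 * (i + 1)) - 1)

theorem evenProd_succ (q : ℚ) (m : ℕ) :
    evenProd q (m + 1) = evenProd q m * (q ^ (2 * (m + 1)) - 1) := Finset.prod_range_succ _ _

theorem evenProd_zero (q : ℚ) : evenProd q 0 = 1 := Finset.prod_range_zero _

theorem evenProd_pos {q : ℚ} (hq : 1 < q) (m : ℕ) : 0 < evenProd q m :=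
  Finset.prod_pos fun _ _ => sub_pos.2 (one_lt_pow₀ hq (by omega))

/-- With `Q = q^2`, each factor is `Q^m - Q^i = Q^i (Q^(m-i) - 1)`, and the factors `Q^(m-i) - 1`
complete `evenProd q (m - k)` to `evenProd q m`. -/
theorem prod_pow_sub_mul_evenProd {q : ℚ} {m k : ℕ} (h : k ≤ m) :
    (∏ i ∈ Finset.range k, ((q ^ 2) ^ m - (q ^ 2) ^ i)) * evenProd q (m - k) =
      (∏ i ∈ Finset.range k, (q ^ 2) ^ i) * evenProd q m := by
  induction k with
  | zero => simp
  | succ k ih =>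
    obtain ⟨d, rfl⟩ : ∃ d, m = k + 1 + d := ⟨m - (k + 1), by omega⟩
    have ih := ih (by omega)
    rw [show k + 1 + d - k = d + 1 by omega, evenProd_succ] at ih
    rw [Finset.prod_range_succ, Finset.prod_range_succ, show k + 1 + d - (k + 1) = d by omega]
    linear_combination (q ^ 2) ^ k * ih

theorem qBinom_sq {q : ℚ} (hq : 1 < q) {m k : ℕ} (h : k ≤ m) :
    qBinom (q ^ 2) m k = evenProd q m / (evenProd q k * evenProd q (m - k)) := by
  have h1 := prod_pow_sub_mul_evenProd (q := q) h
  have h2 := prod_pow_sub_mul_evenProd (q := q) le_rfl (k := k)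
  rw [Nat.sub_self, evenProd_zero, mul_one] at h2
  have h3 := (evenProd_pos hq k).ne'
  have h4 := (evenProd_pos hq (m - k)).ne'
  have h5 : (∏ i ∈ Finset.range k, (q ^ 2) ^ i) ≠ 0 :=
    Finset.prod_ne_zero_iff.2 fun i _ => by positivity
  rw [qBinom, h2, div_eq_div_iff (mul_ne_zero h5 h3) (mul_ne_zero h3 h4)]
  linear_combination evenProd q k * h1

/-- Half-closed form of the order of the orthogonal group of dimension `n` and discriminant sign
`ε` over the field of `q` elements, with `s` the quadratic character of `-1`. It vanishes for
`n = 0` and `ε = -1`. -/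
def orthOrder (q s : ℚ) (n : ℕ) (ε : ℚ) : ℚ :=
  if Even n then
    2 * q ^ (n / 2 * (n / 2 - 1)) * evenProd q (n / 2) / (q ^ (n / 2) + s ^ (n / 2) * ε)
  else 2 * q ^ (n / 2 * (n / 2)) * evenProd q (n / 2)

theorem orthOrder_even (q s : ℚ) (m : ℕ) (ε : ℚ) :
    orthOrder q s (2 * m) ε = 2 * q ^ (m * (m - 1)) * evenProd q m / (q ^ m + s ^ m * ε) := by
  rw [orthOrder, if_pos (even_two_mul m), Nat.mul_div_cancel_left m two_pos]

theorem orthOrder_odd (q s : ℚ) (m : ℕ) (ε : ℚ) :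
    orthOrder q s (2 * m + 1) ε = 2 * q ^ (m * m) * evenProd q m := by
  rw [orthOrder, if_neg (by simp), show (2 * m + 1) / 2 = m by omega]

theorem sign_pow_mul {s ε : ℚ} (hs : s = 1 ∨ s = -1) (hε : ε = 1 ∨ ε = -1) (m : ℕ) :
    s ^ m * ε = 1 ∨ s ^ m * ε = -1 := by
  have : s ^ m = 1 ∨ s ^ m = -1 := by
    rcases hs with rfl | rfl
    · simp
    · exact neg_one_pow_eq_or ℚ m
  rcases this with h | h <;> rcases hε with rfl | rfl <;> simp [h]

theorem orthOrder_ne_zero {q s ε : ℚ} (hq : 1 < q) (hs : s = 1 ∨ s = -1) (hε : ε = 1 ∨ ε = -1)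
    {n : ℕ} (h : n = 0 → ε = 1) : orthOrder q s n ε ≠ 0 := by
  have hP := fun m => (evenProd_pos hq m).ne'
  have hq0 : q ≠ 0 := by positivity
  obtain ⟨m, rfl | rfl⟩ := n.even_or_odd' 
  · rw [orthOrder_even]
    refine div_ne_zero (mul_ne_zero (mul_ne_zero two_ne_zero (pow_ne_zero _ hq0)) (hP m)) ?_
    rcases Nat.eq_zero_or_pos m with rfl | hm
    · rw [h rfl]; norm_num
    · have := one_lt_pow₀ hq hm.ne'
      rcases sign_pow_mul hs hε m with h | h <;> rw [h] <;> linarith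
  · rw [orthOrder_odd]
    exact mul_ne_zero (mul_ne_zero two_ne_zero (pow_ne_zero _ hq0)) (hP m)

/-- The denominator is `1 - 1`, and division by zero returns 0. This convention encodes that the
zero space has sign 1 only, so that the quotient formulas below need no exceptions. -/
theorem orthOrder_zero_neg_one (q s : ℚ) : orthOrder q s 0 (-1) = 0 := by simp [orthOrder]

theorem orthOrder_zero_one (q s : ℚ) : orthOrder q s 0 1 = 1 := by
  norm_num [orthOrder, evenProd_zero]

/-! ### Nondegenerate subspaces for odd `q`, by discriminant sign. -/

section Count

variable {K V : Type*} [Field K] [AddCommGroup V] [Module K V] [Fintype K] [DecidableEq K]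
  [Fintype V] {B : LinearMap.BilinForm K V}

theorem cast_quadraticChar_eq {a : K} (ha : a ≠ 0) :
    (quadraticChar K a : ℚ) = 1 ∨ (quadraticChar K a : ℚ) = -1 := by
  rcases quadraticChar_dichotomy ha with h | h <;> simp [h]

omit [DecidableEq K] in
theorem one_lt_cast_card : (1 : ℚ) < Fintype.card K := by
  exact_mod_cast Fintype.one_lt_card

/-- The number of vectors of given norm is a quotient of orders of orthogonal groups. -/
theorem ncard_eq_orthOrder_div (hK : ringChar K ≠ 2) {ψ : AddChar K ℂ} (hψ : ψ ≠ 1)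
    {E : Submodule K V} {ε : ℤ} (hε : ε = 1 ∨ ε = -1) (h : HasDisc ψ B E ε) {c : K} (hc : c ≠ 0)
    {n : ℕ} (hn : finrank K E = n + 1) :
    ({x | x ∈ E ∧ B x x = c}.ncard : ℚ) =
      orthOrder (Fintype.card K) (quadraticChar K (-1)) (n + 1) ε /
        orthOrder (Fintype.card K) (quadraticChar K (-1)) n (ε * quadraticChar K c) := by
  have hq : (1 : ℚ) < Fintype.card K := one_lt_cast_card
  have hs := cast_quadraticChar_eq (neg_ne_zero.2 (one_ne_zero (α := K)))
  obtain ⟨m, rfl | rfl⟩ := n.even_or_odd'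
  · have key := ncard_of_hasDisc_odd hK hψ h hc hn
    rw [key, orthOrder_odd, orthOrder_even, div_div_eq_mul_div]
    have hP := (evenProd_pos hq m).ne'
    generalize (Fintype.card K : ℚ) = q at *
    generalize (quadraticChar K (-1) : ℚ) = s at *
    generalize (quadraticChar K c : ℚ) = t at *
    have hq0 : q ≠ 0 := by positivity
    rw [eq_div_iff (by positivity)]
    have : q ^ (m * m) = q ^ m * q ^ (m * (m - 1)) := by
      rw [← pow_add]; congr 1; cases m <;> simp; ring
    rw [this]
    ring
  · have key := ncard_of_hasDisc_even hK hψ h hc (m := m + 1) (by omega)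
    rw [show 2 * m + 1 + 1 = 2 * (m + 1) by ring, orthOrder_odd, orthOrder_even, div_div]
    have hP := (evenProd_pos hq m).ne'
    have he : (ε : ℚ) = 1 ∨ (ε : ℚ) = -1 := by exact_mod_cast hε
    have hse := sign_pow_mul hs he (m + 1)
    rw [evenProd_succ]
    generalize (Fintype.card K : ℚ) = q at *
    generalize (quadraticChar K (-1) : ℚ) ^ (m + 1) * ε = e at *
    have hq0 : q ≠ 0 := by positivity
    have h1 := one_lt_pow₀ hq (n := m + 1) (by omega)
    have h2 : q ^ (m + 1) + e ≠ 0 := by rcases hse with rfl | rfl <;> linarith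
    have he2 : e ^ 2 = 1 := by rcases hse with rfl | rfl <;> norm_num
    refine mul_left_cancel₀ hq0 (key.trans ?_)
    rw [Nat.add_sub_cancel, mul_div_assoc', eq_div_iff (by positivity)]
    have : q ^ ((m + 1) * m) = q ^ m * q ^ (m * m) := by rw [← pow_add]; ring
    rw [this]
    linear_combination (-2) * q ^ (m + 1) * evenProd q m * q ^ (m * m) * he2

/-- The number of nondegenerate subspaces of given dimension and discriminant sign. -/
theorem ncard_nondegSub_hasDisc (hB : B.IsSymm) (hK : ringChar K ≠ 2) {ψ : AddChar K ℂ}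
    (hψ : ψ ≠ 1) {F : Submodule K V} (hF : NondegOn B F) {d t : ℤ} (hd : d = 1 ∨ d = -1)
    (ht : t = 1 ∨ t = -1) (hFd : HasDisc ψ B F d) {n r : ℕ} (hn : finrank K F = n) (hr : r ≤ n) :
    ({E | E ∈ nondegSub B F r ∧ HasDisc ψ B E t}.ncard : ℚ) =
      orthOrder (Fintype.card K) (quadraticChar K (-1)) n d /
        (orthOrder (Fintype.card K) (quadraticChar K (-1)) r t *
          orthOrder (Fintype.card K) (quadraticChar K (-1)) (n - r) (d * t)) := by
  have hq : (1 : ℚ) < Fintype.card K := one_lt_cast_card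
  have hs := cast_quadraticChar_eq (neg_ne_zero.2 (one_ne_zero (α := K)))
  have hbot : HasDisc ψ B (⊥ : Submodule K V) 1 := by
    obtain ⟨ε, -, h⟩ := (nondegOn_bot (B := B)).exists_hasDisc hB hK hψ
    intro t _
    have h : ∀ x : (⊥ : Submodule K V), ψ (t * B (x : V) x) = 1 := fun x => by
      rw [(Submodule.mem_bot K).1 x.2]; simp
    simp [quadSum, h]
  induction r generalizing F d t n with
  | zero =>
    rw [nondegSub_zero]
    rcases ht with rfl | rfl
    · have : {E | E ∈ ({⊥} : Set (Submodule K V)) ∧ HasDisc ψ B E 1} = {⊥} := by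
        ext E
        simp only [Set.mem_singleton_iff, Set.mem_ofPred_eq, and_iff_left_iff_imp]
        rintro rfl
        exact hbot
      rw [this, Set.ncard_singleton, Nat.sub_zero, Int.cast_one, mul_one, orthOrder_zero_one,
        one_mul, div_self, Nat.cast_one]
      refine orthOrder_ne_zero hq hs (by exact_mod_cast hd) fun h0 => ?_
      obtain rfl : F = ⊥ := Submodule.finrank_eq_zero.1 (hn.trans h0)
      exact_mod_cast hFd.unique hK hψ hbot
    · have : {E | E ∈ ({⊥} : Set (Submodule K V)) ∧ HasDisc ψ B E (-1)} = ∅ := by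
        ext E
        simp only [Set.mem_singleton_iff, Set.mem_ofPred_eq, Set.mem_empty_iff_false, iff_false]
        rintro ⟨rfl, h⟩
        exact absurd (h.unique hK hψ hbot) (by decide)
      rw [this]
      push_cast
      simp [orthOrder_zero_neg_one]
  | succ r ih =>
    obtain ⟨n, rfl⟩ : ∃ k, n = k + 1 := ⟨n - 1, by omega⟩
    have htQ : (t : ℚ) = 1 ∨ (t : ℚ) = -1 := by exact_mod_cast ht
    have hdQ : (d : ℚ) = 1 ∨ (d : ℚ) = -1 := by exact_mod_cast hd
    have htt : t * t = 1 := by rcases ht with rfl | rfl <;> rfl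
    -- The norm `c` is chosen with character equal to the sign `t` of the subspaces: splitting a
    -- vector of norm `c` off such a subspace leaves a complement of sign `t * t = 1`, while the
    -- complement in `F` gets sign `d * t`.
    obtain ⟨c, hc⟩ : ∃ c : K, quadraticChar K c = t := by
      rcases ht with rfl | rfl
      · exact ⟨1, map_one _⟩
      · exact quadraticChar_exists_neg_one hK
    have hc0 : c ≠ 0 := by
      rintro rfl
      rw [quadraticChar_zero] at hc
      rcases ht with rfl | rfl <;> simp at hc
    have hF' : ∀ v ∈ {x | x ∈ F ∧ B x x = c},
        {E | E ∈ {E | E ∈ nondegSub B F (r + 1) ∧ HasDisc ψ B E t} ∧ v ∈ E}.ncard =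
          {E | E ∈ nondegSub B (F ⊓ B.orthogonal (K ∙ v)) r ∧ HasDisc ψ B E 1}.ncard ∧
        finrank K (F ⊓ B.orthogonal (K ∙ v) : Submodule K V) = n ∧
        NondegOn B (F ⊓ B.orthogonal (K ∙ v)) ∧
        HasDisc ψ B (F ⊓ B.orthogonal (K ∙ v)) (d * t) := by
      rintro v ⟨hvF, hvc⟩
      have hv : B v v ≠ 0 := hvc ▸ hc0
      have hv0 : v ≠ 0 := by rintro rfl; simp at hv
      have hP := nondegOn_span_singleton hv
      have hPF : K ∙ v ≤ F := (Submodule.span_singleton_le_iff_mem v F).2 hvF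
      have hfin := hP.finrank_inf_orthogonal hB hPF
      rw [finrank_span_singleton hv0] at hfin
      refine ⟨?_, by omega, hP.inf_orthogonal hB hF hPF, ?_⟩
      · have key := ncard_nondegSub_through hB hP hPF r (fun E => HasDisc ψ B E t)
        rw [finrank_span_singleton hv0, add_comm] at key
        convert key using 2
        · ext E
          simp only [Set.mem_ofPred_eq, Submodule.span_singleton_le_iff_mem, and_assoc]
        · ext E
          simp only [Set.mem_ofPred_eq, and_congr_right_iff]
          intro hE
          have hle := hE.1.trans inf_le_right
          have hsub : (K ∙ v ⊔ E) ⊓ B.orthogonal (K ∙ v) = E := hP.sup_inf_cancel hB hle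
          have hvE : v ∈ K ∙ v ⊔ E :=
            Submodule.mem_sup_left (Submodule.mem_span_singleton_self v)
          constructor
          · intro h
            have := HasDisc.of_inf_orthogonal hB hK hψ hvE hv (hsub.symm ▸ h)
            rwa [hvc, hc, mul_one] at this
          · intro h
            have := h.inf_orthogonal hB hK hψ (hP.sup hB hE.2.1 hle) hvE hv
            rwa [hsub, hvc, hc, htt] at this
      · have := hFd.inf_orthogonal hB hK hψ hF hvF hv
        rwa [hvc, hc, mul_comm] at this
    have hdt : d * t = 1 ∨ d * t = -1 := by
      rcases hd with rfl | rfl <;> rcases ht with rfl | rfl <;> decide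
    have hdtQ : (d : ℚ) * t = 1 ∨ (d : ℚ) * t = -1 := by exact_mod_cast hdt
    set w := orthOrder (Fintype.card K) (quadraticChar K (-1)) with hw
    have hSF := ncard_eq_orthOrder_div hK hψ hd hFd hc0 hn
    have hSE : ∀ E ∈ {E | E ∈ nondegSub B F (r + 1) ∧ HasDisc ψ B E t},
        ({x | x ∈ {x | x ∈ F ∧ B x x = c} ∧ x ∈ E}.ncard : ℚ) = w (r + 1) t / w r 1 := by
      rintro E ⟨hE, hEt⟩
      have := ncard_eq_orthOrder_div hK hψ ht hEt hc0 hE.2.2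
      rw [hc, ← Int.cast_mul, htt, Int.cast_one] at this
      rw [← this]
      congr 2
      ext x
      exact ⟨fun h => ⟨h.2, h.1.2⟩, fun h => ⟨⟨hE.1 h.1, h.2⟩, h.1⟩⟩
    rw [hc] at hSF
    have hwr : w r 1 ≠ 0 := orthOrder_ne_zero hq hs (Or.inl rfl) fun _ => rfl
    have hwr1 : w (r + 1) t ≠ 0 := orthOrder_ne_zero hq hs htQ (by simp)
    have hS0 : w (r + 1) t / w r 1 ≠ 0 := div_ne_zero hwr1 hwr
    have hN' : ∀ v ∈ {x | x ∈ F ∧ B x x = c},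
        ({E | E ∈ {E | E ∈ nondegSub B F (r + 1) ∧ HasDisc ψ B E t} ∧ v ∈ E}.ncard : ℚ) =
          w n (d * t) / (w r 1 * w (n - r) (d * t)) := by
      intro v hv
      obtain ⟨h1, h2, h3, h4⟩ := hF' v hv
      rw [h1, ih h3 hdt (Or.inl rfl) h4 h2 (by omega)]
      push_cast
      rw [mul_one]
    have key : ({E | E ∈ nondegSub B F (r + 1) ∧ HasDisc ψ B E t}.ncard : ℚ) *
        (w (r + 1) t / w r 1) = w (n + 1) d / w n (d * t) *
          (w n (d * t) / (w r 1 * w (n - r) (d * t))) := by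
      rw [← hSF]
      exact ncard_mul_eq_of_fibers (fun E v => v ∈ E) hSE hN'
    rw [Nat.add_sub_add_right]
    by_cases h0 : n = 0 → (d : ℚ) * t = 1
    · rw [div_mul_div_cancel₀ (orthOrder_ne_zero hq hs hdtQ h0)] at key
      rw [← eq_div_iff hS0] at key
      rw [key, div_div_div_eq, mul_assoc, mul_div_mul_comm, mul_comm (w (r + 1) t)]
      by_cases hk : w (n - r) (d * t) = 0
      · simp [hk]
      · field_simp
    -- Here `F` is a line whose norms have character different from `t`. Both sides are 0, the right
    -- one through `orthOrder_zero_neg_one`.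
    · push Not at h0
      obtain ⟨rfl, h0⟩ := h0
      have h0 := hdtQ.resolve_left h0
      obtain rfl : r = 0 := by omega
      rw [h0, hw, orthOrder_zero_neg_one, ← hw] at key ⊢
      rw [div_zero, zero_mul] at key
      rw [mul_zero, div_zero]
      exact (mul_eq_zero.1 key).resolve_right hS0

/-- The number of nondegenerate subspaces of given dimension, for odd `q`. -/
theorem ncard_nondegSub_of_odd (hB : B.IsSymm) (hK : ringChar K ≠ 2) {ψ : AddChar K ℂ}
    (hψ : ψ ≠ 1) {F : Submodule K V} (hF : NondegOn B F)
    (hFd : HasDisc ψ B F 1) {n r : ℕ} (hn : finrank K F = n) (hr : r ≤ n) :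
    ((nondegSub B F r).ncard : ℚ) =
      orthOrder (Fintype.card K) (quadraticChar K (-1)) n 1 /
        (orthOrder (Fintype.card K) (quadraticChar K (-1)) r 1 *
          orthOrder (Fintype.card K) (quadraticChar K (-1)) (n - r) 1) +
      orthOrder (Fintype.card K) (quadraticChar K (-1)) n 1 /
        (orthOrder (Fintype.card K) (quadraticChar K (-1)) r (-1) *
          orthOrder (Fintype.card K) (quadraticChar K (-1)) (n - r) (-1)) := by
  have h1 := ncard_nondegSub_hasDisc hB hK hψ hF (Or.inl rfl) (Or.inl rfl) hFd hn hr
  have h2 := ncard_nondegSub_hasDisc hB hK hψ hF (Or.inl rfl) (Or.inr rfl) hFd hn hr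
  push_cast at h1 h2
  rw [one_mul] at h1 h2
  rw [← h1, ← h2, ← Nat.cast_add, ← Set.ncard_union_eq]
  · congr 2
    ext E
    constructor
    · intro hE
      obtain ⟨ε, rfl | rfl, h⟩ := hE.2.1.exists_hasDisc hB hK hψ
      · exact Or.inl ⟨hE, h⟩
      · exact Or.inr ⟨hE, h⟩
    · rintro (h | h) <;> exact h.1
  · rw [Set.disjoint_left]
    rintro E ⟨-, h⟩ ⟨-, h'⟩
    exact absurd (h.unique hK hψ h') (by decide)

end Count

/-! ### Adding the two discriminant signs. -/

theorem pow_add_sign_ne_zero {q s ε : ℚ} (hq : 1 < q) (hs : s = 1 ∨ s = -1)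
    (hε : ε = 1 ∨ ε = -1) {m : ℕ} (hm : 0 < m) : q ^ m + s ^ m * ε ≠ 0 := by
  have := one_lt_pow₀ hq hm.ne'
  rcases sign_pow_mul hs hε m with h | h <;> rw [h] <;> linarith

/-- Decompositions of an odd-dimensional space into an even- and an odd-dimensional part. -/
theorem orthOrder_sum_even_odd {q s : ℚ} (hq : 1 < q) (hs : s = 1 ∨ s = -1) {k : ℕ} (hk : 0 < k)
    (j : ℕ) :
    orthOrder q s (2 * (k + j) + 1) 1 / (orthOrder q s (2 * k) 1 * orthOrder q s (2 * j + 1) 1) +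
      orthOrder q s (2 * (k + j) + 1) 1 /
        (orthOrder q s (2 * k) (-1) * orthOrder q s (2 * j + 1) (-1)) =
    q ^ (2 * (k * (j + 1))) * (evenProd q (k + j) / (evenProd q k * evenProd q j)) := by
  have hq0 : q ≠ 0 := by positivity
  simp only [orthOrder_even, orthOrder_odd]
  have h2 := pow_add_sign_ne_zero hq hs (Or.inl rfl) hk
  have h4 := pow_add_sign_ne_zero hq hs (Or.inr rfl) hk
  simp only [mul_one, mul_neg] at h2 h4 ⊢
  have he : q ^ ((k + j) * (k + j)) * q ^ k =
      q ^ (2 * (k * (j + 1))) * q ^ (k * (k - 1)) * q ^ (j * j) := by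
    rw [← pow_add, ← pow_add, ← pow_add]
    congr 1
    obtain ⟨k, rfl⟩ : ∃ l, k = l + 1 := ⟨k - 1, by omega⟩
    simp only [Nat.add_sub_cancel]
    ring
  have hP1 := (evenProd_pos hq k).ne'
  have hP2 := (evenProd_pos hq j).ne'
  field_simp
  linear_combination 2 * evenProd q (k + j) * he

/-- Decompositions of an even-dimensional space into two even-dimensional parts. -/
theorem orthOrder_sum_even_even {q s : ℚ} (hq : 1 < q) (hs : s = 1 ∨ s = -1) {k j : ℕ}
    (hk : 0 < k) (hj : 0 < j) :
    orthOrder q s (2 * (k + j)) 1 / (orthOrder q s (2 * k) 1 * orthOrder q s (2 * j) 1) +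
      orthOrder q s (2 * (k + j)) 1 / (orthOrder q s (2 * k) (-1) * orthOrder q s (2 * j) (-1)) =
    q ^ (2 * (k * j)) * (evenProd q (k + j) / (evenProd q k * evenProd q j)) := by
  have hq0 : q ≠ 0 := by positivity
  simp only [orthOrder_even]
  have h1 := pow_add_sign_ne_zero hq hs (Or.inl rfl) (m := k + j) (by omega)
  have h2 := pow_add_sign_ne_zero hq hs (Or.inl rfl) hk
  have h3 := pow_add_sign_ne_zero hq hs (Or.inl rfl) hj
  have h4 := pow_add_sign_ne_zero hq hs (Or.inr rfl) hk
  have h5 := pow_add_sign_ne_zero hq hs (Or.inr rfl) hj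
  simp only [mul_one, mul_neg] at h1 h2 h3 h4 h5 ⊢
  have he : q ^ ((k + j) * (k + j - 1)) =
      q ^ (2 * (k * j)) * q ^ (k * (k - 1)) * q ^ (j * (j - 1)) := by
    rw [← pow_add, ← pow_add]
    congr 1
    obtain ⟨k, rfl⟩ : ∃ l, k = l + 1 := ⟨k - 1, by omega⟩
    obtain ⟨j, rfl⟩ : ∃ l, j = l + 1 := ⟨j - 1, by omega⟩
    simp only [← add_assoc, Nat.add_sub_cancel]
    ring
  rw [he]
  have hP1 := (evenProd_pos hq k).ne'
  have hP2 := (evenProd_pos hq j).ne'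
  rw [pow_add, pow_add s] at h1 ⊢
  field_simp
  ring

/-- Decompositions of an even-dimensional space into two odd-dimensional parts. -/
theorem orthOrder_sum_odd_odd {q s : ℚ} (hq : 1 < q) (hs : s = 1 ∨ s = -1) (k j : ℕ) :
    orthOrder q s (2 * (k + j + 1)) 1 /
        (orthOrder q s (2 * k + 1) 1 * orthOrder q s (2 * j + 1) 1) +
      orthOrder q s (2 * (k + j + 1)) 1 /
        (orthOrder q s (2 * k + 1) (-1) * orthOrder q s (2 * j + 1) (-1)) =
    q ^ (2 * (k * j) + k + j) * (q ^ (k + j + 1) - s ^ (k + j + 1)) *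
      (evenProd q (k + j) / (evenProd q k * evenProd q j)) := by
  have hq0 : q ≠ 0 := by positivity
  simp only [orthOrder_even, orthOrder_odd]
  have h1 := pow_add_sign_ne_zero hq hs (Or.inl rfl) (m := k + j + 1) (by omega)
  have hs2 : (s ^ (k + j + 1)) ^ 2 = 1 := by
    rcases sign_pow_mul hs (Or.inl rfl) (k + j + 1) with h | h <;> rw [mul_one] at h <;> rw [h] <;>
      norm_num
  simp only [mul_one] at h1 ⊢
  have he : q ^ ((k + j + 1) * (k + j + 1 - 1)) =
      q ^ (2 * (k * j) + k + j) * q ^ (k * k) * q ^ (j * j) := by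
    rw [← pow_add, ← pow_add, Nat.add_sub_cancel]
    congr 1
    ring
  rw [he, evenProd_succ]
  have hP1 := (evenProd_pos hq k).ne'
  have hP2 := (evenProd_pos hq j).ne'
  rw [show q ^ (2 * (k + j + 1)) = (q ^ (k + j + 1)) ^ 2 by rw [← pow_mul, mul_comm]]
  generalize s ^ (k + j + 1) = a at *
  generalize q ^ (k + j + 1) = b at *
  field_simp
  linear_combination 2 * evenProd q (k + j) * hs2

/-- The total number of nondegenerate subspaces, summed over the two discriminant classes, is given
by the explicit formula. -/
theorem orthOrder_sum_eq_lcdFormula {q : ℕ} (hq : 1 < q) (hodd : ¬ Even q) {s : ℚ}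
    (hs : s = if q % 4 = 3 then -1 else 1) {n r : ℕ} (hr : r ≤ n) :
    orthOrder q s n 1 / (orthOrder q s r 1 * orthOrder q s (n - r) 1) +
      orthOrder q s n 1 / (orthOrder q s r (-1) * orthOrder q s (n - r) (-1)) =
    lcdFormula q n r := by
  have hqQ : (1 : ℚ) < q := by exact_mod_cast hq
  have hs1 : s = 1 ∨ s = -1 := by rw [hs]; split_ifs <;> simp
  have hw : ∀ n, orthOrder q s n 1 ≠ 0 := fun n =>
    orthOrder_ne_zero hqQ hs1 (Or.inl rfl) fun _ => rfl
  by_cases h0 : r = 0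
  · subst h0
    simp [lcdFormula, orthOrder_zero_neg_one, orthOrder_zero_one, div_self (hw n)]
  by_cases hrn : r = n
  · subst hrn
    simp [lcdFormula, orthOrder_zero_neg_one, orthOrder_zero_one, div_self (hw r)]
  rw [lcdFormula, if_neg (by tauto), if_neg hodd]
  obtain ⟨d, rfl⟩ : ∃ d, n = r + d := ⟨n - r, by omega⟩
  rw [Nat.add_sub_cancel_left]
  obtain ⟨k, rfl | rfl⟩ := r.even_or_odd' <;> obtain ⟨j, rfl | rfl⟩ := d.even_or_odd'
  · rw [← mul_add, if_neg (by simp), if_neg (by simp), if_neg (by simp),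
      orthOrder_sum_even_even hqQ hs1 (by omega) (by omega),
      show 2 * (k + j) / 2 = k + j by omega, show 2 * k / 2 = k by omega,
      qBinom_sq hqQ (by omega), Nat.add_sub_cancel_left,
      show 2 * k * (2 * j) / 2 = 2 * (k * j) by rw [mul_mul_mul_comm]; omega]
  · rw [show 2 * k + (2 * j + 1) = 2 * (k + j) + 1 by ring, if_neg (by simp), if_neg (by simp),
      if_pos (by simp), orthOrder_sum_even_odd hqQ hs1 (by omega),
      show (2 * (k + j) + 1 - 1) / 2 = k + j by omega, show 2 * k / 2 = k by omega,
      qBinom_sq hqQ (by omega), Nat.add_sub_cancel_left,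
      show 2 * k * (2 * j + 1 + 1) / 2 = 2 * (k * (j + 1)) by
        rw [show 2 * j + 1 + 1 = 2 * (j + 1) by omega, mul_mul_mul_comm]; omega]
  · rw [show 2 * k + 1 + 2 * j = 2 * (j + k) + 1 by ring, if_pos (by simp),
      mul_comm (orthOrder _ _ (2 * k + 1) _), mul_comm (orthOrder _ _ (2 * k + 1) _),
      orthOrder_sum_even_odd hqQ hs1 (by omega),
      show (2 * (j + k) + 1 - 1) / 2 = j + k by omega, show (2 * k + 1 - 1) / 2 = k by omega,
      qBinom_sq hqQ (by omega), Nat.add_sub_cancel,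
      show 2 * j * (2 * k + 1 + 1) / 2 = 2 * (j * (k + 1)) by
        rw [show 2 * j * (2 * k + 1 + 1) = 2 * (2 * (j * (k + 1))) by ring]; omega,
      mul_comm (evenProd _ k)]
  · rw [show 2 * k + 1 + (2 * j + 1) = 2 * (k + j + 1) by ring, if_neg (by simp),
      if_pos (by simp), orthOrder_sum_odd_odd hqQ hs1,
      show (2 * (k + j + 1) - 2) / 2 = k + j by omega, show (2 * k + 1 - 1) / 2 = k by omega,
      show 2 * (k + j + 1) / 2 = k + j + 1 by omega,
      qBinom_sq hqQ (by omega), Nat.add_sub_cancel_left,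
      show (2 * (k + j + 1) * (2 * k + 1) - (2 * k + 1) ^ 2 - 1) / 2 = 2 * (k * j) + k + j by
        rw [show 2 * (k + j + 1) * (2 * k + 1) =
          2 * (2 * (k * j) + k + j) + 1 + (2 * k + 1) ^ 2 by ring]; omega]
    -- The sign `s ^ (n / 2)` is `-1` exactly when `q ≡ 3` modulo 4 and `n / 2` is odd; this is the
    -- case distinction of the formula for even `n` and odd `r`.
    have hq4 : q % 4 = 1 ∨ q % 4 = 3 := by
      have := Nat.not_even_iff.1 hodd; omega
    rcases hq4 with h4 | h4
    · rw [if_pos (Or.inl h4), hs, if_neg (by omega), one_pow]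
    · rw [hs, if_pos h4]
      rcases Nat.even_or_odd (k + j + 1) with he | ho
      · rw [if_pos (Or.inr ⟨by obtain ⟨m, hm⟩ := he; omega, h4⟩), he.neg_one_pow]
      · rw [if_neg (by obtain ⟨m, hm⟩ := ho; omega), ho.neg_one_pow, sub_neg_eq_add]

/-! ### The standard dot product, and the field count for odd `q`. -/

section StdForm

variable {K : Type*} [Field K] [Fintype K] [DecidableEq K]

/-- The standard dot product on `K ^ n` as a bilinear form. -/
def stdForm (K : Type*) [Field K] (n : ℕ) : LinearMap.BilinForm K (Fin n → K) :=
  dotProductBilin K K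

omit [Fintype K] [DecidableEq K] in
theorem stdForm_apply {n : ℕ} (x y : Fin n → K) : stdForm K n x y = x ⬝ᵥ y := rfl

omit [Fintype K] [DecidableEq K] in
theorem stdForm_isSymm (n : ℕ) : (stdForm K n).IsSymm :=
  ⟨fun x y => dotProduct_comm x y⟩

omit [Fintype K] [DecidableEq K] in
theorem nondegOn_top_stdForm (n : ℕ) :
    NondegOn (stdForm K n) ⊤ := by
  intro x _ h
  ext i
  have := h (Pi.single i 1) trivial
  simpa [stdForm_apply] using this

/-- The exponential sum of a sum of squares is a product of `n` one-variable sums. -/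
theorem hasDisc_top_stdForm (hK : ringChar K ≠ 2) {ψ : AddChar K ℂ} (hψ : ψ ≠ 1) (n : ℕ) :
    HasDisc ψ (stdForm K n) ⊤ 1 := by
  classical
  intro t ht
  rw [finrank_top, finrank_fin_fun, Int.cast_one, mul_one, ← mul_pow,
    ← sum_addChar_mul_sq hK hψ ht, Fintype.sum_pow, quadSum,
    ← (Submodule.topEquiv (R := K) (M := Fin n → K)).toEquiv.symm.sum_comp]
  refine Finset.sum_congr rfl fun x _ => ?_
  have h : ∀ s : Finset (Fin n), ψ (t * ∑ i ∈ s, x i * x i) = ∏ i ∈ s, ψ (t * x i ^ 2) := by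
    intro s
    induction s using Finset.induction_on with
    | empty => simp
    | insert a s ha ih =>
      rw [Finset.sum_insert ha, Finset.prod_insert ha, mul_add, AddChar.map_add_eq_mul, ih, pow_two]
  exact h Finset.univ

omit [Fintype K] [DecidableEq K] in
theorem fieldLCDCount_eq_ncard (n r : ℕ) :
    fieldLCDCount K n r = (nondegSub (stdForm K n) ⊤ r).ncard := by
  rw [fieldLCDCount, ← Nat.card_coe_set_eq]
  refine Nat.card_congr (Equiv.subtypeEquivRight fun C => ?_)
  exact ⟨fun h => ⟨le_top, h.2, h.1⟩, fun h => ⟨h.2.2, h.2.1⟩⟩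

theorem fieldLCDCount_eq_of_odd (hodd : ¬ Even (Fintype.card K)) {n r : ℕ} (hr : r ≤ n) :
    (fieldLCDCount K n r : ℚ) = lcdFormula (Fintype.card K) n r := by
  have hK : ringChar K ≠ 2 := fun h =>
    hodd (Nat.even_iff.2 (FiniteField.even_card_iff_char_two.1 h))
  obtain ⟨ψ, hψ⟩ := (AddChar.exists_apply_ne_zero (α := K) (a := 1)).2 one_ne_zero
  have hψ1 : ψ ≠ 1 := by rintro rfl; exact hψ rfl
  rw [fieldLCDCount_eq_ncard, ncard_nondegSub_of_odd (stdForm_isSymm n) hK hψ1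
    (nondegOn_top_stdForm n) (hasDisc_top_stdForm hK hψ1 n) (by simp) hr,
    orthOrder_sum_eq_lcdFormula Fintype.one_lt_card hodd _ hr]
  have h1 : (-1 : K) ≠ 0 := neg_ne_zero.2 one_ne_zero
  split_ifs with h
  · have : quadraticChar K (-1) = -1 := by
      rw [quadraticChar_neg_one_iff_not_isSquare, FiniteField.isSquare_neg_one_iff]
      exact not_not.2 h
    rw [this]; norm_num
  · rw [(quadraticChar_one_iff_isSquare h1).2 (FiniteField.isSquare_neg_one_iff.2 h)]
    norm_num

end StdForm

/-! ### Nondegenerate alternating spaces. -/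

section Alternating

variable {K V : Type*} [Field K] [AddCommGroup V] [Module K V] {B : LinearMap.BilinForm K V}

/-- The restriction of `B` to `E` is alternating. -/
def AltOn (B : LinearMap.BilinForm K V) (E : Submodule K V) : Prop := ∀ x ∈ E, B x x = 0

theorem AltOn.mono {E F : Submodule K V} (hF : AltOn B F) (h : E ≤ F) : AltOn B E :=
  fun x hx => hF x (h hx)

theorem eq_zero_of_pair (hB : B.IsSymm) {x y : V} (hx : B x x = 0) (hxy : B x y = 1) {a b : K}
    (h1 : B (a • x + b • y) x = 0) (h2 : B (a • x + b • y) y = 0) : a = 0 ∧ b = 0 := by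
  simp only [map_add, map_smul, LinearMap.add_apply, LinearMap.smul_apply, smul_eq_mul, hx, hxy,
    hB.eq y x, mul_zero, zero_add, mul_one] at h1 h2
  rw [h1, zero_mul, add_zero] at h2
  exact ⟨h2, h1⟩

theorem nondegOn_span_pair (hB : B.IsSymm) {x y : V} (hx : B x x = 0) (hxy : B x y = 1) :
    NondegOn B (Submodule.span K {x, y}) := by
  intro z hz h
  obtain ⟨a, b, rfl⟩ := Submodule.mem_span_pair.1 hz
  obtain ⟨rfl, rfl⟩ := eq_zero_of_pair hB hx hxy (h x (Submodule.subset_span (by simp)))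
    (h y (Submodule.subset_span (by simp)))
  simp

theorem finrank_span_pair_of_apply_eq_one (hB : B.IsSymm) {x y : V} (hx : B x x = 0)
    (hxy : B x y = 1) : finrank K (Submodule.span K {x, y}) = 2 := by
  have hli : LinearIndependent K ![x, y] := by
    rw [LinearIndependent.pair_iff]
    intro a b h
    exact eq_zero_of_pair hB hx hxy (by rw [h]; simp) (by rw [h]; simp)
  have := finrank_span_eq_card hli
  rwa [Matrix.range_cons_cons_empty, Fintype.card_fin] at this

theorem span_pair_le {x y : V} {E : Submodule K V} :
    Submodule.span K {x, y} ≤ E ↔ x ∈ E ∧ y ∈ E := by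
  rw [Submodule.span_le, Set.insert_subset_iff, Set.singleton_subset_iff]; rfl

theorem NondegOn.exists_apply_eq_one {F : Submodule K V} (hF : NondegOn B F) {x : V} (hx : x ∈ F)
    (hx0 : x ≠ 0) (c : K) : ∃ y ∈ F, B x y = c := by
  by_contra! h
  refine hx0 (hF x hx fun y hy => ?_)
  by_contra h0
  refine h ((c / B x y) • y) (F.smul_mem _ hy) ?_
  rw [map_smul, smul_eq_mul, div_mul_cancel₀ _ h0]

/-- A nondegenerate alternating form lives in even dimension. -/
theorem NondegOn.even_finrank [FiniteDimensional K V] (hB : B.IsSymm) {F : Submodule K V}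
    (hF : NondegOn B F) (hA : AltOn B F) : Even (finrank K F) := by
  induction hn : finrank K F using Nat.strong_induction_on generalizing F with
  | _ n ih =>
    subst hn
    rcases eq_or_ne F ⊥ with rfl | h0
    · simp
    obtain ⟨x, hx, hx0⟩ := (Submodule.ne_bot_iff F).1 h0
    obtain ⟨y, hy, hxy⟩ := hF.exists_apply_eq_one hx hx0 1
    have hP := nondegOn_span_pair hB (hA x hx) hxy
    have hPF : Submodule.span K {x, y} ≤ F := span_pair_le.2 ⟨hx, hy⟩
    have h2 := finrank_span_pair_of_apply_eq_one hB (hA x hx) hxy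
    have hfin := hP.finrank_inf_orthogonal hB hPF
    have := ih _ (by omega) (hP.inf_orthogonal hB hF hPF) (hA.mono inf_le_left) rfl
    rw [← hfin, h2]
    exact even_two.add this

variable [Fintype K] [Finite V]

/-- The fibres of an additive map onto the field have equal sizes. -/
theorem ncard_fiber_mul_card (F : Submodule K V) (f : V →+ K) (hf : ∀ c, ∃ x ∈ F, f x = c) (c : K) :
    ({x | x ∈ F ∧ f x = c}.ncard : ℚ) * Fintype.card K = (Fintype.card K : ℚ) ^ finrank K F := by
  classical
  have h1 : ∀ c', {x | x ∈ F ∧ f x = c'}.ncard = {x | x ∈ F ∧ f x = c}.ncard := by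
    intro c'
    obtain ⟨u, hu, hfu⟩ := hf (c - c')
    refine Set.ncard_congr (fun x _ => x + u) ?_ ?_ ?_
    · rintro x ⟨hx, rfl⟩
      exact ⟨F.add_mem hx hu, by rw [map_add, hfu, add_sub_cancel]⟩
    · intro x y _ _ h
      exact add_right_cancel h
    · rintro x ⟨hx, rfl⟩
      exact ⟨x - u, ⟨F.sub_mem hx hu, by rw [map_sub, hfu, sub_sub_cancel]⟩, sub_add_cancel x u⟩
  have h2 := ncard_mul_eq_of_fibers (S := (F : Set V)) (T := (Set.univ : Set K))
    (fun x c => f x = c) (m := 1) (n := ({x | x ∈ F ∧ f x = c}.ncard : ℚ))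
    (fun x _ => by
      have : {b | b ∈ Set.univ ∧ f x = b} = {f x} := by ext; simp [eq_comm]
      rw [this]; simp)
    (fun c' _ => by rw [← h1 c']; rfl)
  rw [Set.ncard_univ, Nat.card_eq_fintype_card, mul_one] at h2
  rw [mul_comm, ← h2, ← Nat.card_coe_set_eq]
  have h3 : Nat.card (F : Set V) = Fintype.card K ^ finrank K F := by
    rw [← Nat.card_eq_fintype_card]
    exact Module.natCard_eq_pow_finrank (K := K) (V := F)
  rw [h3]; push_cast; rfl

theorem ncard_apply_eq_mul_card {F : Submodule K V} (hF : NondegOn B F) {x : V} (hx : x ∈ F)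
    (hx0 : x ≠ 0) :
    ({y | y ∈ F ∧ B x y = 1}.ncard : ℚ) * Fintype.card K = (Fintype.card K : ℚ) ^ finrank K F :=
  ncard_fiber_mul_card F (B x).toAddMonoidHom (hF.exists_apply_eq_one hx hx0) 1

/-- The number of hyperbolic pairs. -/
theorem ncard_pairs_mul_card {F : Submodule K V} (hF : NondegOn B F) :
    ({z : V × V | (z.1 ∈ F ∧ z.2 ∈ F) ∧ B z.1 z.2 = 1}.ncard : ℚ) * Fintype.card K =
      ((Fintype.card K : ℚ) ^ finrank K F - 1) * (Fintype.card K : ℚ) ^ finrank K F := by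
  have hq : (Fintype.card K : ℚ) ≠ 0 := by simp
  have h := ncard_mul_eq_of_fibers
    (S := {z : V × V | (z.1 ∈ F ∧ z.2 ∈ F) ∧ B z.1 z.2 = 1}) (T := (F : Set V) \ {0})
    (fun z x => z.1 = x) (m := 1) (n := (Fintype.card K : ℚ) ^ finrank K F / Fintype.card K)
    (by
      rintro ⟨x, y⟩ ⟨⟨hx, -⟩, hxy⟩
      have : {b | b ∈ (F : Set V) \ {0} ∧ x = b} = {x} := by
        ext b
        constructor
        · rintro ⟨-, rfl⟩; rfl
        · rintro rfl
          refine ⟨⟨hx, ?_⟩, rfl⟩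
          rintro rfl
          simp at hxy
      rw [this]; simp)
    (by
      rintro x ⟨hx, hx0⟩
      rw [eq_div_iff hq, ← ncard_apply_eq_mul_card hF hx hx0]
      congr 2
      refine Set.ncard_congr (fun z _ => z.2) ?_ ?_ ?_
      · rintro ⟨a, b⟩ ⟨⟨⟨-, hb⟩, hab⟩, rfl⟩
        exact ⟨hb, hab⟩
      · rintro z z' ⟨-, h₁⟩ ⟨-, h₂⟩ h
        exact Prod.ext (h₁.trans h₂.symm) h
      · rintro b ⟨hb, hab⟩
        exact ⟨(x, b), ⟨⟨⟨hx, hb⟩, hab⟩, rfl⟩, rfl⟩)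
  have h3 : Nat.card (F : Set V) = Fintype.card K ^ finrank K F := by
    rw [← Nat.card_eq_fintype_card]
    exact Module.natCard_eq_pow_finrank (K := K) (V := F)
  have h4 := Set.ncard_sdiff_singleton_add_one (s := (F : Set V)) (a := 0) F.zero_mem
  rw [← Nat.card_coe_set_eq (F : Set V), h3] at h4
  have h5 : (((F : Set V) \ {0}).ncard : ℚ) = (Fintype.card K : ℚ) ^ finrank K F - 1 := by
    rw [eq_sub_iff_add_eq]; exact_mod_cast h4
  rw [mul_one, h5] at h
  rw [h, mul_assoc, div_mul_cancel₀ _ hq]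

/-- The number of nondegenerate subspaces of a nondegenerate alternating space. -/
theorem ncard_nondegSub_of_altOn (hB : B.IsSymm) {F : Submodule K V} (hF : NondegOn B F)
    (hA : AltOn B F) {k j : ℕ} (hn : finrank K F = 2 * (k + j)) :
    ((nondegSub B F (2 * k)).ncard : ℚ) = (Fintype.card K : ℚ) ^ (2 * (k * j)) *
      (evenProd (Fintype.card K) (k + j) /
        (evenProd (Fintype.card K) k * evenProd (Fintype.card K) j)) := by
  have hq : (1 : ℚ) < Fintype.card K := one_lt_cast_card
  have hP := fun m => (evenProd_pos hq m).ne'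
  have hq0 : (Fintype.card K : ℚ) ≠ 0 := by positivity
  induction k generalizing F with
  | zero =>
    rw [mul_zero, nondegSub_zero, Set.ncard_singleton, zero_mul, mul_zero, pow_zero, zero_add,
      evenProd_zero, one_mul, one_mul, div_self (hP j), Nat.cast_one]
  | succ k ih =>
    have hpow : (Fintype.card K : ℚ) ^ (2 * (k + 1)) - 1 ≠ 0 :=
      (sub_pos.2 (one_lt_pow₀ hq (by omega))).ne'
    -- Pairs (subspace, hyperbolic pair in it) are counted. A hyperbolic pair spans a nondegenerate
    -- plane, so subspaces through it correspond to subspaces of its complement, of dimension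
    -- smaller by 2.
    have key := ncard_mul_eq_of_fibers (S := nondegSub B F (2 * (k + 1)))
      (T := {z : V × V | (z.1 ∈ F ∧ z.2 ∈ F) ∧ B z.1 z.2 = 1})
      (fun E z => z.1 ∈ E ∧ z.2 ∈ E)
      (m := ((Fintype.card K : ℚ) ^ (2 * (k + 1)) - 1) * (Fintype.card K : ℚ) ^ (2 * (k + 1)) /
        Fintype.card K)
      (n := (Fintype.card K : ℚ) ^ (2 * (k * j)) * (evenProd (Fintype.card K) (k + j) /
        (evenProd (Fintype.card K) k * evenProd (Fintype.card K) j)))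
      (by
        rintro E ⟨hEF, hE, hr⟩
        rw [eq_div_iff hq0, ← hr, ← ncard_pairs_mul_card hE]
        congr 3
        ext z
        exact ⟨fun h => ⟨h.2, h.1.2⟩, fun h => ⟨⟨⟨hEF h.1.1, hEF h.1.2⟩, h.2⟩, h.1⟩⟩)
      (by
        rintro ⟨x, y⟩ ⟨⟨hx, hy⟩, hxy⟩
        have hPn := nondegOn_span_pair hB (hA x hx) hxy
        have hPF : Submodule.span K {x, y} ≤ F := span_pair_le.2 ⟨hx, hy⟩
        have h2 := finrank_span_pair_of_apply_eq_one hB (hA x hx) hxy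
        have hfin := hPn.finrank_inf_orthogonal hB hPF
        rw [← ih (hPn.inf_orthogonal hB hF hPF) (hA.mono inf_le_left) (by omega)]
        have := ncard_nondegSub_through hB hPn hPF (2 * k) (fun _ => True)
        rw [h2, show 2 + 2 * k = 2 * (k + 1) by ring] at this
        simp only [true_and, and_true, span_pair_le] at this
        exact congrArg (Nat.cast : ℕ → ℚ) this)
    have hT := ncard_pairs_mul_card hF
    rw [← eq_div_iff hq0] at hT
    rw [hT, hn] at key
    have hm := hpow
    rw [← eq_div_iff (by positivity)] at key
    rw [key, show k + 1 + j = k + j + 1 by ring, evenProd_succ, evenProd_succ]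
    have := hP k
    have := hP j
    rw [show 2 * ((k + 1) * j) = 2 * (k * j) + 2 * j by ring, pow_add,
      show (Fintype.card K : ℚ) ^ (2 * (k + j + 1)) = (Fintype.card K : ℚ) ^ (2 * (k + 1)) *
        (Fintype.card K : ℚ) ^ (2 * j) by rw [← pow_add]; ring]
    field_simp

omit [Fintype K] in
theorem nondegSub_eq_empty_of_odd (hB : B.IsSymm) {F : Submodule K V} (hA : AltOn B F) {r : ℕ}
    (hr : Odd r) : nondegSub B F r = ∅ := by
  ext E
  simp only [Set.mem_empty_iff_false, iff_false]
  rintro ⟨hEF, hE, rfl⟩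
  exact Nat.not_even_iff_odd.2 hr (hE.even_finrank hB (hA.mono hEF))

end Alternating

/-! ### Characteristic two: unit vectors and alternating complements. -/

section CharTwo

variable {K V : Type*} [Field K] [CharP K 2] [AddCommGroup V] [Module K V]
  {B : LinearMap.BilinForm K V}

/-- In characteristic two the quadratic form of a symmetric bilinear form is additive. -/
def selfApplyHom (hB : B.IsSymm) : V →+ K where
  toFun x := B x x
  map_zero' := by simp
  map_add' x y := by
    simp only [map_add, LinearMap.add_apply, hB.eq y x]
    linear_combination CharTwo.add_self_eq_zero (B x y)

theorem selfApplyHom_apply (hB : B.IsSymm) (x : V) : selfApplyHom hB x = B x x := rfl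

theorem sq_injective_charTwo {a b : K} (h : a ^ 2 = b ^ 2) : a = b := by
  have : (a + b) ^ 2 = 0 := by
    rw [CharTwo.add_sq, h, CharTwo.add_self_eq_zero]
  have := pow_eq_zero_iff two_ne_zero |>.1 this
  rw [← CharTwo.neg_eq b]
  exact eq_neg_of_add_eq_zero_left this

/-- Every element of a finite field of characteristic two is a square, so a vector of nonzero norm
can be rescaled to any norm. -/
theorem exists_apply_self_eq [Finite K] {F : Submodule K V} (hF : ¬ AltOn B F) (c : K) :
    ∃ x ∈ F, B x x = c := by
  simp only [AltOn, not_forall] at hF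
  obtain ⟨u, hu, hu0⟩ := hF
  obtain ⟨a, ha⟩ := FiniteField.isSquare_of_char_two (CharP.ringChar_of_prime_eq_zero
    Nat.prime_two (CharP.cast_eq_zero K 2)) (c / B u u)
  refine ⟨a • u, F.smul_mem _ hu, ?_⟩
  simp only [map_smul, LinearMap.smul_apply, smul_eq_mul]
  rw [← mul_assoc, ← ha, div_mul_cancel₀ _ hu0]

theorem ncard_norm_one_mul_card [Fintype K] [Finite V] (hB : B.IsSymm) {F : Submodule K V}
    (hF : ¬ AltOn B F) :
    ({x | x ∈ F ∧ B x x = 1}.ncard : ℚ) * Fintype.card K = (Fintype.card K : ℚ) ^ finrank K F :=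
  ncard_fiber_mul_card F (selfApplyHom hB) (exists_apply_self_eq hF) 1

omit [CharP K 2] in
theorem finrank_inf_orthogonal_singleton [FiniteDimensional K V] (hB : B.IsSymm)
    {F : Submodule K V} {v : V} (hv : v ∈ F) (hv1 : B v v = 1) :
    finrank K (F ⊓ B.orthogonal (K ∙ v) : Submodule K V) + 1 = finrank K F := by
  have hv' : B v v ≠ 0 := hv1 ▸ one_ne_zero
  have hv0 : v ≠ 0 := by rintro rfl; simp at hv'
  have := (nondegOn_span_singleton hv').finrank_inf_orthogonal hB
    ((Submodule.span_singleton_le_iff_mem v F).2 hv)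
  rw [finrank_span_singleton hv0] at this
  omega

omit [CharP K 2] in
theorem nondegOn_inf_orthogonal_singleton [FiniteDimensional K V] (hB : B.IsSymm)
    {F : Submodule K V} (hF : NondegOn B F) {v : V} (hv : v ∈ F) (hv1 : B v v = 1) :
    NondegOn B (F ⊓ B.orthogonal (K ∙ v)) :=
  (nondegOn_span_singleton (hv1 ▸ one_ne_zero)).inf_orthogonal hB hF
    ((Submodule.span_singleton_le_iff_mem v F).2 hv)

omit [CharP K 2] in
/-- A unit vector with alternating orthogonal complement represents the square root of the
quadratic form. -/
theorem sq_apply_eq_of_altOn [FiniteDimensional K V] (hB : B.IsSymm) {F : Submodule K V} {v : V}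
    (hv : v ∈ F) (hv1 : B v v = 1)
    (hA : AltOn B (F ⊓ B.orthogonal (K ∙ v))) {x : V} (hx : x ∈ F) : B v x ^ 2 = B x x := by
  have h1 : x - B v x • v ∈ F ⊓ B.orthogonal (K ∙ v) := by
    refine ⟨F.sub_mem hx (F.smul_mem _ hv), mem_orthogonal_span_singleton.2 ?_⟩
    rw [map_sub, map_smul, hv1, smul_eq_mul, mul_one, sub_self]
  have h2 := hA _ h1
  simp only [map_sub, map_smul, LinearMap.sub_apply, LinearMap.smul_apply, smul_eq_mul, hv1,
    hB.eq x v] at h2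
  linear_combination -h2

/-- The square root of the norm is additive and commutes with scalars, hence is a linear functional
on `F`; nondegeneracy represents it by a vector. -/
theorem exists_sq_apply_eq [Finite K] [FiniteDimensional K V] (hB : B.IsSymm) {F : Submodule K V}
    (hF : NondegOn B F) : ∃ w ∈ F, ∀ x ∈ F, B w x ^ 2 = B x x := by
  classical
  have := Fintype.ofFinite K
  have : Fact (Nat.Prime 2) := ⟨Nat.prime_two⟩
  let f := (frobeniusEquiv K 2).symm
  have hf : ∀ a, f a ^ 2 = a := fun a => frobeniusEquiv_symm_pow_p K 2 a
  let φ : F →ₗ[K] K :=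
    { toFun := fun x => f (B x x)
      map_add' := fun x y => by
        rw [← map_add f]
        exact congrArg f ((selfApplyHom hB).map_add x y)
      map_smul' := fun c x => by
        apply sq_injective_charTwo
        simp only [hf, RingHom.id_apply, smul_eq_mul, mul_pow, Submodule.coe_smul, map_smul,
          LinearMap.smul_apply]
        ring }
  let T : F →ₗ[K] Dual K F :=
    LinearMap.mk₂ K (fun x y : F => B x y) (by simp) (by simp) (by simp) (by simp)
  have hT : Function.Injective T := by
    rw [injective_iff_map_eq_zero]
    intro x hx
    exact Subtype.ext (hF x x.2 fun y hy => LinearMap.congr_fun hx ⟨y, hy⟩)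
  obtain ⟨w, hw⟩ := (LinearMap.injective_iff_surjective_of_finrank_eq_finrank
    (Subspace.dual_finrank_eq (K := K) (V := F)).symm).1 hT φ
  refine ⟨w, w.2, fun x hx => ?_⟩
  have : B w x = f (B x x) := LinearMap.congr_fun hw ⟨x, hx⟩
  rw [this, hf]

/-- Unit vectors whose orthogonal complement in `F` is alternating. -/
def altCenter (B : LinearMap.BilinForm K V) (F : Submodule K V) : Set V :=
  {v | (v ∈ F ∧ B v v = 1) ∧ AltOn B (F ⊓ B.orthogonal (K ∙ v))}

-- The complement of such a vector would be nondegenerate and alternating of odd dimension.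
omit [CharP K 2] in
theorem altCenter_eq_empty [FiniteDimensional K V] (hB : B.IsSymm) {F : Submodule K V}
    (hF : NondegOn B F) (hn : Even (finrank K F)) : altCenter B F = ∅ := by
  ext v
  simp only [Set.mem_empty_iff_false, iff_false]
  rintro ⟨⟨hv, hv1⟩, hA⟩
  have h1 := (nondegOn_inf_orthogonal_singleton hB hF hv hv1).even_finrank hB hA
  have h2 := finrank_inf_orthogonal_singleton hB hv hv1
  rw [← h2, Nat.even_add_one] at hn
  exact hn h1

/-- The vector is the `w` representing the square root of the norm: vectors orthogonal to `w` have
norm zero, and any other centre represents the same functional. What needs odd dimension is `B(w, w)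
= 1`. -/
theorem exists_altCenter_eq_singleton [Finite K] [FiniteDimensional K V] (hB : B.IsSymm)
    {F : Submodule K V} (hF : NondegOn B F) (hn : Odd (finrank K F)) :
    ∃ w, altCenter B F = {w} := by
  obtain ⟨w, hw, hwx⟩ := exists_sq_apply_eq hB hF
  have hA : AltOn B (F ⊓ B.orthogonal (K ∙ w)) := by
    rintro x ⟨hx, hx'⟩
    rw [← hwx x hx, mem_orthogonal_span_singleton.1 hx', zero_pow two_ne_zero]
  -- The defining property gives `B(w, w)^2 = B(w, w)`. If the value were 0, then `w` and a unit
  -- vector `u` would span a nondegenerate plane whose complement lies in `w^⊥`, hence is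
  -- alternating of even dimension, making `F` even-dimensional.
  have hw1 : B w w = 1 := by
    by_contra h1
    have h0 : B w w = 0 := by
      have h2 : B w w * (B w w - 1) = 0 := by linear_combination hwx w hw
      exact (mul_eq_zero.1 h2).resolve_right (sub_ne_zero.2 h1)
    have hFA : ¬ AltOn B F := fun h => Nat.not_even_iff_odd.2 hn (hF.even_finrank hB h)
    obtain ⟨u, hu, hu1⟩ := exists_apply_self_eq hFA 1
    have hwu : B w u = 1 := sq_injective_charTwo (by rw [hwx u hu, hu1, one_pow])
    have hP := nondegOn_span_pair hB h0 hwu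
    have hPF : Submodule.span K {w, u} ≤ F := span_pair_le.2 ⟨hw, hu⟩
    have hfin := hP.finrank_inf_orthogonal hB hPF
    rw [finrank_span_pair_of_apply_eq_one hB h0 hwu] at hfin
    have hev := (hP.inf_orthogonal hB hF hPF).even_finrank hB (hA.mono (inf_le_inf_left F
      (LinearMap.BilinForm.orthogonal_le (Submodule.span_mono (by simp)))))
    rw [← hfin] at hn
    exact Nat.not_even_iff_odd.2 hn (even_two.add hev)
  refine ⟨w, ?_⟩
  ext v
  rw [Set.mem_singleton_iff]
  constructor
  · rintro ⟨⟨hv, hv1⟩, hvA⟩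
    refine sub_eq_zero.1 (hF _ (F.sub_mem hv hw) fun y hy => ?_)
    rw [map_sub, LinearMap.sub_apply, sub_eq_zero]
    apply sq_injective_charTwo
    rw [hwx y hy, sq_apply_eq_of_altOn hB hv hv1 hvA hy]
  · rintro rfl
    exact ⟨⟨hw, hw1⟩, hA⟩

variable [Fintype K] [Finite V]

/-- Nondegenerate non-alternating subspaces, counted through their unit vectors. -/
theorem ncard_nonalt_mul (hB : B.IsSymm) {F : Submodule K V} (hF : NondegOn B F)
    (hFA : ¬ AltOn B F) {r : ℕ} {n₁ n₂ : ℚ}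
    (h₁ : ∀ F' : Submodule K V, NondegOn B F' → ¬ AltOn B F' → finrank K F' + 1 = finrank K F →
      ((nondegSub B F' r).ncard : ℚ) = n₁)
    (h₂ : ∀ F' : Submodule K V, NondegOn B F' → AltOn B F' → finrank K F' + 1 = finrank K F →
      ((nondegSub B F' r).ncard : ℚ) = n₂) :
    ({E | E ∈ nondegSub B F (r + 1) ∧ ¬ AltOn B E}.ncard : ℚ) * (Fintype.card K : ℚ) ^ r =
      ((Fintype.card K : ℚ) ^ (finrank K F - 1) - (altCenter B F).ncard) * n₁ +
        (altCenter B F).ncard * n₂ := by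
  have hq0 : (Fintype.card K : ℚ) ≠ 0 := by simp
  set T : Set V := {v | v ∈ F ∧ B v v = 1} with hT
  have hsub : altCenter B F ⊆ T := fun v hv => hv.1
  have hTc : (T.ncard : ℚ) = (Fintype.card K : ℚ) ^ (finrank K F - 1) := by
    refine mul_right_cancel₀ hq0 ((ncard_norm_one_mul_card hB hFA).trans ?_)
    rw [← pow_succ, Nat.sub_add_cancel]
    rw [Nat.one_le_iff_ne_zero]
    intro h
    obtain rfl : F = ⊥ := Submodule.finrank_eq_zero.1 h
    exact hFA fun x hx => by rw [(Submodule.mem_bot K).1 hx]; simp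
  have hd : ((T \ altCenter B F).ncard : ℚ) =
      (Fintype.card K : ℚ) ^ (finrank K F - 1) - (altCenter B F).ncard := by
    rw [← hTc, eq_sub_iff_add_eq]
    exact_mod_cast Set.ncard_sdiff_add_ncard_of_subset hsub
  have hthrough : ∀ v ∈ T,
      {E | E ∈ {E | E ∈ nondegSub B F (r + 1) ∧ ¬ AltOn B E} ∧ v ∈ E}.ncard =
        (nondegSub B (F ⊓ B.orthogonal (K ∙ v)) r).ncard := by
    rintro v ⟨hv, hv1⟩
    have hv' : B v v ≠ 0 := hv1 ▸ one_ne_zero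
    have hv0 : v ≠ 0 := by rintro rfl; simp at hv'
    have := ncard_nondegSub_through hB (nondegOn_span_singleton hv')
      ((Submodule.span_singleton_le_iff_mem v F).2 hv) r (fun E => ¬ AltOn B E)
    rw [finrank_span_singleton hv0, add_comm] at this
    convert this using 2
    · ext E
      simp only [Set.mem_ofPred_eq, Submodule.span_singleton_le_iff_mem, and_assoc]
    · ext E
      refine ⟨fun h => ⟨h, fun hA => hv' (hA v ?_)⟩, fun h => h.1⟩
      exact Submodule.mem_sup_left (Submodule.mem_span_singleton_self v)
  rw [← hd]
  -- A non-alternating subspace of dimension `r + 1` contains `q ^ r` unit vectors. On the other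
  -- side, unit vectors are separated by whether their complement in `F` is alternating.
  refine ncard_mul_eq_add_of_fibers Set.disjoint_sdiff_left (fun E v => v ∈ E) ?_ ?_ ?_
  · rintro E ⟨⟨hEF, hE, hr⟩, hEA⟩
    refine mul_right_cancel₀ hq0 (Eq.trans ?_ ((ncard_norm_one_mul_card hB hEA).trans ?_))
    · rw [Set.sdiff_union_of_subset hsub]
      congr 3
      ext v
      exact ⟨fun h => ⟨h.2, h.1.2⟩, fun h => ⟨⟨hEF h.1, h.2⟩, h.1⟩⟩
    · rw [hr, pow_succ]
  · rintro v ⟨hv, hv'⟩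
    rw [hthrough v hv]
    exact h₁ _ (nondegOn_inf_orthogonal_singleton hB hF hv.1 hv.2) (fun h => hv' ⟨hv, h⟩)
      (finrank_inf_orthogonal_singleton hB hv.1 hv.2)
  · rintro v hv
    rw [hthrough v hv.1]
    exact h₂ _ (nondegOn_inf_orthogonal_singleton hB hF hv.1.1 hv.1.2) hv.2
      (finrank_inf_orthogonal_singleton hB hv.1.1 hv.1.2)

/-- In odd dimension the alternating nondegenerate subspaces all lie in the alternating
hyperplane. -/
theorem ncard_alt_of_odd (hB : B.IsSymm) {F : Submodule K V} (hF : NondegOn B F)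
    (hn : Odd (finrank K F)) : ∃ F' : Submodule K V, NondegOn B F' ∧ AltOn B F' ∧
      finrank K F' + 1 = finrank K F ∧
      ∀ r, {E | E ∈ nondegSub B F r ∧ AltOn B E} = nondegSub B F' r := by
  obtain ⟨w, hw⟩ := exists_altCenter_eq_singleton hB hF hn
  have hwA : w ∈ altCenter B F := hw ▸ rfl
  obtain ⟨⟨hwF, hw1⟩, hA⟩ := hwA
  refine ⟨_, nondegOn_inf_orthogonal_singleton hB hF hwF hw1, hA,
    finrank_inf_orthogonal_singleton hB hwF hw1, fun r => ?_⟩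
  ext E
  constructor
  · rintro ⟨⟨hEF, hE, hr⟩, hEA⟩
    refine ⟨le_inf hEF fun x hx => mem_orthogonal_span_singleton.2 ?_, hE, hr⟩
    have := sq_apply_eq_of_altOn hB hwF hw1 hA (hEF hx)
    rw [hEA x hx] at this
    exact pow_eq_zero_iff two_ne_zero |>.1 this
  · rintro ⟨hEF, hE, hr⟩
    exact ⟨⟨hEF.trans inf_le_left, hE, hr⟩, hA.mono hEF⟩

/-- Alternating subspaces of an even-dimensional non-alternating space, counted through the unit
vectors orthogonal to them. -/
theorem ncard_alt_mul_of_even (hB : B.IsSymm) {F : Submodule K V} (hF : NondegOn B F)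
    (hFA : ¬ AltOn B F) (hn : Even (finrank K F)) {r : ℕ} {m : ℚ}
    (h : ∀ F' : Submodule K V, NondegOn B F' → AltOn B F' → finrank K F' + 2 = finrank K F →
      ((nondegSub B F' r).ncard : ℚ) = m) :
    ({E | E ∈ nondegSub B F r ∧ AltOn B E}.ncard : ℚ) *
      ((Fintype.card K : ℚ) ^ (finrank K F - r) / Fintype.card K) =
      (Fintype.card K : ℚ) ^ (finrank K F) / Fintype.card K * m := by
  have hq0 : (Fintype.card K : ℚ) ≠ 0 := by simp
  have hT := ncard_norm_one_mul_card hB hFA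
  rw [← eq_div_iff hq0] at hT
  rw [← hT]
  refine ncard_mul_eq_of_fibers (fun E v => v ∈ B.orthogonal E) ?_ ?_
  · rintro E ⟨⟨hEF, hE, hr⟩, hEA⟩
    have hs := hE.sup_inf_orthogonal hB hEF
    -- If `E` and its complement were both alternating, so would be `F`, the norm being additive.
    have hA : ¬ AltOn B (F ⊓ B.orthogonal E) := by
      intro hA
      refine hFA fun x hx => ?_
      rw [← hs] at hx
      obtain ⟨u, hu, v, hv, rfl⟩ := Submodule.mem_sup.1 hx
      rw [← selfApplyHom_apply hB, map_add, selfApplyHom_apply, selfApplyHom_apply, hEA u hu, hA v hv, add_zero]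
    have h1 := ncard_norm_one_mul_card hB hA
    have h2 := hE.finrank_inf_orthogonal hB hEF
    rw [show finrank K F - r = finrank K (F ⊓ B.orthogonal E : Submodule K V) by omega, ← h1,
      mul_div_cancel_right₀ _ hq0]
    congr 2
    ext v
    exact ⟨fun h => ⟨⟨h.1.1, h.2⟩, h.1.2⟩, fun h => ⟨⟨h.1.1, h.2⟩, h.1.2⟩⟩
  · rintro v ⟨hv, hv1⟩
    have hf := finrank_inf_orthogonal_singleton hB hv hv1
    obtain ⟨F', hF', hA', hf', hF'r⟩ :=
      ncard_alt_of_odd hB (nondegOn_inf_orthogonal_singleton hB hF hv hv1) (by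
        rw [← hf, Nat.even_add_one, Nat.not_even_iff_odd] at hn; exact hn)
    rw [← h F' hF' hA' (by omega), ← hF'r r]
    congr 2
    ext E
    constructor
    · rintro ⟨⟨⟨hEF, hE, hr⟩, hEA⟩, hvE⟩
      refine ⟨⟨le_inf hEF fun x hx => mem_orthogonal_span_singleton.2 ?_, hE, hr⟩, hEA⟩
      rw [hB.eq]; exact hvE x hx
    · rintro ⟨⟨hEF, hE, hr⟩, hEA⟩
      refine ⟨⟨⟨hEF.trans inf_le_left, hE, hr⟩, hEA⟩, fun x hx => ?_⟩
      have hvx := mem_orthogonal_span_singleton.1 (hEF hx).2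
      rw [hB.eq] at hvx
      exact hvx

end CharTwo

/-! ### Induction on the dimension of the subspaces in characteristic two. -/

section CharTwoCount

variable {K V : Type*} [Field K] [CharP K 2] [AddCommGroup V] [Module K V]
  {B : LinearMap.BilinForm K V} [Fintype K] [Finite V]

omit [CharP K 2] [Fintype K] in
theorem ncard_nondegSub_eq_add (F : Submodule K V) (r : ℕ) :
    ((nondegSub B F r).ncard : ℚ) = {E | E ∈ nondegSub B F r ∧ ¬ AltOn B E}.ncard +
      {E | E ∈ nondegSub B F r ∧ AltOn B E}.ncard := by
  have h : nondegSub B F r = {E | E ∈ nondegSub B F r ∧ ¬ AltOn B E} ∪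
      {E | E ∈ nondegSub B F r ∧ AltOn B E} := by
    ext E
    simp only [Set.mem_union, Set.mem_ofPred_eq]
    tauto
  conv_lhs => rw [h]
  rw [Set.ncard_union_eq]
  · push_cast; rfl
  · rw [Set.disjoint_left]
    exact fun E h h' => h.2 h'.2

omit [CharP K 2] [Fintype K] in
theorem ncard_alt_eq_zero_of_odd (hB : B.IsSymm) (F : Submodule K V) {r : ℕ} (hr : Odd r) :
    {E | E ∈ nondegSub B F r ∧ AltOn B E}.ncard = 0 := by
  have : {E | E ∈ nondegSub B F r ∧ AltOn B E} = ∅ := by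
    ext E
    simp only [Set.mem_empty_iff_false, iff_false]
    rintro ⟨⟨hEF, hE, rfl⟩, hA⟩
    exact Nat.not_even_iff_odd.2 hr (hE.even_finrank hB hA)
  rw [this, Set.ncard_empty]

/-- The number of `2k`-dimensional nondegenerate subspaces of a non-alternating space. -/
def EvenCount (B : LinearMap.BilinForm K V) (k : ℕ) : Prop :=
  ∀ F : Submodule K V, NondegOn B F → ¬ AltOn B F → ∀ j,
    (finrank K F = 2 * (k + j) → ((nondegSub B F (2 * k)).ncard : ℚ) =
      (Fintype.card K : ℚ) ^ (2 * (k * j)) * (evenProd (Fintype.card K) (k + j) /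
        (evenProd (Fintype.card K) k * evenProd (Fintype.card K) j))) ∧
    (finrank K F = 2 * (k + j) + 1 → ((nondegSub B F (2 * k)).ncard : ℚ) =
      (Fintype.card K : ℚ) ^ (2 * (k * (j + 1))) * (evenProd (Fintype.card K) (k + j) /
        (evenProd (Fintype.card K) k * evenProd (Fintype.card K) j)))

/-- The number of `2k+1`-dimensional nondegenerate subspaces of a non-alternating space. -/
def OddCount (B : LinearMap.BilinForm K V) (k : ℕ) : Prop :=
  ∀ F : Submodule K V, NondegOn B F → ¬ AltOn B F → ∀ j,
    (finrank K F = 2 * (k + j) + 1 → ((nondegSub B F (2 * k + 1)).ncard : ℚ) =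
      (Fintype.card K : ℚ) ^ (2 * (j * (k + 1))) * (evenProd (Fintype.card K) (k + j) /
        (evenProd (Fintype.card K) k * evenProd (Fintype.card K) j))) ∧
    (finrank K F = 2 * (k + j + 1) → ((nondegSub B F (2 * k + 1)).ncard : ℚ) =
      (Fintype.card K : ℚ) ^ (2 * (k * j) + 2 * k + 2 * j + 1) *
        (evenProd (Fintype.card K) (k + j) /
        (evenProd (Fintype.card K) k * evenProd (Fintype.card K) j)))

/-- Odd-dimensional nondegenerate subspaces are never alternating, so splitting off unit vectors
reaches all of them. In odd ambient dimension the single centre needs no correction, as alternating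
and non-alternating complements have the same number of even-dimensional nondegenerate subspaces. -/
theorem EvenCount.oddCount (hB : B.IsSymm) {k : ℕ} (h : EvenCount B k) : OddCount B k := by
  have hq : (1 : ℚ) < Fintype.card K := one_lt_cast_card
  have hq0 : (Fintype.card K : ℚ) ≠ 0 := by positivity
  intro F hF hFA j
  constructor
  · intro hn
    obtain ⟨w, hw⟩ := exists_altCenter_eq_singleton hB hF (by rw [hn]; simp)
    have key := ncard_nonalt_mul hB hF hFA (r := 2 * k)
      (fun F' h1 h2 h3 => (h F' h1 h2 j).1 (by omega))
      (fun F' h1 h2 h3 => ncard_nondegSub_of_altOn hB h1 h2 (k := k) (j := j) (by omega))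
    rw [hw, Set.ncard_singleton, hn, Nat.add_sub_cancel] at key
    rw [ncard_nondegSub_eq_add, ncard_alt_eq_zero_of_odd hB F (by simp), Nat.cast_zero, add_zero]
    refine mul_right_cancel₀ (pow_ne_zero (2 * k) hq0) (key.trans ?_)
    push_cast
    rw [show 2 * (k + j) = 2 * k + 2 * j by ring,
      show 2 * (j * (k + 1)) = 2 * (k * j) + 2 * j by ring, pow_add, pow_add]
    ring
  · intro hn
    have key := ncard_nonalt_mul hB hF hFA (r := 2 * k) (n₂ := 0)
      (fun F' h1 h2 h3 => (h F' h1 h2 j).2 (by omega))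
      (fun F' h1 h2 h3 => by
        have := h1.even_finrank hB h2
        rw [hn] at h3
        exact absurd (h3 ▸ (even_two_mul (k + j + 1)) : Even (finrank K F' + 1))
          (by rwa [Nat.even_add_one, not_not]))
    rw [altCenter_eq_empty hB hF (by rw [hn]; simp), Set.ncard_empty, hn, Nat.cast_zero, sub_zero,
      zero_mul, add_zero] at key
    rw [ncard_nondegSub_eq_add, ncard_alt_eq_zero_of_odd hB F (by simp), Nat.cast_zero, add_zero]
    refine mul_right_cancel₀ (pow_ne_zero (2 * k) hq0) (key.trans ?_)
    rw [← mul_assoc, ← pow_add, mul_right_comm, ← pow_add]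
    congr 2
    rw [show 2 * (k + j + 1) - 1 = 2 * k + 2 * j + 1 by omega]
    ring

/-- Non-alternating subspaces come from splitting off a unit vector, and the alternating ones are
added separately. In odd ambient dimension the centre contributes nothing to the first kind, its
complement having no odd-dimensional nondegenerate subspaces, while all subspaces of the second kind
lie in that complement. -/
theorem OddCount.evenCount (hB : B.IsSymm) {k : ℕ} (h : OddCount B k) : EvenCount B (k + 1) := by
  have hq : (1 : ℚ) < Fintype.card K := one_lt_cast_card
  have hq0 : (Fintype.card K : ℚ) ≠ 0 := by positivity
  have hP := fun m => (evenProd_pos hq m).ne'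
  intro F hF hFA j
  constructor
  · intro hn
    have hev : Even (finrank K F) := by rw [hn]; simp
    have key := ncard_nonalt_mul hB hF hFA (r := 2 * k + 1) (n₂ := 0)
      (fun F' h1 h2 h3 => (h F' h1 h2 j).1 (by omega))
      (fun F' h1 h2 h3 => by
        have := h1.even_finrank hB h2
        rw [← h3] at hev
        exact absurd hev (by rwa [Nat.even_add_one, not_not]))
    rw [altCenter_eq_empty hB hF hev, Set.ncard_empty, hn, Nat.cast_zero, sub_zero,
      zero_mul, add_zero, show 2 * (k + 1 + j) - 1 = 2 * k + 1 + 2 * j by omega,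
      pow_add _ (2 * k + 1), mul_comm, mul_assoc] at key
    have key := mul_left_cancel₀ (pow_ne_zero _ hq0) key
    rw [ncard_nondegSub_eq_add, show 2 * (k + 1) = 2 * k + 1 + 1 by ring, key]
    -- For `j = 0` the only subspace of full dimension is `F`, which is not alternating; the count
    -- through orthogonal unit vectors needs an alternating space of dimension `finrank K F - 2` and
    -- starts at `j = 1`.
    rcases j with _ | j
    · have : {E | E ∈ nondegSub B F (2 * k + 1 + 1) ∧ AltOn B E} = ∅ := by
        ext E
        simp only [Set.mem_empty_iff_false, iff_false]
        rintro ⟨⟨hEF, -, hr⟩, hA⟩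
        have := Submodule.eq_of_le_of_finrank_eq hEF (by omega)
        exact hFA (this ▸ hA)
      rw [this]
      have := hP k
      have := hP (k + 1)
      simp [evenProd_zero]
      field_simp
    · have key2 := ncard_alt_mul_of_even hB hF hFA hev (r := 2 * (k + 1))
        (fun F' h1 h2 h3 => ncard_nondegSub_of_altOn hB h1 h2 (k := k + 1) (j := j) (by omega))
      rw [hn, show 2 * (k + 1 + (j + 1)) - 2 * (k + 1) = 2 * (j + 1) by omega,
        ← eq_div_iff (by positivity)] at key2
      rw [show 2 * k + 1 + 1 = 2 * (k + 1) by ring, key2,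
        show k + 1 + (j + 1) = k + j + 1 + 1 by ring, show k + 1 + j = k + j + 1 by ring,
        show k + (j + 1) = k + j + 1 by ring,
        evenProd_succ _ (k + j + 1), evenProd_succ _ k, evenProd_succ _ j]
      have := hP k
      have := hP j
      have h1 : (Fintype.card K : ℚ) ^ (2 * (k + 1)) - 1 ≠ 0 :=
        (sub_pos.2 (one_lt_pow₀ hq (by omega))).ne'
      have h2 : (Fintype.card K : ℚ) ^ (2 * (j + 1)) - 1 ≠ 0 :=
        (sub_pos.2 (one_lt_pow₀ hq (by omega))).ne'
      rw [show (Fintype.card K : ℚ) ^ (2 * (k + j + 1 + 1)) = (Fintype.card K : ℚ) ^ (2 * (k + 1)) *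
        (Fintype.card K : ℚ) ^ (2 * (j + 1)) by rw [← pow_add]; ring,
        show 2 * ((j + 1) * (k + 1)) = 2 * ((k + 1) * j) + 2 * (k + 1) by ring,
        show 2 * ((k + 1) * (j + 1)) = 2 * ((k + 1) * j) + 2 * (k + 1) by ring, pow_add]
      field_simp
      ring
  · intro hn
    obtain ⟨w, hw⟩ := exists_altCenter_eq_singleton hB hF (by rw [hn]; simp)
    obtain ⟨F₀, h1, h2, h3, h4⟩ := ncard_alt_of_odd hB hF (by rw [hn]; simp)
    have key := ncard_nonalt_mul hB hF hFA (r := 2 * k + 1) (n₂ := 0)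
      (fun F' h1 h2 h3 => (h F' h1 h2 j).2 (by omega))
      (fun F' h1 h2 h3 => by rw [nondegSub_eq_empty_of_odd hB h2 (by simp)]; simp)
    rw [hw, Set.ncard_singleton, hn, Nat.add_sub_cancel, mul_zero, add_zero,
      show 2 * (k * j) + 2 * k + 2 * j + 1 = (2 * k + 1) + 2 * (k * j + j) by ring,
      pow_add _ (2 * k + 1), mul_assoc, mul_left_comm, mul_comm] at key
    have key := mul_left_cancel₀ (pow_ne_zero _ hq0) key
    rw [ncard_nondegSub_eq_add, h4, ncard_nondegSub_of_altOn hB h1 h2 (k := k + 1) (j := j)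
      (by omega), show 2 * (k + 1) = 2 * k + 1 + 1 by ring, key,
      show k + 1 + j = k + j + 1 by ring, evenProd_succ, evenProd_succ]
    have := hP k
    have := hP j
    have h1 : (Fintype.card K : ℚ) ^ (2 * (k + 1)) - 1 ≠ 0 :=
      (sub_pos.2 (one_lt_pow₀ hq (by omega))).ne'
    rw [show 2 * ((k + 1) * (j + 1)) = 2 * (k * j + j) + 2 * (k + 1) by ring,
      show 2 * ((k + 1) * j) = 2 * (k * j + j) by ring, pow_add]
    push_cast
    field_simp
    ring

theorem evenCount_oddCount (hB : B.IsSymm) (k : ℕ) : EvenCount B k ∧ OddCount B k := by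
  induction k with
  | zero =>
    have : EvenCount B 0 := by
      intro F _ _ j
      have := (evenProd_pos (one_lt_cast_card (K := K)) j).ne'
      simp [nondegSub_zero, evenProd_zero, this]
    exact ⟨this, this.oddCount hB⟩
  | succ k ih => exact ⟨ih.2.evenCount hB, (ih.2.evenCount hB).oddCount hB⟩

end CharTwoCount

/-! ### The field count for even `q`. -/

section StdFormTwo

variable {K : Type*} [Field K] [Fintype K]

omit [Fintype K] in
theorem fieldLCDCount_self (n : ℕ) : fieldLCDCount K n n = 1 := by
  rw [fieldLCDCount_eq_ncard]
  have : nondegSub (stdForm K n) ⊤ n = {⊤} := by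
    ext E
    rw [Set.mem_singleton_iff]
    constructor
    · rintro ⟨-, -, h⟩
      exact Submodule.eq_top_of_finrank_eq (h.trans (finrank_fin_fun K).symm)
    · rintro rfl
      exact ⟨le_rfl, nondegOn_top_stdForm n, by simp⟩
  rw [this, Set.ncard_singleton]

omit [Fintype K] in
theorem fieldLCDCount_zero (n : ℕ) : fieldLCDCount K n 0 = 1 := by
  rw [fieldLCDCount_eq_ncard, nondegSub_zero, Set.ncard_singleton]

theorem fieldLCDCount_eq_of_even (heven : Even (Fintype.card K)) {n r : ℕ} (hn : 0 < n)
    (hr : r ≤ n) : (fieldLCDCount K n r : ℚ) = lcdFormula (Fintype.card K) n r := by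
  have : CharP K 2 :=
    ringChar.of_eq (FiniteField.even_card_iff_char_two.2 (Nat.even_iff.1 heven))
  rw [lcdFormula]
  by_cases h0 : r = 0
  · rw [if_pos (Or.inl h0), h0, fieldLCDCount_zero, Nat.cast_one]
  by_cases hrn : r = n
  · rw [if_pos (Or.inr hrn), hrn, fieldLCDCount_self, Nat.cast_one]
  rw [if_neg (by tauto), if_pos heven, fieldLCDCount_eq_ncard]
  have hq : (1 : ℚ) < Fintype.card K := one_lt_cast_card
  have hq0 : (Fintype.card K : ℚ) ≠ 0 := by positivity
  have hP := fun m => (evenProd_pos hq m).ne'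
  have hA : ¬ AltOn (stdForm K n) ⊤ := by
    intro h
    have := h (Pi.single ⟨0, hn⟩ 1) trivial
    rw [stdForm_apply] at this
    simp at this
  have hN := nondegOn_top_stdForm (K := K) n
  have hf : finrank K (⊤ : Submodule K (Fin n → K)) = n := by simp
  obtain ⟨d, rfl⟩ : ∃ d, n = r + d := ⟨n - r, by omega⟩
  obtain ⟨k, rfl | rfl⟩ := r.even_or_odd' <;> obtain ⟨j, rfl | rfl⟩ := d.even_or_odd'
  · rw [((evenCount_oddCount (stdForm_isSymm _) k).1 _ hN hA j).1 (by rw [hf]; ring),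
      ← mul_add, if_neg (by simp), if_neg (by simp), if_neg (by simp)]
    -- The two-term expression of `lcdFormula` collapses to a single binomial: with `X = q^r` and `Y
    -- = q^(n-r)`, `(X + q - 1)(Y - 1) + (q Y - Y + 1)(X - 1) = q (X Y - 1)`.
    obtain ⟨k, rfl⟩ : ∃ l, k = l + 1 := ⟨k - 1, by omega⟩
    obtain ⟨j, rfl⟩ : ∃ l, j = l + 1 := ⟨j - 1, by omega⟩
    rw [show (2 * (k + 1 + (j + 1)) - 2) / 2 = k + j + 1 by omega,
      show 2 * (k + 1) / 2 = k + 1 by omega, show (2 * (k + 1) - 2) / 2 = k by omega,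
      qBinom_sq hq (by omega), qBinom_sq hq (by omega),
      show k + j + 1 - (k + 1) = j by omega, show k + j + 1 - k = j + 1 by omega,
      show k + 1 + (j + 1) = k + j + 1 + 1 by ring,
      show 2 * (k + j + 1 + 1) - 2 * (k + 1) = 2 * (j + 1) by omega,
      show (2 * (k + j + 1 + 1) * (2 * (k + 1)) - (2 * (k + 1)) ^ 2 - 2) / 2 =
        2 * (k * j) + 2 * k + 2 * j + 1 by
        rw [show 2 * (k + j + 1 + 1) * (2 * (k + 1)) =
          2 * (2 * (k * j) + 2 * k + 2 * j + 1) + 2 + (2 * (k + 1)) ^ 2 by ring]; omega,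
      show 2 * ((k + 1) * (j + 1)) = 2 * (k * j) + 2 * k + 2 * j + 1 + 1 by ring,
      evenProd_succ _ (k + j + 1), evenProd_succ _ k, evenProd_succ _ j]
    have := hP k
    have := hP j
    have h1 : (Fintype.card K : ℚ) ^ (2 * (k + 1)) - 1 ≠ 0 :=
      (sub_pos.2 (one_lt_pow₀ hq (by omega))).ne'
    have h2 : (Fintype.card K : ℚ) ^ (2 * (j + 1)) - 1 ≠ 0 :=
      (sub_pos.2 (one_lt_pow₀ hq (by omega))).ne'
    rw [show (Fintype.card K : ℚ) ^ (2 * (k + j + 1 + 1)) = (Fintype.card K : ℚ) ^ (2 * (k + 1)) *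
        (Fintype.card K : ℚ) ^ (2 * (j + 1)) by rw [← pow_add]; ring,
      pow_succ _ (2 * (k * j) + 2 * k + 2 * j + 1), pow_succ _ (2 * (j + 1))]
    generalize (Fintype.card K : ℚ) ^ (2 * (k + 1)) = X at *
    generalize (Fintype.card K : ℚ) ^ (2 * (j + 1)) = Y at *
    field_simp
    ring
  · rw [((evenCount_oddCount (stdForm_isSymm _) k).1 _ hN hA j).2 (by rw [hf]; ring),
      show 2 * k + (2 * j + 1) = 2 * (k + j) + 1 by ring, if_neg (by simp), if_neg (by simp),
      if_pos (by simp),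
      show (2 * (k + j) + 1 - 1) / 2 = k + j by omega, show 2 * k / 2 = k by omega,
      qBinom_sq hq (by omega), Nat.add_sub_cancel_left,
      show 2 * (k + j) + 1 - 2 * k + 1 = 2 * (j + 1) by omega,
      show 2 * k * (2 * (j + 1)) / 2 = 2 * (k * (j + 1)) by rw [mul_mul_mul_comm]; omega]
  · rw [((evenCount_oddCount (stdForm_isSymm _) k).2 _ hN hA j).1 (by rw [hf]; ring),
      show 2 * k + 1 + 2 * j = 2 * (k + j) + 1 by ring, if_pos (by simp),
      show (2 * (k + j) + 1 - 1) / 2 = k + j by omega, show (2 * k + 1 - 1) / 2 = k by omega,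
      qBinom_sq hq (by omega), Nat.add_sub_cancel_left,
      show 2 * (k + j) + 1 - (2 * k + 1) = 2 * j by omega,
      show 2 * j * (2 * k + 1 + 1) / 2 = 2 * (j * (k + 1)) by
        rw [show 2 * j * (2 * k + 1 + 1) = 2 * (2 * (j * (k + 1))) by ring]; omega]
  · rw [((evenCount_oddCount (stdForm_isSymm _) k).2 _ hN hA j).2 (by rw [hf]; ring),
      show 2 * k + 1 + (2 * j + 1) = 2 * (k + j + 1) by ring, if_neg (by simp),
      if_pos (by simp),
      show (2 * (k + j + 1) - 2) / 2 = k + j by omega, show (2 * k + 1 - 1) / 2 = k by omega,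
      qBinom_sq hq (by omega), Nat.add_sub_cancel_left,
      show (2 * (k + j + 1) * (2 * k + 1) - (2 * k + 1) ^ 2 + 2 * (k + j + 1) - 1) / 2 =
          2 * (k * j) + 2 * k + 2 * j + 1 by
        rw [show 2 * (k + j + 1) * (2 * k + 1) =
          4 * (k * j) + 2 * k + 2 * j + 1 + (2 * k + 1) ^ 2 by ring]; omega]

/-- The number of Euclidean LCD codes over a finite field. -/
theorem fieldLCDCount_eq {n r : ℕ} (hn : 0 < n) (hr : r ≤ n) :
    (fieldLCDCount K n r : ℚ) = lcdFormula (Fintype.card K) n r := by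
  classical
  by_cases h : Even (Fintype.card K)
  · exact fieldLCDCount_eq_of_even h hn hr
  · exact fieldLCDCount_eq_of_odd h hr

end StdFormTwo

/-! ### Arithmetic of the chain ring. -/

section ChainRing

variable {R : Type*} [CommRing R] [IsLocalRing R]

/-- The generator `γ` of the maximal ideal has nilpotency index `e`, and `1 ≤ s < e`. -/
structure IsChainData (γ : R) (e s : ℕ) : Prop where
  maximalIdeal_eq : IsLocalRing.maximalIdeal R = Ideal.span {γ}
  pow_e : γ ^ e = 0
  pow_pred_ne : γ ^ (e - 1) ≠ 0
  one_le : 1 ≤ s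
  lt : s < e

namespace IsChainData

variable {γ : R} {e s : ℕ} (h : IsChainData γ e s)
include h

theorem residue_eq_zero_iff {x : R} : IsLocalRing.residue R x = 0 ↔ γ ∣ x := by
  rw [IsLocalRing.residue_eq_zero_iff, h.maximalIdeal_eq, Ideal.mem_span_singleton]

theorem residue_eq_zero_of_dvd {x : R} {i : ℕ} (hi : 0 < i) (hx : γ ^ i ∣ x) :
    IsLocalRing.residue R x = 0 :=
  h.residue_eq_zero_iff.2 ((dvd_pow_self γ hi.ne').trans hx)

/-- The exponent is the first `i` with `γ ^ (i + 1)` not dividing `x`; it exists because `γ ^ e = 0`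
divides only zero. The cofactor is not divisible by `γ`, so it is a unit of the local ring. -/
theorem exists_eq_pow_mul {x : R} (hx : x ≠ 0) : ∃ i < e, ∃ u : Rˣ, x = γ ^ i * u := by
  classical
  have hex : ∃ i, ¬ γ ^ (i + 1) ∣ x := ⟨e - 1, fun hd => hx (by
    rw [Nat.sub_add_cancel (by have := h.lt; omega), h.pow_e] at hd
    exact zero_dvd_iff.1 hd)⟩
  have hd : γ ^ Nat.find hex ∣ x := by
    rcases Nat.eq_zero_or_pos (Nat.find hex) with h0 | h0
    · rw [h0, pow_zero]; exact one_dvd x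
    · have := Nat.find_min hex (Nat.sub_lt h0 one_pos)
      rwa [not_not, show Nat.find hex - 1 + 1 = Nat.find hex by omega] at this
  obtain ⟨u, hu⟩ := hd
  have hunit : IsUnit u := by
    by_contra hnu
    have : u ∈ IsLocalRing.maximalIdeal R := (IsLocalRing.mem_maximalIdeal u).2 hnu
    rw [h.maximalIdeal_eq, Ideal.mem_span_singleton] at this
    obtain ⟨v, rfl⟩ := this
    exact Nat.find_spec hex ⟨v, hu.trans (by ring)⟩
  refine ⟨Nat.find hex, ?_, hunit.unit, hu⟩
  by_contra hle
  rw [hu, ← Nat.add_sub_cancel' (not_lt.1 hle), pow_add, h.pow_e] at hx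
  simp at hx

theorem le_of_pow_eq_zero {m : ℕ} (hm : γ ^ m = 0) : e ≤ m := by
  by_contra hlt
  refine h.pow_pred_ne ?_
  rw [← Nat.add_sub_cancel' (show m ≤ e - 1 by omega), pow_add, hm, zero_mul]

theorem pow_mul_eq_zero_iff {i : ℕ} (hi : i ≤ e) {x : R} : γ ^ i * x = 0 ↔ γ ^ (e - i) ∣ x := by
  constructor
  · intro hx
    by_cases hx0 : x = 0
    · rw [hx0]; exact dvd_zero _
    obtain ⟨j, -, u, rfl⟩ := h.exists_eq_pow_mul hx0
    rw [← mul_assoc, ← pow_add, Units.mul_left_eq_zero] at hx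
    have := h.le_of_pow_eq_zero hx
    exact (pow_dvd_pow γ (by omega)).mul_right _
  · rintro ⟨y, rfl⟩
    rw [← mul_assoc, ← pow_add, Nat.add_sub_cancel' hi, h.pow_e, zero_mul]

theorem pow_pred_mul_eq_zero_iff {x : R} : γ ^ (e - 1) * x = 0 ↔ IsLocalRing.residue R x = 0 := by
  have := h.lt
  rw [h.pow_mul_eq_zero_iff (Nat.sub_le e 1), show e - (e - 1) = 1 by omega, pow_one,
    h.residue_eq_zero_iff]

/-- Every nonzero ideal contains the socle generator `γ ^ (e - 1)`. Hence an additive character that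
is nontrivial there detects nonzero linear maps into `R`. -/
theorem exists_mul_eq_pow_pred {x : R} (hx : x ≠ 0) : ∃ r, r * x = γ ^ (e - 1) := by
  obtain ⟨i, hi, u, rfl⟩ := h.exists_eq_pow_mul hx
  refine ⟨γ ^ (e - 1 - i) * ↑u⁻¹, ?_⟩
  rw [show γ ^ (e - 1 - i) * ↑u⁻¹ * (γ ^ i * ↑u) = γ ^ (e - 1 - i) * γ ^ i * (↑u⁻¹ * ↑u) by ring,
    Units.inv_mul, mul_one, ← pow_add, Nat.sub_add_cancel (by omega)]

/-- The residue map `Ř → R̄`. -/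
noncomputable def resCheck : RCheck γ s →+* IsLocalRing.ResidueField R :=
  Ideal.Quotient.lift _ (IsLocalRing.residue R) fun _ hx =>
    h.residue_eq_zero_of_dvd h.one_le (Ideal.mem_span_singleton.1 hx)

theorem resCheck_mk (x : R) :
    h.resCheck (Ideal.Quotient.mk _ x) = IsLocalRing.residue R x := rfl

theorem resCheck_surjective : Function.Surjective h.resCheck := fun y => by
  obtain ⟨x, rfl⟩ := IsLocalRing.residue_surjective y
  exact ⟨_, h.resCheck_mk x⟩

omit [IsLocalRing R] h in
theorem pow_smul_eq_zero (x : RCheck γ s) : γ ^ s • x = 0 := by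
  obtain ⟨x, rfl⟩ := Ideal.Quotient.mk_surjective x
  exact Ideal.Quotient.eq_zero_iff_mem.2 (Ideal.mem_span_singleton.2 ⟨x, rfl⟩)

theorem exists_eq_smul_of_resCheck {x : RCheck γ s} (hx : h.resCheck x = 0) :
    ∃ y : RCheck γ s, x = γ • y := by
  obtain ⟨x, rfl⟩ := Ideal.Quotient.mk_surjective x
  rw [h.resCheck_mk, h.residue_eq_zero_iff] at hx
  obtain ⟨y, rfl⟩ := hx
  exact ⟨Ideal.Quotient.mk _ y, rfl⟩

theorem resCheck_smul (r : R) (x : RCheck γ s) :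
    h.resCheck (r • x) = IsLocalRing.residue R r * h.resCheck x := by
  obtain ⟨x, rfl⟩ := Ideal.Quotient.mk_surjective x
  exact map_mul (IsLocalRing.residue R) r x

theorem scaleMap_injective : Function.Injective (scaleMap γ h.lt.le h.pow_e) := by
  rw [injective_iff_map_eq_zero]
  intro x hx
  obtain ⟨x, rfl⟩ := Ideal.Quotient.mk_surjective x
  rw [scaleMap_mk, h.pow_mul_eq_zero_iff (Nat.sub_le e s), Nat.sub_sub_self h.lt.le] at hx
  exact Ideal.Quotient.eq_zero_iff_mem.2 (Ideal.mem_span_singleton.2 hx)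

/-- A scaled value killed by `γ ^ (s - 1)` has zero residue. -/
theorem pow_mul_scaleMap_eq_zero_iff {x : RCheck γ s} :
    γ ^ (s - 1) * scaleMap γ h.lt.le h.pow_e x = 0 ↔ h.resCheck x = 0 := by
  obtain ⟨x, rfl⟩ := Ideal.Quotient.mk_surjective x
  have h1 := h.lt
  have h2 := h.one_le
  rw [scaleMap_mk, ← mul_assoc, ← pow_add, show s - 1 + (e - s) = e - 1 by omega,
    h.pow_pred_mul_eq_zero_iff, h.resCheck_mk]

end IsChainData

end ChainRing

/-! ### The mixed space, its bilinear form and the two residue codes. -/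

section MixedSpace

instance {R : Type*} [CommRing R] [Finite R] (γ : R) (s : ℕ) : Finite (RCheck γ s) :=
  Finite.of_surjective _ Ideal.Quotient.mk_surjective

variable {R : Type*} [CommRing R] [IsLocalRing R] {γ : R} {e s a b : ℕ} (h : IsChainData γ e s)

instance : RingHomSurjective (IsLocalRing.residue R) := ⟨IsLocalRing.residue_surjective⟩

variable (R γ s a b) in
/-- Reduction of the first block. -/
noncomputable def redFst :
    MixedSpace γ s a b →ₛₗ[IsLocalRing.residue R] (Fin a → IsLocalRing.ResidueField R) where
  toFun x i := IsLocalRing.residue R (x.1 i)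
  map_add' x y := by ext i; simp
  map_smul' r x := by ext i; simp

/-- Reduction of the second block. -/
noncomputable def IsChainData.redSnd (a b : ℕ) :
    MixedSpace γ s a b →ₛₗ[IsLocalRing.residue R] (Fin b → IsLocalRing.ResidueField R) where
  toFun x i := h.resCheck (x.2 i)
  map_add' x y := by ext i; simp
  map_smul' r x := by ext i; exact h.resCheck_smul r _

/-- The Euclidean inner product as a bilinear form. -/
noncomputable def IsChainData.form (a b : ℕ) : LinearMap.BilinForm R (MixedSpace γ s a b) :=
  LinearMap.mk₂ R (mixedInner γ h.lt.le h.pow_e)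
    (fun x y z => by
      simp only [mixedInner, Prod.fst_add, Prod.snd_add, Pi.add_apply, add_mul,
        Finset.sum_add_distrib, map_add]
      ring)
    (fun r x y => by
      simp only [mixedInner, Prod.smul_fst, Prod.smul_snd, Pi.smul_apply, smul_mul_assoc,
        ← Finset.smul_sum, map_smul, ← smul_add])
    (fun x y z => by
      simp only [mixedInner, Prod.fst_add, Prod.snd_add, Pi.add_apply, mul_add,
        Finset.sum_add_distrib, map_add]
      ring)
    (fun r x y => by
      simp only [mixedInner, Prod.smul_fst, Prod.smul_snd, Pi.smul_apply, mul_smul_comm,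
        ← Finset.smul_sum, map_smul, ← smul_add])

namespace IsChainData

theorem form_apply (x y : MixedSpace γ s a b) :
    h.form a b x y = ∑ i, x.1 i * y.1 i + scaleMap γ h.lt.le h.pow_e (∑ j, x.2 j * y.2 j) := rfl

theorem form_comm (x y : MixedSpace γ s a b) : h.form a b x y = h.form a b y x := by
  simp only [form_apply, mul_comm]

theorem mem_mixedDual {C : Submodule R (MixedSpace γ s a b)} {x : MixedSpace γ s a b} :
    x ∈ mixedDual γ h.lt.le h.pow_e C ↔ ∀ y ∈ C, h.form a b x y = 0 := Iff.rfl

/-- The reduction of the inner product is the dot product of the first blocks. -/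
theorem residue_form (x y : MixedSpace γ s a b) :
    IsLocalRing.residue R (h.form a b x y) = redFst R γ s a b x ⬝ᵥ redFst R γ s a b y := by
  obtain ⟨z, hz⟩ := Ideal.Quotient.mk_surjective (∑ j, x.2 j * y.2 j)
  have h1 := h.lt
  rw [form_apply, ← hz, scaleMap_mk, map_add,
    h.residue_eq_zero_of_dvd (show 0 < e - s by omega) (dvd_mul_right _ z), add_zero, map_sum]
  simp [dotProduct, redFst]

theorem form_eq_zero_of_forall {x : MixedSpace γ s a b} (hx : ∀ y, h.form a b x y = 0) :
    x = 0 := by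
  classical
  refine Prod.ext (funext fun i => ?_) (funext fun j => ?_)
  · have := hx (Pi.single i 1, 0)
    rw [form_apply] at this
    simpa [Pi.single_apply] using this
  · have := hx (0, Pi.single j 1)
    rw [form_apply] at this
    simp only [Pi.zero_apply, mul_zero, Finset.sum_const_zero, zero_add, Pi.single_apply, mul_ite,
      mul_one, Finset.sum_ite_eq', Finset.mem_univ, if_true] at this
    exact (map_eq_zero_iff _ h.scaleMap_injective).1 this

include h in
theorem dvd_of_mem_torsionBy {x : MixedSpace γ s a b}
    (hx : x ∈ Submodule.torsionBy R (MixedSpace γ s a b) (γ ^ s)) (i : Fin a) :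
    γ ^ (e - s) ∣ x.1 i := by
  rw [Submodule.mem_torsionBy_iff] at hx
  exact (h.pow_mul_eq_zero_iff h.lt.le).1 (congrFun (congrArg Prod.fst hx) i)

omit [IsLocalRing R] in
theorem mem_torsionBy_of_fst_eq_zero {x : MixedSpace γ s a b} (hx : x.1 = 0) :
    x ∈ Submodule.torsionBy R (MixedSpace γ s a b) (γ ^ s) := by
  rw [Submodule.mem_torsionBy_iff]
  refine Prod.ext ?_ (funext fun j => pow_smul_eq_zero (x.2 j))
  rw [Prod.smul_fst, hx, smul_zero, Prod.fst_zero]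

include h in
theorem redFst_eq_zero_of_mem_torsionBy {x : MixedSpace γ s a b}
    (hx : x ∈ Submodule.torsionBy R (MixedSpace γ s a b) (γ ^ s)) : redFst R γ s a b x = 0 := by
  have h1 := h.lt
  exact funext fun i => h.residue_eq_zero_of_dvd (show 0 < e - s by omega)
    (h.dvd_of_mem_torsionBy hx i)

/-- For vectors killed by `γ ^ s`, the inner product controls the dot product of the reductions of
the second blocks. -/
theorem dotProduct_redSnd_eq_zero {x y : MixedSpace γ s a b}
    (hx : x ∈ Submodule.torsionBy R (MixedSpace γ s a b) (γ ^ s))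
    (hy : y ∈ Submodule.torsionBy R (MixedSpace γ s a b) (γ ^ s))
    (hxy : γ ^ (s - 1) * h.form a b x y = 0) : h.redSnd a b x ⬝ᵥ h.redSnd a b y = 0 := by
  have h1 := h.lt
  have h2 := h.one_le
  -- First blocks of vectors killed by `γ ^ s` are divisible by `γ ^ (e - s)`, so the first-block
  -- part acquires the exponent `(s - 1) + 2 (e - s) = e + (e - s - 1) ≥ e`.
  have hz : γ ^ (s - 1) * ∑ i, x.1 i * y.1 i = 0 := by
    rw [Finset.mul_sum]
    refine Finset.sum_eq_zero fun i _ => ?_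
    obtain ⟨u, hu⟩ := h.dvd_of_mem_torsionBy hx i
    obtain ⟨v, hv⟩ := h.dvd_of_mem_torsionBy hy i
    rw [hu, hv, show γ ^ (s - 1) * (γ ^ (e - s) * u * (γ ^ (e - s) * v)) =
      γ ^ (s - 1 + (e - s) + (e - s)) * (u * v) by rw [pow_add, pow_add]; ring,
      show s - 1 + (e - s) + (e - s) = e + (e - s - 1) by omega, pow_add, h.pow_e, zero_mul,
      zero_mul]
  rw [form_apply, mul_add, hz, zero_add, h.pow_mul_scaleMap_eq_zero_iff, map_sum] at hxy
  simpa [dotProduct, redSnd] using hxy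

theorem redFst_surjective : Function.Surjective (redFst R γ s a b) := by
  intro z
  choose x hx using fun i => IsLocalRing.residue_surjective (z i)
  exact ⟨(x, 0), funext hx⟩

theorem exists_redSnd_eq (z : Fin b → IsLocalRing.ResidueField R) :
    ∃ x ∈ Submodule.torsionBy R (MixedSpace γ s a b) (γ ^ s), h.redSnd a b x = z := by
  choose x hx using fun i => h.resCheck_surjective (z i)
  exact ⟨(0, x), mem_torsionBy_of_fst_eq_zero rfl, funext hx⟩

/-- The residue code of the first block. -/
noncomputable def resFst (_ : IsChainData γ e s) (C : Submodule R (MixedSpace γ s a b)) :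
    Submodule (IsLocalRing.ResidueField R) (Fin a → IsLocalRing.ResidueField R) :=
  C.map (redFst R γ s a b)

/-- The residue code of the second block, taken over the codewords killed by `γ ^ s`. -/
noncomputable def resSnd (C : Submodule R (MixedSpace γ s a b)) :
    Submodule (IsLocalRing.ResidueField R) (Fin b → IsLocalRing.ResidueField R) :=
  (C ⊓ Submodule.torsionBy R (MixedSpace γ s a b) (γ ^ s)).map (h.redSnd a b)

theorem resFst_mono {C D : Submodule R (MixedSpace γ s a b)} (hCD : C ≤ D) :
    h.resFst C ≤ h.resFst D := Submodule.map_mono hCD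

theorem resSnd_mono {C D : Submodule R (MixedSpace γ s a b)} (hCD : C ≤ D) :
    h.resSnd C ≤ h.resSnd D := Submodule.map_mono (inf_le_inf_right _ hCD)

theorem resFst_sup_of_codisjoint {C D : Submodule R (MixedSpace γ s a b)} (hCD : Codisjoint C D) :
    h.resFst C ⊔ h.resFst D = ⊤ := by
  rw [resFst, resFst, ← Submodule.map_sup, hCD.eq_top, Submodule.map_top, LinearMap.range_eq_top]
  exact redFst_surjective

/-- Directness is needed besides spanning: if `c + d` is killed by `γ ^ s`, then `γ ^ s c = -γ ^ s
d` lies in `C ∩ D = 0`, so `c` and `d` are killed separately. -/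
theorem resSnd_sup_of_isCompl {C D : Submodule R (MixedSpace γ s a b)} (hCD : IsCompl C D) :
    h.resSnd C ⊔ h.resSnd D = ⊤ := by
  rw [eq_top_iff]
  intro z _
  obtain ⟨x, hx, rfl⟩ := h.exists_redSnd_eq (a := a) z
  obtain ⟨c, hc, d, hd, rfl⟩ := Submodule.mem_sup.1
    (hCD.sup_eq_top ▸ Submodule.mem_top : x ∈ C ⊔ D)
  rw [Submodule.mem_torsionBy_iff, smul_add] at hx
  have hc0 : γ ^ s • c = 0 := Submodule.disjoint_def.1 hCD.disjoint _ (C.smul_mem _ hc) (by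
    rw [eq_neg_of_add_eq_zero_left hx]; exact D.neg_mem (D.smul_mem _ hd))
  have hd0 : γ ^ s • d = 0 := by rwa [hc0, zero_add] at hx
  rw [map_add]
  exact Submodule.add_mem_sup (Submodule.mem_map_of_mem ⟨hc, hc0⟩)
    (Submodule.mem_map_of_mem ⟨hd, hd0⟩)

/-- Nakayama: a submodule with full residue codes is everything. -/
theorem eq_top_of_res [Finite R] {S : Submodule R (MixedSpace γ s a b)} (h1 : h.resFst S = ⊤)
    (h2 : h.resSnd S = ⊤) : S = ⊤ := by
  rw [eq_top_iff]
  refine Submodule.le_of_le_smul_of_le_jacobson_bot (I := IsLocalRing.maximalIdeal R)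
    (Module.Finite.fg_top) (IsLocalRing.maximalIdeal_le_jacobson ⊥) ?_
  intro m _
  obtain ⟨c, hc, hcm⟩ : redFst R γ s a b m ∈ h.resFst S := h1 ▸ Submodule.mem_top
  obtain ⟨t, ⟨htS, ht⟩, htm⟩ : h.redSnd a b (m - c) ∈ h.resSnd S := h2 ▸ Submodule.mem_top
  have h3 : redFst R γ s a b (m - c - t) = 0 := by
    rw [map_sub, map_sub, hcm, h.redFst_eq_zero_of_mem_torsionBy ht, sub_self, sub_zero]
  have h4 : h.redSnd a b (m - c - t) = 0 := by rw [map_sub, htm, sub_self]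
  choose u hu using fun i => h.residue_eq_zero_iff.1 (congrFun h3 i)
  choose v hv using fun j => h.exists_eq_smul_of_resCheck (congrFun h4 j)
  have h5 : m - c - t = γ • ((u, v) : MixedSpace γ s a b) :=
    Prod.ext (funext hu) (funext hv)
  rw [show m = (c + t) + (m - c - t) by abel, h5]
  refine Submodule.add_mem_sup (S.add_mem hc htS) (Submodule.smul_mem_smul ?_ Submodule.mem_top)
  rw [h.maximalIdeal_eq]
  exact Ideal.mem_span_singleton_self γ

theorem sup_eq_top_of_res [Finite R] {C D : Submodule R (MixedSpace γ s a b)}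
    (h1 : h.resFst C ⊔ h.resFst D = ⊤) (h2 : h.resSnd C ⊔ h.resSnd D = ⊤) : C ⊔ D = ⊤ :=
  h.eq_top_of_res
    (top_le_iff.1 (h1 ▸ sup_le (h.resFst_mono le_sup_left) (h.resFst_mono le_sup_right)))
    (top_le_iff.1 (h2 ▸ sup_le (h.resSnd_mono le_sup_left) (h.resSnd_mono le_sup_right)))

/-- An LCD code is complemented by its dual. -/
theorem isCompl_mixedDual [Finite R] {C : Submodule R (MixedSpace γ s a b)}
    (hC : IsMixedLCD γ h.lt.le h.pow_e C) : IsCompl C (mixedDual γ h.lt.le h.pow_e C) := by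
  classical
  refine ⟨disjoint_iff.2 hC, codisjoint_iff.2 (eq_top_iff.2 fun m _ => ?_)⟩
  let Ψ : C →ₗ[R] (C →ₗ[R] R) := LinearMap.compl₁₂ (h.form a b) C.subtype C.subtype
  have hΨ : Function.Injective Ψ := by
    rw [injective_iff_map_eq_zero]
    intro x hx
    have : (x : MixedSpace γ s a b) ∈ C ⊓ mixedDual γ h.lt.le h.pow_e C :=
      ⟨x.2, fun y hy => LinearMap.congr_fun hx ⟨y, hy⟩⟩
    rw [IsMixedLCD] at hC
    rw [hC] at this
    exact Subtype.ext ((Submodule.mem_bot R).1 this)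
  have : Finite C := Subtype.finite
  have := Fintype.ofFinite C
  -- Composition with a character nontrivial on the socle embeds the dual module of `C` into the
  -- character group of `C`. The dual thus has at most as many elements as `C`, and the injection
  -- `Ψ` is onto.
  obtain ⟨ψ, hψ⟩ := (AddChar.exists_apply_ne_zero (α := R) (a := γ ^ (e - 1))).2 h.pow_pred_ne
  let j : (C →ₗ[R] R) → AddChar C ℂ := fun f => ψ.compAddMonoidHom f.toAddMonoidHom
  have hj : Function.Injective j := by
    intro f g hfg
    by_contra hne
    obtain ⟨x, hx⟩ := DFunLike.exists_ne hne
    obtain ⟨r, hr⟩ := h.exists_mul_eq_pow_pred (sub_ne_zero.2 hx)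
    have h1 : ψ (f (r • x)) = ψ (g (r • x)) := DFunLike.congr_fun hfg (r • x)
    rw [f.map_smul, g.map_smul, smul_eq_mul, smul_eq_mul] at h1
    rw [mul_sub] at hr
    rw [← hr, AddChar.map_sub_eq_div, h1] at hψ
    exact hψ (div_self ((ψ.val_isUnit _).ne_zero))
  have hfin : Finite (AddChar C ℂ) := inferInstance
  have hsurj : Function.Surjective Ψ := by
    have : Finite (C →ₗ[R] R) := Finite.of_injective j hj
    refine (hΨ.bijective_of_nat_card_le ?_).2
    calc Nat.card (C →ₗ[R] R) ≤ Nat.card (AddChar C ℂ) := Nat.card_le_card_of_injective j hj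
      _ = Nat.card C := by
        rw [Nat.card_eq_fintype_card, Nat.card_eq_fintype_card]
        exact AddChar.card_eq
  -- The functional of `m` on `C` is represented by some `c` in `C`, so `m - c` lies in the dual
  -- code.
  obtain ⟨c, hc⟩ := hsurj ((h.form a b m).comp C.subtype)
  rw [← add_sub_cancel (c : MixedSpace γ s a b) m]
  refine Submodule.add_mem_sup c.2 fun y hy => ?_
  have := LinearMap.congr_fun hc ⟨y, hy⟩
  change h.form a b (m - c) y = 0
  rw [map_sub, LinearMap.sub_apply, sub_eq_zero]
  exact this.symm

end IsChainData

end MixedSpace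

/-! ### LCD codes and nondegeneracy of the residue codes. -/

section Residues

variable {R : Type*} [CommRing R] [IsLocalRing R] {γ : R} {e s a b : ℕ}

local notation "𝔽" => IsLocalRing.ResidueField R

theorem stdForm_eq_zero_of_sup {K : Type*} [Field K] {n : ℕ} {X Y : Submodule K (Fin n → K)}
    (hXY : X ⊔ Y = ⊤) {x : Fin n → K} (hX : ∀ y ∈ X, stdForm K n x y = 0)
    (hY : ∀ y ∈ Y, stdForm K n x y = 0) : x = 0 :=
  nondegOn_top_stdForm n x trivial (hXY ▸ apply_eq_zero_of_mem_sup hX hY)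

theorem nondegOn_orthogonal {K : Type*} [Field K] {n : ℕ} {X : Submodule K (Fin n → K)}
    (hX : NondegOn (stdForm K n) X) : NondegOn (stdForm K n) ((stdForm K n).orthogonal X) := by
  have := hX.inf_orthogonal (stdForm_isSymm n) (nondegOn_top_stdForm n) le_top
  rwa [top_inf_eq] at this

/-- If `Y` is nondegenerate and orthogonal to `X`, then `Z ≥ X` as soon as `Z` is orthogonal
to `Y` and `Z ⊔ Y` is everything. -/
theorem le_of_orthogonal_of_sup {K : Type*} [Field K] {n : ℕ} {X Y Z : Submodule K (Fin n → K)}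
    (hY : NondegOn (stdForm K n) Y) (hXY : ∀ x ∈ X, ∀ y ∈ Y, stdForm K n x y = 0)
    (hZY : ∀ z ∈ Z, ∀ y ∈ Y, stdForm K n z y = 0) (hsup : Z ⊔ Y = ⊤) : X ≤ Z := by
  intro x hx
  obtain ⟨z, hz, y, hy, rfl⟩ := Submodule.mem_sup.1 (hsup ▸ Submodule.mem_top : x ∈ Z ⊔ Y)
  have : y = 0 := hY y hy fun y' hy' => by
    have h1 := hXY _ hx y' hy'
    rwa [map_add, LinearMap.add_apply, hZY z hz y' hy', zero_add] at h1
  rwa [this, add_zero]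

namespace IsChainData

variable (h : IsChainData γ e s)

theorem resFst_orthogonal (C : Submodule R (MixedSpace γ s a b)) :
    ∀ x ∈ h.resFst C, ∀ y ∈ h.resFst (mixedDual γ h.lt.le h.pow_e C), stdForm 𝔽 a x y = 0 := by
  rintro _ ⟨x, hx, rfl⟩ _ ⟨y, hy, rfl⟩
  rw [stdForm_apply, ← h.residue_form, h.form_comm, (h.mem_mixedDual.1 hy) x hx, map_zero]

theorem resSnd_orthogonal (C : Submodule R (MixedSpace γ s a b)) :
    ∀ x ∈ h.resSnd C, ∀ y ∈ h.resSnd (mixedDual γ h.lt.le h.pow_e C), stdForm 𝔽 b x y = 0 := by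
  rintro _ ⟨x, hx, rfl⟩ _ ⟨y, hy, rfl⟩
  rw [stdForm_apply]
  refine h.dotProduct_redSnd_eq_zero hx.2 hy.2 ?_
  rw [h.form_comm, (h.mem_mixedDual.1 hy.1) x hx.1, mul_zero]

variable [Finite R]

/-- A radical vector of the residue code is also orthogonal to the residue code of the dual; the two
codes span, so it vanishes. -/
theorem nondegOn_resFst {C : Submodule R (MixedSpace γ s a b)}
    (hC : IsMixedLCD γ h.lt.le h.pow_e C) : NondegOn (stdForm 𝔽 a) (h.resFst C) :=
  fun x hx hxC => stdForm_eq_zero_of_sup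
    (h.resFst_sup_of_codisjoint (h.isCompl_mixedDual hC).codisjoint) hxC
    (h.resFst_orthogonal C x hx)

theorem nondegOn_resSnd {C : Submodule R (MixedSpace γ s a b)}
    (hC : IsMixedLCD γ h.lt.le h.pow_e C) : NondegOn (stdForm 𝔽 b) (h.resSnd C) :=
  fun x hx hxC => stdForm_eq_zero_of_sup
    (h.resSnd_sup_of_isCompl (h.isCompl_mixedDual hC)) hxC (h.resSnd_orthogonal C x hx)

include h in
omit [Finite R] in
theorem exists_smul_ne_zero {x : MixedSpace γ s a b} (hx : x ≠ 0) :
    ∃ i, γ ^ i • x ≠ 0 ∧ γ • γ ^ i • x = 0 := by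
  classical
  have hex : ∃ i, γ ^ i • x = 0 := ⟨e, by rw [h.pow_e, zero_smul]⟩
  have h0 : Nat.find hex ≠ 0 := fun h0 => hx (by
    have := Nat.find_spec hex
    rwa [h0, pow_zero, one_smul] at this)
  refine ⟨Nat.find hex - 1, Nat.find_min hex (by omega), ?_⟩
  rw [smul_smul, ← pow_succ', show Nat.find hex - 1 + 1 = Nat.find hex by omega]
  exact Nat.find_spec hex

include h in
omit [Finite R] in
/-- Vectors killed by `γ` are of the form `(γ ^ (e - 1) c | γ ^ (s - 1) d)`. -/
theorem exists_eq_of_smul_eq_zero {x : MixedSpace γ s a b} (hx : γ • x = 0) :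
    ∃ c : Fin a → R, ∃ d : Fin b → RCheck γ s, x = (γ ^ (e - 1) • c, γ ^ (s - 1) • d) := by
  have h1 := h.lt
  have h2 := h.one_le
  have hc : ∀ i, ∃ c, x.1 i = γ ^ (e - 1) * c := fun i => by
    have := congrFun (congrArg Prod.fst hx) i
    exact (h.pow_mul_eq_zero_iff (i := 1) (by omega)).1 (by rw [pow_one]; exact this)
  have hd : ∀ j, ∃ d, x.2 j = γ ^ (s - 1) • d := fun j => by
    have hj : γ • x.2 j = 0 := congrFun (congrArg Prod.snd hx) j
    obtain ⟨w, hw⟩ := Ideal.Quotient.mk_surjective (x.2 j)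
    rw [← hw] at hj ⊢
    obtain ⟨v, hv⟩ := Ideal.mem_span_singleton.1 (Ideal.Quotient.eq_zero_iff_mem.1 hj :
      γ * w ∈ Ideal.span {γ ^ s})
    have h3 : γ ^ 1 * (w - γ ^ (s - 1) * v) = 0 := by
      rw [pow_one, mul_sub, hv, ← mul_assoc, ← pow_succ', Nat.sub_add_cancel h2, sub_self]
    obtain ⟨u, hu⟩ := (h.pow_mul_eq_zero_iff (by omega)).1 h3
    have h4 : w = γ ^ (s - 1) * (v + γ ^ (e - s) * u) := by
      rw [mul_add, ← mul_assoc, ← pow_add, show s - 1 + (e - s) = e - 1 by omega, ← hu]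
      ring
    exact ⟨Ideal.Quotient.mk _ (v + γ ^ (e - s) * u), congrArg (Ideal.Quotient.mk _) h4⟩
  choose c hc using hc
  choose d hd using hd
  exact ⟨c, d, Prod.ext (funext hc) (funext hd)⟩

omit [IsLocalRing R] [Finite R] in
theorem smul_eq_zero_of_le {i : ℕ} (hi : s ≤ i) (x : RCheck γ s) : γ ^ i • x = 0 := by
  rw [← Nat.add_sub_cancel' hi, pow_add, mul_smul, pow_smul_eq_zero]

omit [Finite R] in
/-- A direct summand with nondegenerate residue codes is LCD. -/
theorem isMixedLCD_of_isCompl {C D : Submodule R (MixedSpace γ s a b)} (hCD : IsCompl C D)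
    (h1 : NondegOn (stdForm 𝔽 a) (h.resFst C)) (h2 : NondegOn (stdForm 𝔽 b) (h.resSnd C)) :
    IsMixedLCD γ h.lt.le h.pow_e C := by
  have hes := h.lt
  have hs1 := h.one_le
  rw [IsMixedLCD, eq_bot_iff]
  intro x₀ hx₀
  rw [Submodule.mem_bot]
  by_contra hne
  -- A multiple of the vector is nonzero, still in `C ∩ C^⊥`, and killed by `γ`.
  obtain ⟨i, hi, hγ⟩ := h.exists_smul_ne_zero hne
  have hx := Submodule.smul_mem _ (γ ^ i) hx₀
  generalize γ ^ i • x₀ = x at *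
  clear x₀ hne hx₀
  have hxC : ∀ z ∈ C, h.form a b x z = 0 := h.mem_mixedDual.1 hx.2
  obtain ⟨c, d, hcd⟩ := h.exists_eq_of_smul_eq_zero hγ
  have hproj : ∀ y : MixedSpace γ s a b, ∃ u ∈ C, ∃ v ∈ D, u + v = y := fun y =>
    Submodule.mem_sup.1 (hCD.sup_eq_top ▸ Submodule.mem_top)
  have hunique : ∀ u ∈ C, ∀ v ∈ D, u + v ∈ C → v = 0 := fun u hu v hv huv =>
    Submodule.disjoint_def.1 hCD.disjoint v (by simpa using C.sub_mem huv hu) hv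
  -- The coefficient vectors of `x` need not lie in `C`; they are replaced by their components `u`,
  -- `y` along `C ⊕ D`, which still represent `x` because `x` lies in `C`.
  obtain ⟨u, hu, u', hu', huu⟩ := hproj (c, 0)
  obtain ⟨y, hy, y', hy', hyy⟩ := hproj (0, d)
  have hyT : y ∈ Submodule.torsionBy R (MixedSpace γ s a b) (γ ^ s) := by
    have h3 : γ ^ s • y + γ ^ s • y' = 0 := by
      rw [← smul_add, hyy]
      exact (Submodule.mem_torsionBy_iff _ _).1 (mem_torsionBy_of_fst_eq_zero rfl)
    have h4 := hunique _ (C.smul_mem (γ ^ s) hy) _ (D.smul_mem _ hy') (h3 ▸ C.zero_mem)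
    rw [h4, add_zero] at h3
    exact (Submodule.mem_torsionBy_iff _ _).2 h3
  have hxuy : x = γ ^ (e - 1) • u + γ ^ (s - 1) • y := by
    have h3 : x = (γ ^ (e - 1) • u + γ ^ (s - 1) • y) + (γ ^ (e - 1) • u' + γ ^ (s - 1) • y') := by
      rw [add_add_add_comm, ← smul_add, ← smul_add, huu, hyy, hcd]
      simp
    have h4 := hunique _ (C.add_mem (C.smul_mem _ hu) (C.smul_mem _ hy)) _
      (D.add_mem (D.smul_mem _ hu') (D.smul_mem _ hy')) (h3 ▸ hx.1)
    rwa [h4, add_zero] at h3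
  -- Pairing with codewords killed by `γ ^ s` eliminates `u`, whose contribution has zero residue
  -- before multiplication by `γ ^ (e - 1)`. So the residue of `y` is in the radical of the second
  -- residue code and vanishes; moreover `γ ^ (e - 1)` kills the second block of `u`, as `s ≤ e -
  -- 1`.
  have hx2 : x.2 = 0 := by
    have h3 : h.redSnd a b y = 0 := by
      refine h2 _ (Submodule.mem_map_of_mem ⟨hy, hyT⟩) ?_
      rintro _ ⟨z, ⟨hz, hzT⟩, rfl⟩
      refine h.dotProduct_redSnd_eq_zero hyT hzT ?_
      have h4 := hxC z hz
      rw [hxuy, map_add, map_smul, map_smul, LinearMap.add_apply, LinearMap.smul_apply,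
        LinearMap.smul_apply, smul_eq_mul, smul_eq_mul, h.pow_pred_mul_eq_zero_iff.2, zero_add] at h4
      · exact h4
      · rw [h.residue_form, h.redFst_eq_zero_of_mem_torsionBy hzT, dotProduct_zero]
    funext j
    obtain ⟨w, hw⟩ := h.exists_eq_smul_of_resCheck (congrFun h3 j)
    rw [hxuy]
    change γ ^ (e - 1) • u.2 j + γ ^ (s - 1) • y.2 j = 0
    rw [hw, smul_smul, ← pow_succ, smul_eq_zero_of_le (by omega), smul_eq_zero_of_le (by omega),
      add_zero]
  have hxu : x = γ ^ (e - 1) • u := by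
    have h3 : x = γ ^ (e - 1) • u + γ ^ (e - 1) • u' := by
      rw [← smul_add, huu]
      refine Prod.ext (by rw [hcd]; rfl) (hx2.trans ?_)
      change 0 = γ ^ (e - 1) • (0 : Fin b → RCheck γ s)
      rw [smul_zero]
    have h4 := hunique _ (C.smul_mem _ hu) _ (D.smul_mem _ hu') (h3 ▸ hx.1)
    rwa [h4, add_zero] at h3
  -- With `x = γ ^ (e - 1) u`, orthogonality to all of `C` puts the residue of `u` in the radical of
  -- the first residue code.
  have h5 : redFst R γ s a b u = 0 := by
    refine h1 _ (Submodule.mem_map_of_mem hu) ?_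
    rintro _ ⟨z, hz, rfl⟩
    have h4 := hxC z hz
    rw [hxu, map_smul, LinearMap.smul_apply, smul_eq_mul, h.pow_pred_mul_eq_zero_iff,
      h.residue_form] at h4
    exact h4
  refine hi (Prod.ext (funext fun i => ?_) hx2)
  rw [hxu]
  exact h.pow_pred_mul_eq_zero_iff.2 (congrFun h5 i)

/-- Over a suitable complement `D`, the LCD codes with residue codes `X` and `W` are the complements
of `D` whose residue codes are contained in `X` and `W`. -/
theorem isMixedLCD_and_res_eq_iff {X : Submodule 𝔽 (Fin a → 𝔽)} {W : Submodule 𝔽 (Fin b → 𝔽)}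
    (hX : NondegOn (stdForm 𝔽 a) X) (hW : NondegOn (stdForm 𝔽 b) W)
    {U D : Submodule R (MixedSpace γ s a b)} (hUD : IsCompl U D)
    (hDX : h.resFst D = (stdForm 𝔽 a).orthogonal X)
    (hDW : h.resSnd D = (stdForm 𝔽 b).orthogonal W) (C : Submodule R (MixedSpace γ s a b)) :
    (IsMixedLCD γ h.lt.le h.pow_e C ∧ h.resFst C = X ∧ h.resSnd C = W) ↔
      IsCompl C D ∧ h.resFst C ≤ X ∧ h.resSnd C ≤ W := by
  have hXD : ∀ x ∈ X, ∀ y ∈ h.resFst D, stdForm 𝔽 a x y = 0 := fun x hx y hy => by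
    rw [hDX] at hy; exact hy x hx
  have hWD : ∀ x ∈ W, ∀ y ∈ h.resSnd D, stdForm 𝔽 b x y = 0 := fun x hx y hy => by
    rw [hDW] at hy; exact hy x hx
  have hXc := hX.isCompl (stdForm_isSymm a)
  have hWc := hW.isCompl (stdForm_isSymm b)
  rw [← hDX] at hXc
  rw [← hDW] at hWc
  constructor
  · rintro ⟨hC, rfl, rfl⟩
    -- Spanning follows from Nakayama. For disjointness, `D` is itself LCD and the residue codes of
    -- `D^⊥` contain those of `C`; hence `D^⊥ + C^⊥` has full residue codes and is everything, and a
    -- vector of `C ∩ D` is orthogonal to all of `M`.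
    refine ⟨⟨?_, codisjoint_iff.2 (h.sup_eq_top_of_res hXc.sup_eq_top hWc.sup_eq_top)⟩, le_rfl,
      le_rfl⟩
    have hDX' : NondegOn (stdForm 𝔽 a) (h.resFst D) := hDX ▸ nondegOn_orthogonal hX
    have hDW' : NondegOn (stdForm 𝔽 b) (h.resSnd D) := hDW ▸ nondegOn_orthogonal hW
    have hD := h.isMixedLCD_of_isCompl hUD.symm hDX' hDW'
    have hDc := h.isCompl_mixedDual hD
    have h1 : h.resFst C ≤ h.resFst (mixedDual γ h.lt.le h.pow_e D) :=
      le_of_orthogonal_of_sup hDX' hXD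
        (fun z hz y hy => by
          rw [(stdForm_isSymm a).eq]; exact h.resFst_orthogonal D y hy z hz)
        (h.resFst_sup_of_codisjoint hDc.symm.codisjoint)
    have h2 : h.resSnd C ≤ h.resSnd (mixedDual γ h.lt.le h.pow_e D) :=
      le_of_orthogonal_of_sup hDW' hWD
        (fun z hz y hy => by
          rw [(stdForm_isSymm b).eq]; exact h.resSnd_orthogonal D y hy z hz)
        (h.resSnd_sup_of_isCompl hDc.symm)
    have hCc := h.isCompl_mixedDual hC
    have h3 : mixedDual γ h.lt.le h.pow_e D ⊔ mixedDual γ h.lt.le h.pow_e C = ⊤ := by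
      refine h.sup_eq_top_of_res (top_le_iff.1 ?_) (top_le_iff.1 ?_)
      · rw [← h.resFst_sup_of_codisjoint hCc.codisjoint]
        exact sup_le_sup_right h1 _
      · rw [← h.resSnd_sup_of_isCompl hCc]
        exact sup_le_sup_right h2 _
    rw [Submodule.disjoint_def]
    intro m hmC hmD
    refine h.form_eq_zero_of_forall fun y => apply_eq_zero_of_mem_sup (B := h.form a b)
      (E := mixedDual γ h.lt.le h.pow_e D) (F := mixedDual γ h.lt.le h.pow_e C)
      (fun z hz => ?_) (fun z hz => ?_) y (h3 ▸ Submodule.mem_top)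
    · rw [h.form_comm]; exact h.mem_mixedDual.1 hz m hmD
    · rw [h.form_comm]; exact h.mem_mixedDual.1 hz m hmC
  · rintro ⟨hCD, hCX, hCW⟩
    have h1 : h.resFst C = X := by
      refine hCX.antisymm fun x hx => ?_
      obtain ⟨c, hc, d, hd, hcd⟩ := Submodule.mem_sup.1
        (h.resFst_sup_of_codisjoint hCD.codisjoint ▸ Submodule.mem_top :
          x ∈ h.resFst C ⊔ h.resFst D)
      have : d = 0 := Submodule.disjoint_def.1 hXc.disjoint d
        (by rw [eq_sub_of_add_eq' hcd]; exact X.sub_mem hx (hCX hc)) hd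
      rwa [← hcd, this, add_zero]
    have h2 : h.resSnd C = W := by
      refine hCW.antisymm fun x hx => ?_
      obtain ⟨c, hc, d, hd, hcd⟩ := Submodule.mem_sup.1
        (h.resSnd_sup_of_isCompl hCD ▸ Submodule.mem_top : x ∈ h.resSnd C ⊔ h.resSnd D)
      have : d = 0 := Submodule.disjoint_def.1 hWc.disjoint d
        (by rw [eq_sub_of_add_eq' hcd]; exact W.sub_mem hx (hCW hc)) hd
      rwa [← hcd, this, add_zero]
    exact ⟨h.isMixedLCD_of_isCompl hCD (h1 ▸ hX) (h2 ▸ hW), h1, h2⟩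

end IsChainData

end Residues

/-! ### Cardinalities of annihilators and kernels of reduction. -/

theorem natCard_eq_mul_ker {A B : Type*} [AddGroup A] [AddGroup B] (f : A →+ B)
    (hf : Function.Surjective f) : Nat.card A = Nat.card B * Nat.card f.ker := by
  rw [AddSubgroup.card_eq_card_quotient_mul_card_addSubgroup f.ker,
    Nat.card_congr (QuotientAddGroup.quotientKerEquivOfSurjective f hf).toEquiv]

section Cardinality

instance finite_residueField {R : Type*} [CommRing R] [IsLocalRing R] [Finite R] :
    Finite (IsLocalRing.ResidueField R) :=
  Finite.of_surjective _ IsLocalRing.residue_surjective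

variable {R : Type*} [CommRing R] [IsLocalRing R] [Finite R] {γ : R} {e s : ℕ}

namespace IsChainData

variable (h : IsChainData γ e s)
include h

/-- Multiplication by `γ ^ (e - 1)` maps `R` onto the annihilator of `γ` and has the same kernel as
the residue map. -/
theorem card_pow_ann_one :
    Nat.card {x : R // γ ^ 1 * x = 0} = Nat.card (IsLocalRing.ResidueField R) := by
  have hlt := h.lt
  let f : R →+ (LinearMap.mulLeft R (γ ^ 1)).ker.toAddSubgroup :=
    (AddMonoidHom.mulLeft (γ ^ (e - 1))).codRestrict _ fun x => by
      change γ ^ 1 * (γ ^ (e - 1) * x) = 0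
      rw [← mul_assoc, ← pow_add, show 1 + (e - 1) = e by omega, h.pow_e, zero_mul]
  have hf : Function.Surjective f := by
    rintro ⟨y, hy⟩
    obtain ⟨z, rfl⟩ := (h.pow_mul_eq_zero_iff (by omega)).1 (show γ ^ 1 * y = 0 from hy)
    exact ⟨z, rfl⟩
  have h1 := natCard_eq_mul_ker f hf
  have h2 := natCard_eq_mul_ker (IsLocalRing.residue R).toAddMonoidHom
    IsLocalRing.residue_surjective
  have h3 : f.ker = (IsLocalRing.residue R).toAddMonoidHom.ker := by
    ext x
    rw [AddMonoidHom.mem_ker, AddMonoidHom.mem_ker]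
    exact Subtype.ext_iff.trans h.pow_pred_mul_eq_zero_iff
  rw [h3] at h1
  exact Nat.eq_of_mul_eq_mul_right Nat.card_pos (h1.symm.trans h2)

/-- Multiplication by `γ ^ i` maps the annihilator of `γ ^ (i + 1)` onto that of `γ`, with kernel
the annihilator of `γ ^ i`. -/
theorem card_pow_ann {i : ℕ} (hi : i ≤ e) :
    Nat.card {x : R // γ ^ i * x = 0} = Nat.card (IsLocalRing.ResidueField R) ^ i := by
  induction i with
  | zero =>
    rw [pow_zero (Nat.card _), Nat.card_eq_one_iff_unique]
    refine ⟨⟨fun x y => Subtype.ext ?_⟩, ⟨⟨0, mul_zero _⟩⟩⟩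
    have hx := x.2
    have hy := y.2
    simp only [pow_zero, one_mul] at hx hy
    rw [hx, hy]
  | succ i ih =>
    let f : (LinearMap.mulLeft R (γ ^ (i + 1))).ker.toAddSubgroup →+
        (LinearMap.mulLeft R (γ ^ 1)).ker.toAddSubgroup :=
      ((AddMonoidHom.mulLeft (γ ^ i)).comp (AddSubgroup.subtype _)).codRestrict _ fun x => by
        change γ ^ 1 * (γ ^ i * (x : R)) = 0
        rw [← mul_assoc, ← pow_add, add_comm]
        exact x.2
    have hf : Function.Surjective f := by
      rintro ⟨y, hy⟩
      obtain ⟨z, rfl⟩ := (h.pow_mul_eq_zero_iff (by omega)).1 (show γ ^ 1 * y = 0 from hy)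
      refine ⟨⟨γ ^ (e - 1 - i) * z, ?_⟩, Subtype.ext ?_⟩
      · change γ ^ (i + 1) * (γ ^ (e - 1 - i) * z) = 0
        rw [← mul_assoc, ← pow_add, show i + 1 + (e - 1 - i) = e by omega, h.pow_e, zero_mul]
      · change γ ^ i * (γ ^ (e - 1 - i) * z) = γ ^ (e - 1) * z
        rw [← mul_assoc, ← pow_add, show i + (e - 1 - i) = e - 1 by omega]
    have h1 := natCard_eq_mul_ker f hf
    have h2 : Nat.card f.ker = Nat.card {x : R // γ ^ i * x = 0} := by
      refine Nat.card_congr ⟨fun x => ⟨x.1.1, congrArg Subtype.val x.2⟩,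
        fun x => ⟨⟨x.1, ?_⟩, Subtype.ext x.2⟩, fun _ => rfl, fun _ => rfl⟩
      change γ ^ (i + 1) * x.1 = 0
      rw [pow_succ', mul_assoc, x.2, mul_zero]
    rw [h2, ih (by omega)] at h1
    change Nat.card {x : R // γ ^ (i + 1) * x = 0} = Nat.card {x : R // γ ^ 1 * x = 0} * _ at h1
    rw [h1, h.card_pow_ann_one, pow_succ']

theorem card_eq : Nat.card R = Nat.card (IsLocalRing.ResidueField R) ^ e := by
  rw [← h.card_pow_ann le_rfl]
  exact (Nat.card_congr (Equiv.subtypeUnivEquiv fun x => by rw [h.pow_e, zero_mul])).symm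

/-- The ideal generated by `γ ^ s` is the annihilator of `γ ^ (e - s)`. -/
theorem card_check : Nat.card (RCheck γ s) = Nat.card (IsLocalRing.ResidueField R) ^ s := by
  have h1 := Submodule.card_eq_card_quotient_mul_card (Ideal.span {γ ^ s})
  have h2 : Nat.card (Ideal.span {γ ^ s}) = Nat.card {x : R // γ ^ (e - s) * x = 0} := by
    refine Nat.card_congr (Equiv.subtypeEquivRight fun x => ?_)
    rw [Ideal.mem_span_singleton, h.pow_mul_eq_zero_iff (Nat.sub_le e s),
      Nat.sub_sub_self h.lt.le]
  rw [h2, h.card_pow_ann (Nat.sub_le e s), h.card_eq] at h1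
  refine Nat.eq_of_mul_eq_mul_right (m := Nat.card (IsLocalRing.ResidueField R) ^ (e - s))
    (pow_pos Nat.card_pos _) ?_
  rw [← pow_add, Nat.add_sub_cancel' h.lt.le, h1, mul_comm]

theorem card_residue_ker :
    Nat.card {x : R // IsLocalRing.residue R x = 0} =
      Nat.card (IsLocalRing.ResidueField R) ^ (e - 1) := by
  have h1 := natCard_eq_mul_ker (IsLocalRing.residue R).toAddMonoidHom
    IsLocalRing.residue_surjective
  have h2 : Nat.card (IsLocalRing.ResidueField R) ^ e = Nat.card (IsLocalRing.ResidueField R) *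
      Nat.card (IsLocalRing.ResidueField R) ^ (e - 1) :=
    (mul_pow_sub_one (Nat.ne_zero_of_lt h.lt) _).symm
  rw [h.card_eq, h2] at h1
  exact (Nat.eq_of_mul_eq_mul_left Nat.card_pos h1).symm

theorem card_resCheck_ker :
    Nat.card {x : RCheck γ s // h.resCheck x = 0} =
      Nat.card (IsLocalRing.ResidueField R) ^ (s - 1) := by
  have h1 := natCard_eq_mul_ker h.resCheck.toAddMonoidHom h.resCheck_surjective
  rw [h.card_check] at h1
  have h3 : Nat.card (IsLocalRing.ResidueField R) ^ s = Nat.card (IsLocalRing.ResidueField R) *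
      Nat.card (IsLocalRing.ResidueField R) ^ (s - 1) :=
    (mul_pow_sub_one (Nat.ne_zero_of_lt h.one_le) _).symm
  exact (Nat.eq_of_mul_eq_mul_left Nat.card_pos (h3.symm.trans h1)).symm

variable (a b : ℕ)

theorem card_mixedSpace : Nat.card (MixedSpace γ s a b) =
    Nat.card (IsLocalRing.ResidueField R) ^ (e * a + s * b) := by
  rw [Nat.card_prod, Nat.card_fun, Nat.card_fun, Nat.card_fin, Nat.card_fin, h.card_eq,
    h.card_check, ← pow_mul, ← pow_mul, pow_add]

theorem card_redFst_ker : Nat.card {x : MixedSpace γ s a b // redFst R γ s a b x = 0} =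
    Nat.card (IsLocalRing.ResidueField R) ^ ((e - 1) * a + s * b) := by
  have E : {x : MixedSpace γ s a b // redFst R γ s a b x = 0} ≃
      (Fin a → {x : R // IsLocalRing.residue R x = 0}) × (Fin b → RCheck γ s) :=
    ⟨fun x => (fun i => ⟨x.1.1 i, congrFun x.2 i⟩, x.1.2),
      fun x => ⟨(fun i => (x.1 i).1, x.2), funext fun i => (x.1 i).2⟩, fun _ => rfl, fun _ => rfl⟩
  rw [Nat.card_congr E, Nat.card_prod, Nat.card_fun, Nat.card_fun, Nat.card_fin, Nat.card_fin,
    h.card_residue_ker, h.card_check, ← pow_mul, ← pow_mul, pow_add]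

theorem card_torsionBy_redSnd_ker : Nat.card {x : MixedSpace γ s a b //
      x ∈ Submodule.torsionBy R (MixedSpace γ s a b) (γ ^ s) ∧ h.redSnd a b x = 0} =
    Nat.card (IsLocalRing.ResidueField R) ^ (s * a + (s - 1) * b) := by
  have E : {x : MixedSpace γ s a b //
      x ∈ Submodule.torsionBy R (MixedSpace γ s a b) (γ ^ s) ∧ h.redSnd a b x = 0} ≃
      (Fin a → {x : R // γ ^ s * x = 0}) × (Fin b → {x : RCheck γ s // h.resCheck x = 0}) :=
    ⟨fun x => (fun i => ⟨x.1.1 i, congrFun (congrArg Prod.fst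
        ((Submodule.mem_torsionBy_iff _ _).1 x.2.1)) i⟩, fun j => ⟨x.1.2 j, congrFun x.2.2 j⟩),
      fun x => ⟨(fun i => (x.1 i).1, fun j => (x.2 j).1),
        (Submodule.mem_torsionBy_iff _ _).2 (Prod.ext (funext fun i => (x.1 i).2)
          (funext fun j => pow_smul_eq_zero _)), funext fun j => (x.2 j).2⟩,
      fun _ => rfl, fun _ => rfl⟩
  rw [Nat.card_congr E, Nat.card_prod, Nat.card_fun, Nat.card_fun, Nat.card_fin, Nat.card_fin,
    h.card_pow_ann h.lt.le, h.card_resCheck_ker, ← pow_mul, ← pow_mul, pow_add]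

end IsChainData

end Cardinality

/-! ### Linear maps between mixed spaces. -/

section Homs

variable {R : Type*} [CommRing R] {γ : R} {s k l : ℕ} {N : Type*} [AddCommGroup N] [Module R N]

/-- A linear map out of a mixed space is determined by its values on the standard generators. -/
theorem mixedSpace_hom_ext {φ ψ : MixedSpace γ s k l →ₗ[R] N}
    (h1 : ∀ i, φ (Pi.single i 1, 0) = ψ (Pi.single i 1, 0))
    (h2 : ∀ j, φ (0, Pi.single j 1) = ψ (0, Pi.single j 1)) : φ = ψ := by
  refine LinearMap.prod_ext (LinearMap.pi_ext' fun i => LinearMap.ext_ring (h1 i))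
    (LinearMap.pi_ext' fun j => Submodule.linearMap_qext _ (LinearMap.ext_ring (h2 j)))

/-- Values on the standard generators, of which the last `l` are killed by `γ ^ s`, extend to a
linear map. -/
theorem exists_mixedSpace_hom (p : Fin k → N) (r : Fin l → N) (hr : ∀ j, γ ^ s • r j = 0) :
    ∃ φ : MixedSpace γ s k l →ₗ[R] N, (∀ i, φ (Pi.single i 1, 0) = p i) ∧
      ∀ j, φ (0, Pi.single j 1) = r j := by
  let ρ : Fin l → (RCheck γ s →ₗ[R] N) := fun j =>
    Submodule.liftQ (Ideal.span {γ ^ s}) (LinearMap.toSpanSingleton R N (r j)) (by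
      rw [Ideal.span, Submodule.span_le, Set.singleton_subset_iff]
      exact hr j)
  have hρ : ∀ j, ρ j 1 = r j := fun j => one_smul R (r j)
  refine ⟨LinearMap.coprod (Fintype.linearCombination R p) (LinearMap.lsum R _ R ρ), ?_, ?_⟩
  · intro i
    simp
  · intro j
    rw [LinearMap.coprod_apply, map_zero, zero_add, LinearMap.lsum_apply, LinearMap.sum_apply,
      Finset.sum_eq_single j]
    · simp [hρ]
    · intro i _ hij
      simp [hij]
    · simp

end Homs

section HomCount

variable {R : Type*} [CommRing R] [IsLocalRing R] [Finite R] {γ : R} {e s : ℕ}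

namespace IsChainData

variable (h : IsChainData γ e s)

/-- Linear maps between mixed spaces whose residues vanish. -/
def smallHoms (k l k' l' : ℕ) : Set (MixedSpace γ s k l →ₗ[R] MixedSpace γ s k' l') :=
  {φ | (∀ x, redFst R γ s k' l' (φ x) = 0) ∧
    ∀ x ∈ Submodule.torsionBy R (MixedSpace γ s k l) (γ ^ s), h.redSnd k' l' (φ x) = 0}

/-- A map is determined by the images of the generators. A first-block generator may go anywhere in
the kernel of `redFst`; a second-block generator must go to a vector killed by `γ ^ s` with zero
second residue, its first residue then vanishing automatically. -/
theorem ncard_smallHoms (k l k' l' : ℕ) : (h.smallHoms k l k' l').ncard =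
    Nat.card (IsLocalRing.ResidueField R) ^
      (((e - 1) * k' + s * l') * k + (s * k' + (s - 1) * l') * l) := by
  have hlt := h.lt
  let P := {x : MixedSpace γ s k' l' // redFst R γ s k' l' x = 0}
  let Q := {x : MixedSpace γ s k' l' //
      x ∈ Submodule.torsionBy R (MixedSpace γ s k' l') (γ ^ s) ∧ h.redSnd k' l' x = 0}
  have hT : ∀ (φ : MixedSpace γ s k l →ₗ[R] MixedSpace γ s k' l') (x),
      x ∈ Submodule.torsionBy R (MixedSpace γ s k l) (γ ^ s) →
      φ x ∈ Submodule.torsionBy R (MixedSpace γ s k' l') (γ ^ s) := fun φ x hx => by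
    rw [Submodule.mem_torsionBy_iff] at hx ⊢
    rw [← map_smul, hx, map_zero]
  let f : h.smallHoms k l k' l' → (Fin k → P) × (Fin l → Q) := fun φ =>
    (fun i => ⟨φ.1 (Pi.single i 1, 0), φ.2.1 _⟩,
      fun j => ⟨φ.1 (0, Pi.single j 1), hT _ _ (mem_torsionBy_of_fst_eq_zero rfl),
        φ.2.2 _ (mem_torsionBy_of_fst_eq_zero rfl)⟩)
  have hf : Function.Bijective f := by
    constructor
    · intro φ ψ hφψ
      exact Subtype.ext (mixedSpace_hom_ext
        (fun i => congrArg Subtype.val (congrFun (congrArg Prod.fst hφψ) i))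
        (fun j => congrArg Subtype.val (congrFun (congrArg Prod.snd hφψ) j)))
    · rintro ⟨p, r⟩
      obtain ⟨φ, h1, h2⟩ := exists_mixedSpace_hom (γ := γ) (s := s) (fun i => (p i).1)
        (fun j => (r j).1) (fun j => (Submodule.mem_torsionBy_iff _ _).1 (r j).2.1)
      have hdec : ∀ x : MixedSpace γ s k l, ∃ c : Fin l → R,
          φ x = ∑ i, x.1 i • (p i).1 + ∑ j, c j • (r j).1 := by
        intro x
        choose c hc using fun j => Ideal.Quotient.mk_surjective (x.2 j)
        refine ⟨c, ?_⟩
        have hx : x = ∑ i, x.1 i • ((Pi.single i 1, 0) : MixedSpace γ s k l) +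
            ∑ j, c j • ((0, Pi.single j 1) : MixedSpace γ s k l) := by
          refine Prod.ext ?_ ?_
          · rw [Prod.fst_add, Prod.fst_sum, Prod.fst_sum]
            ext i
            simp [Finset.sum_apply, Pi.single_apply]
          · rw [Prod.snd_add, Prod.snd_sum, Prod.snd_sum]
            ext j
            simp only [Prod.smul_snd, smul_zero, Finset.sum_const_zero, zero_add,
              Finset.sum_apply, Pi.smul_apply, Pi.single_apply, smul_ite, Finset.sum_ite_eq,
              Finset.mem_univ, if_true]
            rw [← hc j]
            exact congrArg (Ideal.Quotient.mk _) (mul_one (c j)).symm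
        conv_lhs => rw [hx]
        simp only [map_add, map_sum, map_smul, h1, h2]
      refine ⟨⟨φ, fun x => ?_, fun x hx => ?_⟩, ?_⟩
      · obtain ⟨c, hc⟩ := hdec x
        rw [hc, map_add, map_sum, map_sum]
        simp [LinearMap.map_smulₛₗ, (p _).2, h.redFst_eq_zero_of_mem_torsionBy (r _).2.1]
      · obtain ⟨c, hc⟩ := hdec x
        -- First-block coordinates of a vector killed by `γ ^ s` have zero residue, so the
        -- unrestricted second residues of the `p i` do not matter.
        have h3 : ∀ i, IsLocalRing.residue R (x.1 i) = 0 := fun i =>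
          congrFun (h.redFst_eq_zero_of_mem_torsionBy hx) i
        rw [hc, map_add, map_sum, map_sum]
        simp [LinearMap.map_smulₛₗ, (r _).2.2, h3]
      · exact Prod.ext (funext fun i => Subtype.ext (h1 i)) (funext fun j => Subtype.ext (h2 j))
  rw [← Nat.card_coe_set_eq, Nat.card_congr (Equiv.ofBijective f hf), Nat.card_prod, Nat.card_fun,
    Nat.card_fun, Nat.card_fin, Nat.card_fin, h.card_redFst_ker, h.card_torsionBy_redSnd_ker,
    ← pow_mul, ← pow_mul, ← pow_add]

end IsChainData

end HomCount

/-! ### Lifting decompositions and describing complements as graphs. -/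

section Coordinates

/-- The matrix of `α` is lifted entry by entry along `π`. -/
theorem exists_linearMap_lift {A F : Type*} [CommRing A] [CommRing F] (π : A →+* F)
    (hπ : Function.Surjective π) {k a : ℕ} (α : (Fin k → F) →ₗ[F] (Fin a → F)) :
    ∃ L : (Fin k → A) →ₗ[A] (Fin a → A), ∀ x i, π (L x i) = α (fun j => π (x j)) i := by
  choose g hg using hπ
  refine ⟨Matrix.toLin' ((LinearMap.toMatrix' α).map g), fun x i => ?_⟩
  have h1 : ((LinearMap.toMatrix' α).map g).map π = LinearMap.toMatrix' α := by
    ext i j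
    exact hg _
  rw [Matrix.toLin'_apply, RingHom.map_mulVec, h1]
  exact congrFun (LinearMap.toMatrix'_mulVec α _) i

theorem exists_injective_range_eq {F V : Type*} [Field F] [AddCommGroup V] [Module F V]
    [FiniteDimensional F V] {E : Submodule F V} {k : ℕ} (hE : finrank F E = k) :
    ∃ α : (Fin k → F) →ₗ[F] V, Function.Injective α ∧ LinearMap.range α = E := by
  let ε : (Fin k → F) ≃ₗ[F] E := LinearEquiv.ofFinrankEq _ _ (by rw [finrank_fin_fun, hE])
  refine ⟨E.subtype ∘ₗ ε, E.injective_subtype.comp ε.injective, ?_⟩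
  rw [LinearMap.range_comp, LinearEquiv.range, Submodule.map_top, Submodule.range_subtype]

theorem add_mem_iff_of_isCompl {F V U U' : Type*} [Field F] [AddCommGroup V] [Module F V]
    [AddCommGroup U] [Module F U] [AddCommGroup U'] [Module F U'] {E E' : Submodule F V}
    (hE : IsCompl E E') {α : U →ₗ[F] V} {α' : U' →ₗ[F] V} (hα : LinearMap.range α = E)
    (hα' : LinearMap.range α' = E') (hinj : Function.Injective α') (x : U) (y : U') :
    α x + α' y ∈ E ↔ y = 0 := by
  have hx : α x ∈ E := hα ▸ LinearMap.mem_range_self α x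
  rw [Submodule.add_mem_iff_right _ hx]
  constructor
  · intro hy
    exact (map_eq_zero_iff α' hinj).1
      (Submodule.disjoint_def.1 hE.disjoint _ hy (hα' ▸ LinearMap.mem_range_self α' y))
  · rintro rfl
    rw [map_zero]
    exact E.zero_mem

theorem isCompl_graph_range_inr {R M N : Type*} [CommRing R] [AddCommGroup M] [Module R M]
    [AddCommGroup N] [Module R N] (φ : M →ₗ[R] N) :
    IsCompl φ.graph (LinearMap.range (LinearMap.inr R M N)) := by
  refine ⟨Submodule.disjoint_def.2 ?_, codisjoint_iff.2 (eq_top_iff.2 fun x _ => ?_)⟩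
  · rintro _ hx ⟨y, rfl⟩
    rw [LinearMap.mem_graph_iff, LinearMap.inr_apply, map_zero] at hx
    exact Prod.ext rfl hx
  · refine Submodule.mem_sup.2 ⟨(x.1, φ x.1), rfl, _, ⟨x.2 - φ x.1, rfl⟩, ?_⟩
    simp

theorem exists_eq_graph_of_isCompl {R M N : Type*} [CommRing R] [AddCommGroup M] [Module R M]
    [AddCommGroup N] [Module R N] {G : Submodule R (M × N)}
    (hG : IsCompl G (LinearMap.range (LinearMap.inr R M N))) : ∃ φ : M →ₗ[R] N, G = φ.graph := by
  refine Submodule.exists_eq_graph ⟨?_, fun x => ?_⟩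
  · change Function.Injective (LinearMap.fst R M N ∘ₗ G.subtype)
    rw [injective_iff_map_eq_zero]
    rintro ⟨x, hx⟩ h0
    have h0 : x.1 = 0 := h0
    exact Subtype.ext (Submodule.disjoint_def.1 hG.disjoint x hx ⟨x.2, Prod.ext h0.symm rfl⟩)
  · obtain ⟨g, hg, _, ⟨y, rfl⟩, hgy⟩ := Submodule.mem_sup.1
      (hG.sup_eq_top ▸ Submodule.mem_top : ((x, 0) : M × N) ∈ _)
    refine ⟨⟨g, hg⟩, ?_⟩
    have := congrArg Prod.fst hgy
    simpa using this

theorem map_mem_torsionBy {R M N : Type*} [CommRing R] [AddCommGroup M] [Module R M]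
    [AddCommGroup N] [Module R N] (f : M →ₗ[R] N) {r : R} {x : M}
    (hx : x ∈ Submodule.torsionBy R M r) : f x ∈ Submodule.torsionBy R N r := by
  rw [Submodule.mem_torsionBy_iff] at hx ⊢
  rw [← map_smul, hx, map_zero]

namespace IsChainData

variable {R : Type*} [CommRing R] [IsLocalRing R] {γ : R} {e s a b k l k' l' : ℕ}
  (h : IsChainData γ e s)

theorem exists_mixedSpace_lift
    (α : (Fin k → IsLocalRing.ResidueField R) →ₗ[IsLocalRing.ResidueField R]
      (Fin a → IsLocalRing.ResidueField R))
    (β : (Fin l → IsLocalRing.ResidueField R) →ₗ[IsLocalRing.ResidueField R]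
      (Fin b → IsLocalRing.ResidueField R)) :
    ∃ L : MixedSpace γ s k l →ₗ[R] MixedSpace γ s a b,
      (∀ x, redFst R γ s a b (L x) = α (redFst R γ s k l x)) ∧
      ∀ x, h.redSnd a b (L x) = β (h.redSnd k l x) := by
  obtain ⟨L₁, h1⟩ := exists_linearMap_lift _ IsLocalRing.residue_surjective α
  obtain ⟨L₂, h2⟩ := exists_linearMap_lift _ h.resCheck_surjective β
  exact ⟨L₁.prodMap (L₂.restrictScalars R), fun x => funext fun i => h1 x.1 i,
    fun x => funext fun i => h2 x.2 i⟩

variable [Finite R]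

/-- Decompositions of the residue spaces lift to a decomposition of the mixed space into mixed
spaces. -/
theorem exists_splitting {X X' : Submodule (IsLocalRing.ResidueField R)
      (Fin a → IsLocalRing.ResidueField R)}
    {W W' : Submodule (IsLocalRing.ResidueField R) (Fin b → IsLocalRing.ResidueField R)}
    (hX : IsCompl X X') (hW : IsCompl W W') (hk : finrank (IsLocalRing.ResidueField R) X = k)
    (hk' : finrank (IsLocalRing.ResidueField R) X' = k')
    (hl : finrank (IsLocalRing.ResidueField R) W = l)
    (hl' : finrank (IsLocalRing.ResidueField R) W' = l') :
    ∃ Φ : (MixedSpace γ s k l × MixedSpace γ s k' l') ≃ₗ[R] MixedSpace γ s a b,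
      (∀ n, redFst R γ s a b (Φ n) ∈ X ↔ redFst R γ s k' l' n.2 = 0) ∧
      (∀ n, h.redSnd a b (Φ n) ∈ W ↔ h.redSnd k' l' n.2 = 0) ∧
      h.resFst ((LinearMap.range (LinearMap.inr R _ _)).map Φ.toLinearMap) = X' ∧
      h.resSnd ((LinearMap.range (LinearMap.inr R _ _)).map Φ.toLinearMap) = W' := by
  obtain ⟨α, -, hα⟩ := exists_injective_range_eq hk
  obtain ⟨α', hαi, hα'⟩ := exists_injective_range_eq hk'
  obtain ⟨β, -, hβ⟩ := exists_injective_range_eq hl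
  obtain ⟨β', hβi, hβ'⟩ := exists_injective_range_eq hl'
  obtain ⟨L, hL1, hL2⟩ := h.exists_mixedSpace_lift α β
  obtain ⟨L', hL1', hL2'⟩ := h.exists_mixedSpace_lift α' β'
  have h1 : ∀ n, redFst R γ s a b (L.coprod L' n) =
      α (redFst R γ s k l n.1) + α' (redFst R γ s k' l' n.2) := fun n => by
    rw [LinearMap.coprod_apply, map_add, hL1, hL1']
  have h2 : ∀ n, h.redSnd a b (L.coprod L' n) =
      β (h.redSnd k l n.1) + β' (h.redSnd k' l' n.2) := fun n => by
    rw [LinearMap.coprod_apply, map_add, hL2, hL2']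
  -- The residues of the range are full, so Nakayama applies; for the second residue the preimages
  -- must be chosen among vectors killed by `γ ^ s`. Injectivity then follows by comparing
  -- cardinalities.
  have hsurj : Function.Surjective (L.coprod L') := by
    rw [← LinearMap.range_eq_top]
    refine h.eq_top_of_res (eq_top_iff.2 fun z _ => ?_) (eq_top_iff.2 fun z _ => ?_)
    · obtain ⟨_, ⟨x, rfl⟩, _, ⟨y, rfl⟩, rfl⟩ := Submodule.mem_sup.1
        (by rw [hα, hα', hX.sup_eq_top]; trivial :
          z ∈ LinearMap.range α ⊔ LinearMap.range α')
      obtain ⟨x, rfl⟩ := redFst_surjective (γ := γ) (s := s) (b := l) x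
      obtain ⟨y, rfl⟩ := redFst_surjective (γ := γ) (s := s) (b := l') y
      exact ⟨L.coprod L' (x, y), LinearMap.mem_range_self _ _, h1 _⟩
    · obtain ⟨_, ⟨x, rfl⟩, _, ⟨y, rfl⟩, rfl⟩ := Submodule.mem_sup.1
        (by rw [hβ, hβ', hW.sup_eq_top]; trivial :
          z ∈ LinearMap.range β ⊔ LinearMap.range β')
      obtain ⟨x, hx, rfl⟩ := h.exists_redSnd_eq (a := k) x
      obtain ⟨y, hy, rfl⟩ := h.exists_redSnd_eq (a := k') y
      exact ⟨L.coprod L' (x, y), ⟨LinearMap.mem_range_self _ _,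
        map_mem_torsionBy _ (Prod.ext hx hy)⟩, h2 _⟩
  have hka : k + k' = a := by
    rw [← hk, ← hk', Submodule.finrank_add_eq_of_isCompl hX, finrank_fin_fun]
  have hlb : l + l' = b := by
    rw [← hl, ← hl', Submodule.finrank_add_eq_of_isCompl hW, finrank_fin_fun]
  have hbij : Function.Bijective (L.coprod L') := by
    refine hsurj.bijective_of_nat_card_le (le_of_eq ?_)
    rw [Nat.card_prod, h.card_mixedSpace, h.card_mixedSpace, h.card_mixedSpace, ← pow_add, ← hka,
      ← hlb]
    congr 1
    ring
  refine ⟨LinearEquiv.ofBijective _ hbij, fun n => ?_, fun n => ?_, ?_, ?_⟩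
  · rw [LinearEquiv.ofBijective_apply, h1, add_mem_iff_of_isCompl hX hα hα' hαi]
  · rw [LinearEquiv.ofBijective_apply, h2, add_mem_iff_of_isCompl hW hβ hβ' hβi]
  · rw [← hα']
    ext z
    constructor
    · rintro ⟨_, ⟨_, ⟨y, rfl⟩, rfl⟩, rfl⟩
      refine ⟨redFst R γ s k' l' y, ?_⟩
      exact ((h1 (0, y)).trans (by simp)).symm
    · rintro ⟨y, rfl⟩
      obtain ⟨y, rfl⟩ := redFst_surjective (γ := γ) (s := s) (b := l') y
      exact ⟨_, ⟨_, ⟨y, rfl⟩, rfl⟩, (h1 (0, y)).trans (by simp)⟩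
  · rw [← hβ']
    ext z
    constructor
    · rintro ⟨_, ⟨⟨_, ⟨y, rfl⟩, rfl⟩, -⟩, rfl⟩
      refine ⟨h.redSnd k' l' y, ?_⟩
      exact ((h2 (0, y)).trans (by simp)).symm
    · rintro ⟨y, rfl⟩
      obtain ⟨y, hy, rfl⟩ := h.exists_redSnd_eq (a := k') y
      exact ⟨_, ⟨⟨_, ⟨y, rfl⟩, rfl⟩, map_mem_torsionBy _ (map_mem_torsionBy _ hy)⟩,
        (h2 (0, y)).trans (by simp)⟩

omit [Finite R] in
/-- The complements with prescribed bounds on the residue codes are graphs of maps with vanishing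
residues. -/
theorem ncard_isCompl_res_le
    {X : Submodule (IsLocalRing.ResidueField R) (Fin a → IsLocalRing.ResidueField R)}
    {W : Submodule (IsLocalRing.ResidueField R) (Fin b → IsLocalRing.ResidueField R)}
    (Φ : (MixedSpace γ s k l × MixedSpace γ s k' l') ≃ₗ[R] MixedSpace γ s a b)
    (hΦ1 : ∀ n, redFst R γ s a b (Φ n) ∈ X ↔ redFst R γ s k' l' n.2 = 0)
    (hΦ2 : ∀ n, h.redSnd a b (Φ n) ∈ W ↔ h.redSnd k' l' n.2 = 0) :
    {C | IsCompl C ((LinearMap.range (LinearMap.inr R _ _)).map Φ.toLinearMap) ∧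
      h.resFst C ≤ X ∧ h.resSnd C ≤ W}.ncard = (h.smallHoms k l k' l').ncard := by
  have himage : {C | IsCompl C ((LinearMap.range (LinearMap.inr R _ _)).map Φ.toLinearMap) ∧
      h.resFst C ≤ X ∧ h.resSnd C ≤ W} =
      (fun φ => φ.graph.map Φ.toLinearMap) '' h.smallHoms k l k' l' := by
    ext C
    constructor
    · rintro ⟨hC, hCX, hCW⟩
      obtain ⟨G, rfl⟩ := (Submodule.orderIsoMapComap Φ).surjective C
      have hG : IsCompl G (LinearMap.range (LinearMap.inr R _ _)) :=
        (Submodule.orderIsoMapComap Φ).isCompl_iff.2 hC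
      obtain ⟨φ, rfl⟩ := exists_eq_graph_of_isCompl hG
      refine ⟨φ, ⟨fun x => ?_, fun x hx => ?_⟩, rfl⟩
      · exact (hΦ1 (x, φ x)).1 (hCX ⟨_, ⟨_, rfl, rfl⟩, rfl⟩)
      · have hT : (x, φ x) ∈ Submodule.torsionBy R (MixedSpace γ s k l × MixedSpace γ s k' l')
            (γ ^ s) := Prod.ext hx (map_mem_torsionBy φ hx)
        exact (hΦ2 (x, φ x)).1 (hCW ⟨_, ⟨⟨_, rfl, rfl⟩, map_mem_torsionBy Φ.toLinearMap hT⟩, rfl⟩)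
    · rintro ⟨φ, ⟨h1, h2⟩, rfl⟩
      refine ⟨(Submodule.orderIsoMapComap Φ).isCompl_iff.1 (isCompl_graph_range_inr φ), ?_, ?_⟩
      · rintro _ ⟨_, ⟨x, hx, rfl⟩, rfl⟩
        refine (hΦ1 x).2 ?_
        rw [show x.2 = φ x.1 from hx]
        exact h1 _
      · rintro _ ⟨_, ⟨⟨x, hx, rfl⟩, hxT⟩, rfl⟩
        refine (hΦ2 x).2 ?_
        rw [show x.2 = φ x.1 from hx]
        have hxT' : Φ.symm (Φ x) ∈ Submodule.torsionBy R _ (γ ^ s) :=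
          map_mem_torsionBy Φ.symm.toLinearMap hxT
        rw [Φ.symm_apply_apply] at hxT'
        exact h2 _ (map_mem_torsionBy (LinearMap.fst R _ _) hxT')
  rw [himage]
  refine Set.ncard_image_of_injective _ fun φ ψ hφψ => ?_
  have hg := (Submodule.orderIsoMapComap Φ).injective hφψ
  refine LinearMap.ext fun x => ?_
  have hx : (x, φ x) ∈ ψ.graph := hg ▸ (rfl : (x, φ x) ∈ φ.graph)
  exact hx

/-- The number of LCD codes with given residue codes. -/
theorem ncard_isMixedLCD_res_eq
    {X : Submodule (IsLocalRing.ResidueField R) (Fin a → IsLocalRing.ResidueField R)}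
    {W : Submodule (IsLocalRing.ResidueField R) (Fin b → IsLocalRing.ResidueField R)}
    (hX : X ∈ nondegSub (stdForm _ a) ⊤ k) (hW : W ∈ nondegSub (stdForm _ b) ⊤ l) :
    {C : Submodule R (MixedSpace γ s a b) | IsMixedLCD γ h.lt.le h.pow_e C ∧
      h.resFst C = X ∧ h.resSnd C = W}.ncard =
    Nat.card (IsLocalRing.ResidueField R) ^
      ((a - k) * (s * l + (e - 1) * k) + (b - l) * (s * k + (s - 1) * l)) := by
  have hXc := hX.2.1.isCompl (stdForm_isSymm a)
  have hWc := hW.2.1.isCompl (stdForm_isSymm b)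
  have hk' := Submodule.finrank_add_eq_of_isCompl hXc
  have hl' := Submodule.finrank_add_eq_of_isCompl hWc
  rw [hX.2.2, finrank_fin_fun] at hk'
  rw [hW.2.2, finrank_fin_fun] at hl'
  obtain ⟨Φ, hΦ1, hΦ2, hΦX, hΦW⟩ := h.exists_splitting hXc hWc hX.2.2
    (Nat.eq_sub_of_add_eq' hk') hW.2.2 (Nat.eq_sub_of_add_eq' hl')
  -- The image of the first factor serves only to show that the lift `D` of the orthogonal residue
  -- spaces is a direct summand.
  have hU : IsCompl ((LinearMap.range (LinearMap.inl R _ _)).map Φ.toLinearMap)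
      ((LinearMap.range (LinearMap.inr R _ _)).map Φ.toLinearMap) :=
    (Submodule.orderIsoMapComap Φ).isCompl_iff.1 LinearMap.isCompl_range_inl_inr
  have := h.ncard_isCompl_res_le Φ hΦ1 hΦ2
  rw [h.ncard_smallHoms] at this
  rw [Set.ext fun C => h.isMixedLCD_and_res_eq_iff hX.2.1 hW.2.1 hU hΦX hΦW C, this]
  congr 1
  ring

end IsChainData

end Coordinates

/-! ### Assembling the count. -/

section Main

namespace IsChainData

variable {R : Type*} [CommRing R] [IsLocalRing R] [Finite R] {γ : R} {e s : ℕ}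
  (h : IsChainData γ e s)

/-- The LCD codes whose residue codes have dimensions `k` and `l`. -/
def lcdOfRank (a b k l : ℕ) : Set (Submodule R (MixedSpace γ s a b)) :=
  {C | IsMixedLCD γ h.lt.le h.pow_e C ∧
    finrank (IsLocalRing.ResidueField R) (h.resFst C) = k ∧
    finrank (IsLocalRing.ResidueField R) (h.resSnd C) = l}

theorem ncard_lcdOfRank (a b k l : ℕ) : ((h.lcdOfRank a b k l).ncard : ℚ) =
    fieldLCDCount (IsLocalRing.ResidueField R) a k *
      fieldLCDCount (IsLocalRing.ResidueField R) b l *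
      (Nat.card (IsLocalRing.ResidueField R) : ℚ) ^
        ((a - k) * (s * l + (e - 1) * k) + (b - l) * (s * k + (s - 1) * l)) := by
  have key := ncard_mul_eq_of_fibers (S := h.lcdOfRank a b k l)
    (T := nondegSub (stdForm (IsLocalRing.ResidueField R) a) ⊤ k ×ˢ
      nondegSub (stdForm (IsLocalRing.ResidueField R) b) ⊤ l)
    (fun C XW => h.resFst C = XW.1 ∧ h.resSnd C = XW.2) (m := 1)
    (n := (Nat.card (IsLocalRing.ResidueField R) : ℚ) ^
      ((a - k) * (s * l + (e - 1) * k) + (b - l) * (s * k + (s - 1) * l))) ?_ ?_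
  · rw [mul_one, Set.ncard_prod, Nat.cast_mul] at key
    rw [key, fieldLCDCount_eq_ncard, fieldLCDCount_eq_ncard]
  · rintro C ⟨hC, hk, hl⟩
    rw [Nat.cast_eq_one, Set.ncard_eq_one]
    refine ⟨(h.resFst C, h.resSnd C), Set.eq_singleton_iff_unique_mem.2 ⟨⟨⟨?_, ?_⟩, rfl, rfl⟩, ?_⟩⟩
    · exact ⟨le_top, h.nondegOn_resFst hC, hk⟩
    · exact ⟨le_top, h.nondegOn_resSnd hC, hl⟩
    · rintro XW ⟨-, h1, h2⟩
      exact Prod.ext h1.symm h2.symm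
  · rintro ⟨X, W⟩ ⟨hX, hW⟩
    rw [← Nat.cast_pow, ← h.ncard_isMixedLCD_res_eq hX hW]
    congr 2
    ext C
    constructor
    · rintro ⟨⟨hC, -, -⟩, h1, h2⟩
      exact ⟨hC, h1, h2⟩
    · rintro ⟨hC, rfl, rfl⟩
      exact ⟨⟨hC, hX.2.2, hW.2.2⟩, rfl, rfl⟩

theorem card_isMixedLCD (a b : ℕ) :
    Nat.card {C : Submodule R (MixedSpace γ s a b) // IsMixedLCD γ h.lt.le h.pow_e C} =
      ∑ k ∈ Finset.range (a + 1), ∑ l ∈ Finset.range (b + 1), (h.lcdOfRank a b k l).ncard := by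
  classical
  have := Fintype.ofFinite (Submodule R (MixedSpace γ s a b))
  have h1 := Finset.card_eq_sum_card_fiberwise
    (s := Finset.univ.filter fun C : Submodule R (MixedSpace γ s a b) =>
      IsMixedLCD γ h.lt.le h.pow_e C)
    (t := Finset.range (a + 1) ×ˢ Finset.range (b + 1))
    (f := fun C => (finrank (IsLocalRing.ResidueField R) (h.resFst C),
      finrank (IsLocalRing.ResidueField R) (h.resSnd C))) (fun C _ => by
        have h2 := Submodule.finrank_le (h.resFst C)
        have h3 := Submodule.finrank_le (h.resSnd C)
        rw [finrank_fin_fun] at h2 h3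
        simp only [Finset.coe_product, Set.mem_prod, Finset.mem_coe, Finset.mem_range]
        omega)
  rw [Nat.card_eq_fintype_card, Fintype.card_subtype, h1, Finset.sum_product]
  refine Finset.sum_congr rfl fun k _ => Finset.sum_congr rfl fun l _ => ?_
  rw [← Set.ncard_coe_finset]
  congr 1
  ext C
  simp [lcdOfRank]

end IsChainData

end Main

/-- `R` is a finite commutative chain ring: finite, local, with principal maximal ideal `γR`. -/
theorem mainTheorem4 {R : Type*} [CommRing R] [Finite R] [IsLocalRing R]
    (γ : R) (hγ : IsLocalRing.maximalIdeal R = Ideal.span {γ})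
    (e s : ℕ) (he2 : 2 ≤ e) (he : γ ^ e = 0) (he_min : γ ^ (e - 1) ≠ 0)
    (hs1 : 1 ≤ s) (hse : s < e)
    (q : ℕ) (hq : Nat.card (IsLocalRing.ResidueField R) = q)
    (a b : ℕ) (ha : 0 < a) (hb : 0 < b) :
    (Nat.card {C : Submodule R (MixedSpace γ s a b) // IsMixedLCD γ hse.le he C} : ℚ) =
        ∑ k ∈ Finset.range (a + 1), ∑ l ∈ Finset.range (b + 1),
          lcdFormula q a k * lcdFormula q b l *
            (q : ℚ) ^ ((a - k) * (s * l + (e - 1) * k) + (b - l) * (s * k + (s - 1) * l)) ∧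
      ∀ n r : ℕ, 0 < n → r ≤ n →
        (fieldLCDCount (IsLocalRing.ResidueField R) n r : ℚ) = lcdFormula q n r := by
  have h : IsChainData γ e s := ⟨hγ, he, he_min, hs1, hse⟩
  have := Fintype.ofFinite (IsLocalRing.ResidueField R)
  have hcount : ∀ n r : ℕ, 0 < n → r ≤ n →
      (fieldLCDCount (IsLocalRing.ResidueField R) n r : ℚ) = lcdFormula q n r := fun n r hn hr => by
    rw [fieldLCDCount_eq hn hr, ← hq, Nat.card_eq_fintype_card]
  refine ⟨?_, hcount⟩
  rw [h.card_isMixedLCD a b, Nat.cast_sum]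
  refine Finset.sum_congr rfl fun k hk => ?_
  rw [Nat.cast_sum]
  refine Finset.sum_congr rfl fun l hl => ?_
  rw [h.ncard_lcdOfRank, hcount a k ha (Nat.lt_succ_iff.1 (Finset.mem_range.1 hk)),
    hcount b l hb (Nat.lt_succ_iff.1 (Finset.mem_range.1 hl)), hq]
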